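/- Let $k$ be a finite field and let $\mathcal A$ be an essentially small $k$-linear abelian category with finite-dimensional spaces $\mathrm{Hom}(X,Y)$ and $\mathrm{Ext}^1(X,Y)$, which is hereditary, i.e. $\mathrm{Ext}^i_{\mathcal A}=0$ for all $i\ge 2$. For $T\in\mathcal A$ let $\mathrm{add}\,T$ be the full subcategory of direct summands of finite direct sums of copies of $T$ and $\mathrm{Fac}\,T$ that of quotients of objects of $\mathrm{add}\,T$. Let $T$ be a tilting object, i.e. there is a torsion pair $(\mathcal T,\mathcal F)$ in $\mathcal A$ such that (1) every object of $\mathcal A$ embeds into an object of $\mathcal T$; (2) $\mathcal T=\mathrm{Fac}\,T$; (3) $\mathrm{Ext}^i(T,X)=0$ for $X\in\mathcal T$, $i>0$; (4) if $Z\in\mathcal T$ and $\mathrm{Ext}^i(Z,X)=0$ for all $X\in\mathcal T$, $i>0$, then $Z\in\mathrm{add}\,T$; (5) if $\mathrm{Ext}^i(T,X)=0$ for all $i\ge 0$, then $X=0$. For $\mathcal E=\mathcal A$ or $\mathcal E=\mathrm{add}\,T$ (an extension-closed subcategory of $\mathcal A$) let $\mathcal C_{\mathbb Z/2}(\mathcal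 E)$ be the exact category of $\mathbb Z/2$-graded complexes over $\mathcal E$, and $\mathcal H(\mathcal C_{\mathbb Z/2}(\mathcal E))$ its Hall algebra: the unital associative $\mathbb Q$-algebra with basis the isomorphism classes $[M]$ and product $$[L]\diamond[M]=\sum_{[X]}\frac{|\mathrm{Ext}^1(L,M)_X|}{|\mathrm{Hom}(L,M)|}\,[X],$$ where $\mathrm{Ext}^1(L,M)_X$ is the set of classes of extensions $0\to M\to Y\to L\to 0$ with $Y\cong X$. Let $I_{\mathbb Z/2}$ be the two-sided ideal of $\mathcal H(\mathcal C_{\mathbb Z/2}(\mathcal A))$ generated by all $[L]-[K\oplus M]$ for which there is a short exact sequence $0\to K\to L\to M\to 0$ with $K$ acyclic. Let $S_{\mathbb Z/2}\subset \mathcal H(\mathcal C_{\mathbb Z/2}(\mathcal A))/I_{\mathbb Z/2}$ be the set of all $q[K]$ with $q\in\mathbb Q^\times$ and $K$ an acyclic complex over $\mathcal A$, and $T_{\mathbb Z/2}\subset\mathcal H(\mathcal C_{\mathbb Z/2}(\mathrm{add}\,T))$ the set of all $q[K]$ with $q\in\mathbb Q^\times$ and $K$ an acyclic complex with components in $\mathrm{add}\,T$.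 For $M,K\in\mathcal C_{\mathbb Z/2}(\mathcal A)$ with $K$ acyclic put $\langle [M],[K]\rangle=\prod_{p\ge 0}|\mathrm{Ext}^p_{\mathcal C_{\mathbb Z/2}(\mathcal A)}(M,K)|^{(-1)^p}$. A $T$-resolution of $M\in\mathcal C_{\mathbb Z/2}(\mathcal A)$ is a pair of short exact sequences of complexes $$0\to M\xrightarrow{w}X\to T_2\to 0,\qquad 0\to T_1\to T_0\xrightarrow{u_0}X\to 0$$ with $w,u_0$ quasi-isomorphisms, $X\in\mathcal C_{\mathbb Z/2}(\mathcal T)$ and $T_0,T_1,T_2\in\mathcal C_{\mathbb Z/2}(\mathrm{add}\,T)$. Then the right localizations (rings of right fractions) $\mathcal H(\mathcal C_{\mathbb Z/2}(\mathrm{add}\,T))[T_{\mathbb Z/2}^{-1}]$ and $\mathcal{MH}_{\mathbb Z/2}(\mathcal A):=(\mathcal H(\mathcal C_{\mathbb Z/2}(\mathcal A))/I_{\mathbb Z/2})[S_{\mathbb Z/2}^{-1}]$ exist, every $M\in\mathcal C_{\mathbb Z/2}(\mathcal A)$ has a $T$-resolution, and $[M]\mapsto[M]$ defines a homomorphism of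 $\mathbb Q$-algebras $$\phi:\mathcal H(\mathcal C_{\mathbb Z/2}(\mathrm{add}\,T))\to\mathcal H(\mathcal C_{\mathbb Z/2}(\mathcal A)).$$ (i) $\phi$ induces an isomorphism of $\mathbb Q$-algebras $\widetilde\phi:\mathcal H(\mathcal C_{\mathbb Z/2}(\mathrm{add}\,T))[T_{\mathbb Z/2}^{-1}]\xrightarrow{\ \sim\ }\mathcal{MH}_{\mathbb Z/2}(\mathcal A)$. (ii) For every $M\in\mathcal C_{\mathbb Z/2}(\mathcal A)$ and every $T$-resolution of $M$ as above, $[T_1\oplus T_2]$ is invertible in $\mathcal H(\mathcal C_{\mathbb Z/2}(\mathrm{add}\,T))[T_{\mathbb Z/2}^{-1}]$ and $$\widetilde\phi^{-1}([M])=\frac{1}{\langle [M],[T_1\oplus T_2]\rangle}\,[T_0]\diamond[T_1\oplus T_2]^{-1}.$$ -/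

import Mathlib

open CategoryTheory CategoryTheory.Limits CategoryTheory.Abelian ZeroObject

universe w v u

set_option linter.unusedSectionVars false

attribute [local instance] CategoryTheory.HasExt.standard
attribute [local instance] CategoryTheory.Abelian.hasFiniteBiproducts

namespace ModifiedHall

section Counting

lemma sum_card_fiber {E J : Type*} [Finite E] (F : J → Type*) [∀ j, Finite (F j)]
    (Q : ∀ j, E → F j → Prop) (β : J → ℚ) (hβ : ∀ j, β j ≠ 0)
    (h : ∀ e, ∃ j₀, (Nat.card {f : F j₀ // Q j₀ e f} : ℚ) = β j₀ ∧
      ∀ j ≠ j₀, IsEmpty {f : F j // Q j e f})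
    (t : Finset J) (ht : ∀ j, Nonempty (F j) → j ∈ t) :
    ∑ j ∈ t, (Nat.card {x : E × F j // Q j x.1 x.2} : ℚ) / β j = Nat.card E := by
  classical
  have := Fintype.ofFinite E
  have h₁ (j : J) : (Nat.card {x : E × F j // Q j x.1 x.2} : ℚ) =
      ∑ e : E, (Nat.card {f : F j // Q j e f} : ℚ) := by
    rw [← Nat.cast_sum, ← Nat.card_sigma]
    exact congrArg _ (Nat.card_congr
      ⟨fun x ↦ ⟨x.1.1, x.1.2, x.2⟩, fun x ↦ ⟨(x.1, x.2.1), x.2.2⟩, fun _ ↦ rfl, fun _ ↦ rfl⟩)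
  simp_rw [h₁, Finset.sum_div]
  rw [Finset.sum_comm]
  have h₂ (e : E) : ∑ j ∈ t, (Nat.card {f : F j // Q j e f} : ℚ) / β j = 1 := by
    obtain ⟨j₀, h₀, h₀'⟩ := h e
    have hj₀ : j₀ ∈ t := by
      have hne : Nat.card {f : F j₀ // Q j₀ e f} ≠ 0 := by
        intro hz
        rw [hz] at h₀
        exact hβ j₀ (by simpa using h₀.symm)
      obtain ⟨f⟩ := (Nat.card_ne_zero.1 hne).1
      exact ht j₀ ⟨f.1⟩
    rw [Finset.sum_eq_single_of_mem j₀ hj₀, h₀, div_self (hβ j₀)]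
    intro j _ hj
    have := h₀' j hj
    simp
  simp [h₂]

lemma double_count {I J : Type*} (E : I → Type*) (F : J → Type*) [∀ i, Finite (E i)]
    [∀ j, Finite (F j)] (Q : ∀ i j, E i → F j → Prop) (α : I → ℚ) (β : J → ℚ)
    (hα : ∀ i, α i ≠ 0) (hβ : ∀ j, β j ≠ 0)
    (hE : ∀ i (e : E i), ∃ j₀, (Nat.card {f : F j₀ // Q i j₀ e f} : ℚ) = β j₀ ∧
      ∀ j ≠ j₀, IsEmpty {f : F j // Q i j e f})
    (hF : ∀ j (f : F j), ∃ i₀, (Nat.card {e : E i₀ // Q i₀ j e f} : ℚ) = α i₀ ∧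
      ∀ i ≠ i₀, IsEmpty {e : E i // Q i j e f})
    (s : Finset I) (hs : ∀ i, Nonempty (E i) → i ∈ s)
    (t : Finset J) (ht : ∀ j, Nonempty (F j) → j ∈ t) :
    ∑ i ∈ s, (Nat.card (E i) : ℚ) / α i = ∑ j ∈ t, (Nat.card (F j) : ℚ) / β j := by
  have h₁ (i : I) := sum_card_fiber F (Q i) β hβ (hE i) t ht
  have h₂ (j : J) := sum_card_fiber E (fun i f e ↦ Q i j e f) α hα (hF j) s hs
  simp_rw [← h₁, ← h₂, Finset.sum_div]
  rw [Finset.sum_comm]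
  refine Finset.sum_congr rfl fun j _ ↦ Finset.sum_congr rfl fun i _ ↦ ?_
  rw [Nat.card_congr (β := {x : F j × E i // Q i j x.2 x.1})
    ⟨fun x ↦ ⟨(x.1.2, x.1.1), x.2⟩, fun x ↦ ⟨(x.1.2, x.1.1), x.2⟩, fun _ ↦ rfl, fun _ ↦ rfl⟩,
    div_right_comm]
end Counting

section Extensions

variable {C : Type u} [Category.{v} C] [Abelian C]

/-- `0 ⟶ X ⟶ Y ⟶ Z ⟶ 0` (with maps `i` and `p`) is a short exact sequence. -/
def IsSES {X Y Z : C} (i : X ⟶ Y) (p : Y ⟶ Z) : Prop :=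
  ∃ w : i ≫ p = 0, (ShortComplex.mk i p w).ShortExact

/-- The class in `Ext¹(Z, X)` of a short exact sequence `0 ⟶ X ⟶ Y ⟶ Z ⟶ 0`. -/
noncomputable def IsSES.extClass {X Y Z : C} {i : X ⟶ Y} {p : Y ⟶ Z} (h : IsSES i p) :
    Ext.{max u v} Z X 1 :=
  h.choose_spec.extClass

/-- `Ext¹(Z, X)_Y`: the classes in `Ext¹(Z, X)` of the extensions of `Z` by `X`
with middle term (isomorphic to) `Y`. -/
def extWithMiddle (Z X Y : C) : Set (Ext.{max u v} Z X 1) :=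
  {e | ∃ (i : X ⟶ Y) (p : Y ⟶ Z) (h : IsSES i p), h.extClass = e}

/-- The structure constant `|Ext¹(Z, X)_Y| / |Hom(Z, X)|`. -/
noncomputable def hallNumber (Z X Y : C) : ℚ :=
  (Nat.card (extWithMiddle Z X Y) : ℚ) / (Nat.card (Z ⟶ X) : ℚ)

/-- The short exact sequences `0 ⟶ X ⟶ Y ⟶ Z ⟶ 0` with the three terms fixed. -/
@[ext]
structure SES (X Y Z : C) : Type v where
  /-- the monomorphism -/
  i : X ⟶ Y
  /-- the epimorphism -/
  p : Y ⟶ Z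
  isSES : IsSES i p

namespace IsSES

variable {X Y Z : C} {i : X ⟶ Y} {p : Y ⟶ Z}

lemma zero (h : IsSES i p) : i ≫ p = 0 := h.choose
lemma shortExact (h : IsSES i p) : (ShortComplex.mk i p h.zero).ShortExact := h.choose_spec
lemma mono (h : IsSES i p) : Mono i := h.shortExact.mono_f
lemma epi (h : IsSES i p) : Epi p := h.shortExact.epi_g

lemma lift (h : IsSES i p) {T : C} (f : T ⟶ Y) (hf : f ≫ p = 0) : ∃ g : T ⟶ X, g ≫ i = f := by
  have := h.mono
  exact ⟨h.shortExact.exact.lift f hf, h.shortExact.exact.lift_f f hf⟩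

lemma desc (h : IsSES i p) {T : C} (f : Y ⟶ T) (hf : i ≫ f = 0) : ∃ g : Z ⟶ T, p ≫ g = f := by
  have := h.epi
  exact ⟨h.shortExact.exact.desc f hf, h.shortExact.exact.g_desc f hf⟩

lemma mk' [Mono i] [Epi p] (w : i ≫ p = 0)
    (h : ∀ {T : C} (f : T ⟶ Y), f ≫ p = 0 →
      ∃ (T' : C) (π : T' ⟶ T) (_ : Epi π) (g : T' ⟶ X), π ≫ f = g ≫ i) : IsSES i p := by
  refine ⟨w, ?_⟩
  have : (ShortComplex.mk i p w).Exact := by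
    rw [ShortComplex.exact_iff_exact_up_to_refinements]
    intro T f hf
    obtain ⟨T', π, hπ, g, hg⟩ := h f hf
    exact ⟨T', π, hπ, g, hg⟩
  exact { exact := this }

lemma comp_iso (h : IsSES i p) {Y' : C} (φ : Y ≅ Y') : IsSES (i ≫ φ.hom) (φ.inv ≫ p) := by
  have := h.mono
  have := h.epi
  refine mk' (by simp [h.zero]) ?_
  intro T f hf
  obtain ⟨g, hg⟩ := h.lift (f ≫ φ.inv) (by simpa using hf)
  exact ⟨T, 𝟙 T, inferInstance, g, by simp [reassoc_of% hg]⟩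

lemma isoLeft (h : IsSES i p) {X' : C} (φ : X' ≅ X) : IsSES (φ.hom ≫ i) p := by
  have := h.mono
  have := h.epi
  refine mk' (by simp [h.zero]) ?_
  intro T f hf
  obtain ⟨g, hg⟩ := h.lift f hf
  exact ⟨T, 𝟙 T, inferInstance, g ≫ φ.inv, by simp [hg]⟩

lemma isoRight (h : IsSES i p) {Z' : C} (φ : Z ≅ Z') : IsSES i (p ≫ φ.hom) := by
  have := h.mono
  have := h.epi
  refine mk' (by simp [reassoc_of% h.zero]) ?_
  intro T f hf
  obtain ⟨g, hg⟩ := h.lift f (by simpa using hf =≫ φ.inv)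
  exact ⟨T, 𝟙 T, inferInstance, g, by simp [hg]⟩

/-- Equivalent extensions have the same class. -/
lemma extClass_eq_of_iso {Y' : C} {i' : X ⟶ Y'} {p' : Y' ⟶ Z}
    (h : IsSES i p) (h' : IsSES i' p') (φ : Y ⟶ Y') (h₁ : i ≫ φ = i') (h₂ : φ ≫ p' = p) :
    h.extClass = h'.extClass := by
  have := h.shortExact.extClass_naturality h'.shortExact
    { τ₁ := 𝟙 X, τ₂ := φ, τ₃ := 𝟙 Z, comm₁₂ := by simp [h₁], comm₂₃ := by simp [h₂] }
  have h₃ : h.shortExact.extClass = h'.shortExact.extClass := by simpa using this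
  exact h₃

/-- Extensions with the same class are equivalent. -/
lemma exists_iso_of_extClass_eq {Y' : C} {i' : X ⟶ Y'} {p' : Y' ⟶ Z}
    (h : IsSES i p) (h' : IsSES i' p') (e : h.extClass = h'.extClass) :
    ∃ φ : Y ≅ Y', i ≫ φ.hom = i' ∧ φ.hom ≫ p' = p := by
  have e' : h.shortExact.extClass = h'.shortExact.extClass := e
  obtain ⟨x, hx⟩ := Ext.contravariant_sequence_exact₁ h.shortExact _ (Ext.mk₀ i') (add_zero 1)
    (by rw [e']; exact h'.shortExact.extClass_comp)
  obtain ⟨φ, rfl⟩ := (Ext.mk₀_bijective _ _).2 x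
  have h₁ : i ≫ φ = i' := by
    apply (Ext.mk₀_bijective _ _).1
    rw [← hx, Ext.mk₀_comp_mk₀]
  obtain ⟨a, ha⟩ := h.desc (φ ≫ p') (by rw [reassoc_of% h₁, h'.zero])
  have hn := h.shortExact.extClass_naturality h'.shortExact
    { τ₁ := 𝟙 X, τ₂ := φ, τ₃ := a, comm₁₂ := by simp [h₁], comm₂₃ := by simp [ha] }
  have hz : (Ext.mk₀ (a - 𝟙 Z)).comp h'.shortExact.extClass (zero_add 1) = 0 := by
    rw [sub_eq_add_neg, Ext.mk₀_add, Ext.mk₀_neg, Ext.add_comp, Ext.neg_comp]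
    simp only [Ext.mk₀_id_comp]
    have : (Ext.mk₀ a).comp h'.shortExact.extClass (zero_add 1) = h'.shortExact.extClass := by
      rw [← e']
      simpa [e'] using hn.symm
    rw [this, add_neg_cancel]
  obtain ⟨x, hx⟩ := Ext.covariant_sequence_exact₃ _ h'.shortExact _ (zero_add 1) hz
  obtain ⟨b, rfl⟩ := (Ext.mk₀_bijective _ _).2 x
  have hb : b ≫ p' = a - 𝟙 Z := by
    apply (Ext.mk₀_bijective _ _).1
    rw [← hx, Ext.mk₀_comp_mk₀]
  let ψ : Y ⟶ Y' := φ - p ≫ b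
  have k₁ : i ≫ ψ = i' := by simp [ψ, h₁, reassoc_of% h.zero]
  have k₂ : ψ ≫ p' = p := by simp [ψ, hb, ha]
  have : IsIso ψ := by
    let f : ShortComplex.mk i p h.zero ⟶ ShortComplex.mk i' p' h'.zero :=
      { τ₁ := 𝟙 X, τ₂ := ψ, τ₃ := 𝟙 Z, comm₁₂ := by simp [k₁], comm₂₃ := by simp [k₂] }
    have i1 : IsIso f.τ₁ := inferInstanceAs (IsIso (𝟙 X))
    have i3 : IsIso f.τ₃ := inferInstanceAs (IsIso (𝟙 Z))
    exact ShortComplex.isIso₂_of_shortExact_of_isIso₁₃ f h.shortExact h'.shortExact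
  exact ⟨asIso ψ, k₁, k₂⟩

end IsSES


section Riedtmann

variable {X Y Z : C}

/-- The automorphism `1 + p h i` of the middle term of an extension. -/
@[simps]
def IsSES.shear {i : X ⟶ Y} {p : Y ⟶ Z} (h : IsSES i p) (t : Z ⟶ X) : Y ≅ Y where
  hom := 𝟙 Y + p ≫ t ≫ i
  inv := 𝟙 Y - p ≫ t ≫ i
  hom_inv_id := by simp [reassoc_of% h.zero]
  inv_hom_id := by simp [reassoc_of% h.zero]

/-- The class of a short exact sequence, as an element of `Ext¹(Z, X)_Y`. -/
noncomputable def SES.cls (w : SES X Y Z) : extWithMiddle Z X Y :=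
  ⟨w.isSES.extClass, w.i, w.p, w.isSES, rfl⟩

/-- A chosen short exact sequence with a given class. -/
noncomputable def chosenSES (e : extWithMiddle Z X Y) : SES X Y Z :=
  ⟨e.2.choose, e.2.choose_spec.choose, e.2.choose_spec.choose_spec.choose⟩

lemma cls_chosenSES (e : extWithMiddle Z X Y) : (chosenSES e).cls = e :=
  Subtype.ext e.2.choose_spec.choose_spec.choose_spec

lemma SES.exists_iso (w w' : SES X Y Z) (h : w.cls = w'.cls) : ∃ φ : Y ≅ Y,
    w.i ≫ φ.hom = w'.i ∧ φ.hom ≫ w'.p = w.p :=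
  IsSES.exists_iso_of_extClass_eq w.isSES w'.isSES (congrArg Subtype.val h)

/-- A chosen equivalence of extensions. -/
noncomputable def chosenIso (w : SES X Y Z) : Y ≅ Y :=
  ((chosenSES w.cls).exists_iso w (cls_chosenSES w.cls)).choose

lemma chosenIso_i (w : SES X Y Z) : (chosenSES w.cls).i ≫ (chosenIso w).hom = w.i :=
  ((chosenSES w.cls).exists_iso w (cls_chosenSES w.cls)).choose_spec.1

lemma chosenIso_p (w : SES X Y Z) : (chosenIso w).inv ≫ (chosenSES w.cls).p = w.p := by
  rw [Iso.inv_comp_eq]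
  exact ((chosenSES w.cls).exists_iso w (cls_chosenSES w.cls)).choose_spec.2.symm

lemma riedtmann_bijective : Function.Bijective
    (fun x : SES X Y Z × (Z ⟶ X) ↦ ((x.1.cls, ((chosenSES x.1.cls).isSES.shear x.2).trans
      (chosenIso x.1)) : extWithMiddle Z X Y × (Y ≅ Y))) := by
  constructor
  · rintro ⟨w, t⟩ ⟨w', t'⟩ hw
    obtain ⟨h₁, h₂⟩ := Prod.ext_iff.1 hw
    dsimp only at h₁ h₂
    have hww : w = w' := by
      have a₁ := chosenIso_i w
      have a₂ := chosenIso_p w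
      have b₁ := chosenIso_i w'
      have b₂ := chosenIso_p w'
      generalize chosenIso w = φ at *
      generalize chosenIso w' = φ' at *
      rw [h₁] at a₁ a₂
      simp only [h₁] at h₂
      have hz := (chosenSES w'.cls).isSES.zero
      have h₃ := congrArg Iso.hom h₂
      have h₄ := congrArg Iso.inv h₂
      simp only [Iso.trans_hom, Iso.trans_inv, IsSES.shear_hom, IsSES.shear_inv] at h₃ h₄
      ext
      · have := (chosenSES w'.cls).i ≫= h₃
        simpa [reassoc_of% hz, a₁, b₁] using this
      · have := h₄ =≫ (chosenSES w'.cls).p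
        simpa [hz, a₂, b₂] using this
    subst hww
    have h₃ := congrArg Iso.hom h₂
    have := (chosenSES w.cls).isSES.epi
    have := (chosenSES w.cls).isSES.mono
    simp only [Iso.trans_hom, IsSES.shear_hom, cancel_mono, add_right_inj, cancel_epi] at h₃
    rw [h₃]
  · rintro ⟨e, ψ⟩
    let w : SES X Y Z := ⟨(chosenSES e).i ≫ ψ.hom, ψ.inv ≫ (chosenSES e).p,
      (chosenSES e).isSES.comp_iso ψ⟩
    have hw : w.cls = e := by
      refine Eq.trans (Subtype.ext ?_) (cls_chosenSES e)
      exact (IsSES.extClass_eq_of_iso (chosenSES e).isSES w.isSES ψ.hom rfl (by simp [w])).symm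
    have a₁ := chosenIso_i w
    have a₂ := chosenIso_p w
    rw [hw] at a₁ a₂
    obtain ⟨g, hg⟩ := (chosenSES e).isSES.lift (ψ.hom ≫ (chosenIso w).inv - 𝟙 Y) (by
      simp only [Preadditive.sub_comp, Category.assoc, a₂]
      simp [w])
    have := (chosenSES e).isSES.mono
    obtain ⟨t, ht⟩ := (chosenSES e).isSES.desc g (by
      rw [← cancel_mono (chosenSES e).i, Category.assoc, hg]
      simp only [Preadditive.comp_sub, ← Category.assoc]
      rw [show (chosenSES e).i ≫ ψ.hom = w.i from rfl, ← a₁]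
      simp)
    refine ⟨(w, t), Prod.ext hw ?_⟩
    ext
    simp only [Iso.trans_hom, IsSES.shear_hom, hw]
    rw [reassoc_of% ht, hg]
    simp

/-- Riedtmann's formula. -/
lemma riedtmann : Nat.card (extWithMiddle Z X Y) * Nat.card (Y ≅ Y) =
    Nat.card (SES X Y Z) * Nat.card (Z ⟶ X) := by
  rw [← Nat.card_prod, ← Nat.card_prod, Nat.card_congr (Equiv.ofBijective _ riedtmann_bijective)]

end Riedtmann


section Octahedral

variable {D B K X Y M : C}

/-- Compatibility of the two ways to see a two-step filtration of `M` with subquotients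
`K`, `B`, `D`: through the quotient `X` and through the subobject `Y`. -/
def Compat (u : SES B X D) (v : SES K M X) (r : SES K Y B) (s : SES Y M D) : Prop :=
  s.p = v.p ≫ u.p ∧ r.i ≫ s.i = v.i ∧ s.i ≫ v.p = r.p ≫ u.i

lemma exists_compat_sub (u : SES B X D) (v : SES K M X) :
    ∃ (Y : C) (r : SES K Y B) (s : SES Y M D), Compat u v r s := by
  have := u.isSES.mono
  have := u.isSES.epi
  have := v.isSES.mono
  have := v.isSES.epi
  have hu := u.isSES.zero
  have hv := v.isSES.zero
  let k := kernel.ι (v.p ≫ u.p)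
  have hk : k ≫ v.p ≫ u.p = 0 := kernel.condition _
  obtain ⟨r, hr⟩ := u.isSES.lift (k ≫ v.p) (by simpa using hk)
  let i' : K ⟶ kernel (v.p ≫ u.p) := kernel.lift _ v.i (by simp [reassoc_of% hv])
  have hi' : i' ≫ k = v.i := kernel.lift_ι _ _ _
  have : Mono (i' ≫ k) := by rw [hi']; infer_instance
  have : Mono i' := mono_of_mono i' k
  have : Epi r := by
    rw [epi_iff_surjective_up_to_refinements]
    intro T b
    obtain ⟨T', π, hπ, m, hm⟩ := surjective_up_to_refinements_of_epi v.p (b ≫ u.i)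
    refine ⟨T', π, hπ, kernel.lift _ m ?_, ?_⟩
    · rw [← Category.assoc, ← hm]; simp [hu]
    · rw [← cancel_mono u.i, Category.assoc, Category.assoc, hr, kernel.lift_ι_assoc, hm]
  have h₁ : IsSES i' r := by
    refine IsSES.mk' ?_ ?_
    · rw [← cancel_mono u.i, Category.assoc, hr, reassoc_of% hi', hv, zero_comp]
    · intro T f hf
      obtain ⟨g, hg⟩ := v.isSES.lift (f ≫ k) (by
        rw [Category.assoc, ← hr, reassoc_of% hf, zero_comp])
      refine ⟨T, 𝟙 T, inferInstance, g, ?_⟩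
      rw [← cancel_mono k, Category.assoc, Category.assoc, hi', hg, Category.id_comp]
  have h₂ : IsSES k (v.p ≫ u.p) := by
    refine IsSES.mk' hk ?_
    intro T f hf
    exact ⟨T, 𝟙 T, inferInstance, kernel.lift _ f hf, by simp [k]⟩
  exact ⟨_, ⟨i', r, h₁⟩, ⟨k, _, h₂⟩, rfl, hi', hr.symm⟩

lemma exists_compat_quot (r : SES K Y B) (s : SES Y M D) :
    ∃ (X : C) (u : SES B X D) (v : SES K M X), Compat u v r s := by
  have := r.isSES.mono
  have := r.isSES.epi
  have := s.isSES.mono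
  have := s.isSES.epi
  have hr := r.isSES.zero
  have hs := s.isSES.zero
  let c := cokernel.π (r.i ≫ s.i)
  have hc : (r.i ≫ s.i) ≫ c = 0 := cokernel.condition _
  obtain ⟨j, hj⟩ := r.isSES.desc (s.i ≫ c) (by simpa using hc)
  let q : cokernel (r.i ≫ s.i) ⟶ D := cokernel.desc _ s.p (by simp [hs])
  have hq : c ≫ q = s.p := cokernel.π_desc _ _ _
  have : Epi (c ≫ q) := by rw [hq]; infer_instance
  have : Epi q := epi_of_epi c q
  have h₂ : IsSES (r.i ≫ s.i) c := by
    refine ⟨hc, ?_⟩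
    exact { exact := ShortComplex.exact_cokernel _ }
  have : Mono j := by
    refine Preadditive.mono_of_cancel_zero _ ?_
    intro T b hb
    obtain ⟨T', π, hπ, y, hy⟩ := surjective_up_to_refinements_of_epi r.p b
    obtain ⟨g, hg⟩ := h₂.lift (y ≫ s.i) (by
      rw [Category.assoc, ← hj, ← reassoc_of% hy, hb, comp_zero])
    have : g ≫ r.i = y := by rw [← cancel_mono s.i, Category.assoc, hg]
    rw [← cancel_epi π, hy, ← this, Category.assoc, hr, comp_zero, comp_zero]
  have h₁ : IsSES j q := by
    refine IsSES.mk' ?_ ?_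
    · rw [← cancel_epi r.p, ← Category.assoc, hj, Category.assoc, hq, hs, comp_zero]
    · intro T f hf
      obtain ⟨T', π, hπ, m, hm⟩ := surjective_up_to_refinements_of_epi c f
      obtain ⟨y, hy⟩ := s.isSES.lift m (by
        rw [← hq, ← Category.assoc, ← hm, Category.assoc, hf, comp_zero])
      exact ⟨T', π, hπ, y ≫ r.p, by rw [hm, ← hy, Category.assoc, Category.assoc, hj]⟩
  exact ⟨_, ⟨j, q, h₁⟩, ⟨_, c, h₂⟩, hq.symm, rfl, hj.symm⟩

lemma compat_sub_bijective {u : SES B X D} {v : SES K M X} {Y₀ : C} {r₀ : SES K Y₀ B}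
    {s₀ : SES Y₀ M D} (h₀ : Compat u v r₀ s₀) (Y : C) : Function.Bijective
    (fun φ : Y ≅ Y₀ ↦ (⟨(⟨r₀.i ≫ φ.inv, φ.hom ≫ r₀.p, r₀.isSES.comp_iso φ.symm⟩,
        ⟨φ.hom ≫ s₀.i, s₀.p, s₀.isSES.isoLeft φ⟩),
      ⟨h₀.1, by simp [h₀.2.1], by simp [h₀.2.2]⟩⟩ :
        {f : SES K Y B × SES Y M D // Compat u v f.1 f.2})) := by
  have := s₀.isSES.mono
  have := u.isSES.mono
  constructor
  · intro φ φ' h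
    have := congrArg (fun f ↦ f.1.2.i) h
    ext
    simpa [cancel_mono] using this
  · rintro ⟨⟨r, s⟩, h₁, h₂, h₃⟩
    have := s.isSES.mono
    dsimp only at h₁ h₂ h₃
    obtain ⟨a, ha⟩ := s₀.isSES.lift s.i (by rw [h₀.1, ← h₁, s.isSES.zero])
    obtain ⟨b, hb⟩ := s.isSES.lift s₀.i (by rw [h₁, ← h₀.1, s₀.isSES.zero])
    refine ⟨⟨a, b, ?_, ?_⟩, ?_⟩
    · rw [← cancel_mono s.i]; simp [hb, ha]
    · rw [← cancel_mono s₀.i]; simp [hb, ha]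
    · apply Subtype.ext
      apply Prod.ext
      · ext
        · dsimp
          rw [← cancel_mono s.i, Category.assoc, hb, h₀.2.1, h₂]
        · dsimp
          rw [← cancel_mono u.i, Category.assoc, ← h₀.2.2, ← h₃, reassoc_of% ha]
      · ext
        · exact ha
        · dsimp
          rw [h₀.1, h₁]

lemma compat_quot_bijective {r : SES K Y B} {s : SES Y M D} {X₀ : C} {u₀ : SES B X₀ D}
    {v₀ : SES K M X₀} (h₀ : Compat u₀ v₀ r s) (X : C) : Function.Bijective
    (fun φ : X₀ ≅ X ↦ (⟨(⟨u₀.i ≫ φ.hom, φ.inv ≫ u₀.p, u₀.isSES.comp_iso φ⟩,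
        ⟨v₀.i, v₀.p ≫ φ.hom, v₀.isSES.isoRight φ⟩),
      ⟨by simp [h₀.1], by simp [h₀.2.1], by simp [reassoc_of% h₀.2.2]⟩⟩ :
        {f : SES B X D × SES K M X // Compat f.1 f.2 r s})) := by
  have := v₀.isSES.epi
  have := r.isSES.epi
  constructor
  · intro φ φ' h
    have := congrArg (fun f ↦ f.1.2.p) h
    ext
    simpa [cancel_epi] using this
  · rintro ⟨⟨u, v⟩, h₁, h₂, h₃⟩
    have := v.isSES.epi
    dsimp only at h₁ h₂ h₃
    obtain ⟨a, ha⟩ := v₀.isSES.desc v.p (by rw [← h₀.2.1, h₂, v.isSES.zero])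
    obtain ⟨b, hb⟩ := v.isSES.desc v₀.p (by rw [← h₂, h₀.2.1, v₀.isSES.zero])
    refine ⟨⟨a, b, ?_, ?_⟩, ?_⟩
    · rw [← cancel_epi v₀.p]; simp [reassoc_of% ha, hb]
    · rw [← cancel_epi v.p]; simp [reassoc_of% hb, ha]
    · apply Subtype.ext
      apply Prod.ext
      · ext
        · dsimp
          rw [← cancel_epi r.p, ← reassoc_of% h₀.2.2, ha, h₃]
        · dsimp
          rw [← cancel_epi v.p, reassoc_of% hb, ← h₀.1, h₁]
      · ext
        · dsimp
          rw [← h₀.2.1, h₂]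
        · exact ha

end Octahedral

/-- Finiteness of the morphism sets, and of the set of isomorphism classes of extensions of
two given objects. -/
class HallFinite (C : Type u) [Category.{v} C] [Abelian C] : Prop where
  finite_hom (X Y : C) : Finite (X ⟶ Y)
  finite_middle (Z X : C) :
    {y : Quotient (isIsomorphicSetoid C) | Nonempty (SES X y.out Z)}.Finite

section Finite

variable [HallFinite C]

instance (X Y : C) : Finite (X ⟶ Y) := HallFinite.finite_hom X Y

instance (X Y : C) : Finite (X ≅ Y) :=
  Finite.of_injective (fun φ ↦ φ.hom) (fun _ _ h ↦ Iso.ext h)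

instance (X Y Z : C) : Finite (SES X Y Z) :=
  Finite.of_injective (fun w ↦ (w.i, w.p)) (fun _ _ h ↦ SES.ext (Prod.ext_iff.1 h).1
    (Prod.ext_iff.1 h).2)

lemma card_aut_ne_zero (X : C) : (Nat.card (X ≅ X) : ℚ) ≠ 0 := by
  have : Nonempty (X ≅ X) := ⟨Iso.refl X⟩
  exact_mod_cast Nat.card_pos.ne'

lemma hallNumber_eq (Z X Y : C) :
    hallNumber Z X Y = (Nat.card (SES X Y Z) : ℚ) / Nat.card (Y ≅ Y) := by
  have h₁ : (Nat.card (Z ⟶ X) : ℚ) ≠ 0 := by exact_mod_cast Nat.card_pos.ne'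
  rw [hallNumber, div_eq_div_iff h₁ (card_aut_ne_zero Y)]
  exact_mod_cast riedtmann

end Finite

/-- Short exact sequences can be transported along isomorphisms. -/
def SES.congr {X Y Z X' Y' Z' : C} (a : X ≅ X') (b : Y ≅ Y') (c : Z ≅ Z') :
    SES X Y Z ≃ SES X' Y' Z' where
  toFun w := ⟨a.inv ≫ w.i ≫ b.hom, (b.inv ≫ w.p) ≫ c.hom,
    ((w.isSES.comp_iso b).isoLeft a.symm).isoRight c⟩
  invFun w := ⟨a.hom ≫ w.i ≫ b.inv, (b.hom ≫ w.p) ≫ c.inv,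
    ((w.isSES.comp_iso b.symm).isoLeft a).isoRight c.symm⟩
  left_inv w := by ext <;> simp
  right_inv w := by ext <;> simp

lemma hallNumber_congr [HallFinite C] {X Y Z X' Y' Z' : C} (a : X ≅ X') (b : Y ≅ Y')
    (c : Z ≅ Z') : hallNumber Z X Y = hallNumber Z' X' Y' := by
  rw [hallNumber_eq, hallNumber_eq, Nat.card_congr (SES.congr a b c),
    Nat.card_congr ⟨fun φ ↦ b.symm ≪≫ φ ≪≫ b, fun φ ↦ b ≪≫ φ ≪≫ b.symm,
      fun φ ↦ by ext; simp, fun φ ↦ by ext; simp⟩]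

end Extensions


section HallAlgebra

variable {C : Type u} [Category.{v} C] [Abelian C] (P : ObjectProperty C)

/-- The isomorphism classes of the objects satisfying `P`. -/
def IsoClass : Type u := Quotient (isIsomorphicSetoid P.FullSubcategory)

/-- The Hall algebra over `ℚ` of the full subcategory of the objects satisfying `P`: the vector
space with basis the isomorphism classes. When `P` is closed under extensions in `C`, this
subcategory is an exact category, its conflations being the short exact sequences of `C` with
terms in it, and its extension groups `Ext¹` are those of `C`. -/
def HallAlg : Type u := IsoClass P →₀ ℚ

noncomputable instance : AddCommGroup (HallAlg P) := inferInstanceAs (AddCommGroup (_ →₀ ℚ))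
noncomputable instance : Module ℚ (HallAlg P) := inferInstanceAs (Module ℚ (_ →₀ ℚ))

variable {P}

/-- The coefficients of an element of the Hall algebra in the basis of isomorphism classes. -/
def HallAlg.coeff (x : HallAlg P) : IsoClass P → ℚ := DFunLike.coe (F := IsoClass P →₀ ℚ) x

/-- A representative of an isomorphism class. -/
noncomputable def IsoClass.rep (x : IsoClass P) : C := (Quotient.out x).obj

lemma IsoClass.rep_property (x : IsoClass P) : P x.rep := (Quotient.out x).property

/-- The isomorphism class of an object. -/
def IsoClass.mk (X : P.FullSubcategory) : IsoClass P := Quotient.mk _ X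

lemma IsoClass.nonempty_iso_rep (X : P.FullSubcategory) :
    Nonempty ((IsoClass.mk X).rep ≅ X.obj) := by
  obtain ⟨e⟩ := Quotient.mk_out (s := isIsomorphicSetoid P.FullSubcategory) X
  exact ⟨P.ι.mapIso e⟩

lemma IsoClass.mk_eq_of_iso {X Y : P.FullSubcategory} (e : X.obj ≅ Y.obj) :
    IsoClass.mk X = IsoClass.mk Y :=
  Quotient.sound (s := isIsomorphicSetoid P.FullSubcategory) ⟨P.isoMk e⟩

lemma IsoClass.mk_rep (x : IsoClass P) (h : P x.rep) : IsoClass.mk ⟨x.rep, h⟩ = x :=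
  Quotient.out_eq x

lemma IsoClass.eq_of_iso {x y : IsoClass P} (e : x.rep ≅ y.rep) : x = y := by
  rw [← x.mk_rep x.rep_property, ← y.mk_rep y.rep_property]
  exact IsoClass.mk_eq_of_iso e

variable [HallFinite C]

lemma finite_middle_isoClass (a c : IsoClass P) :
    {b : IsoClass P | Nonempty (SES c.rep b.rep a.rep)}.Finite := by
  let f (x : IsoClass P) : Quotient (isIsomorphicSetoid C) := Quotient.mk _ x.rep
  have hf : Function.Injective f := by
    intro x y h
    obtain ⟨e⟩ := Quotient.exact h
    exact IsoClass.eq_of_iso e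
  refine ((HallFinite.finite_middle a.rep c.rep).preimage (f := f) hf.injOn).subset ?_
  rintro b ⟨w⟩
  obtain ⟨e⟩ := Quotient.mk_out (s := isIsomorphicSetoid C) b.rep
  exact ⟨SES.congr (Iso.refl _) e.symm (Iso.refl _) w⟩

lemma hallNumber_ne_zero_iff (Z X Y : C) : hallNumber Z X Y ≠ 0 ↔ Nonempty (SES X Y Z) := by
  rw [hallNumber_eq, div_ne_zero_iff, Nat.cast_ne_zero, Nat.card_ne_zero]
  exact ⟨fun h ↦ h.1.1, fun h ↦ ⟨⟨h, inferInstance⟩, card_aut_ne_zero Y⟩⟩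

/-- The product of two basis elements:
`[a] ⬦ [c] = ∑_b |Ext¹(a, c)_b| / |Hom(a, c)| [b]`. -/
noncomputable def hallProd (a c : IsoClass P) : HallAlg P :=
  Finsupp.ofSupportFinite (fun b ↦ hallNumber a.rep c.rep b.rep)
    ((finite_middle_isoClass a c).subset fun _ hb ↦ (hallNumber_ne_zero_iff _ _ _).1 hb)

/-- The Hall product, as a bilinear map. -/
noncomputable def hallMul : HallAlg P →ₗ[ℚ] HallAlg P →ₗ[ℚ] HallAlg P :=
  Finsupp.linearCombination ℚ (fun a : IsoClass P ↦
    (Finsupp.linearCombination ℚ (fun c : IsoClass P ↦ hallProd a c) :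
      (IsoClass P →₀ ℚ) →ₗ[ℚ] HallAlg P))

/-- The class `[X]` in the Hall algebra. -/
noncomputable def HallAlg.cls (X : P.FullSubcategory) : HallAlg P :=
  Finsupp.single (IsoClass.mk X) (1 : ℚ)

lemma HallAlg.cls_eq_of_iso {X Y : P.FullSubcategory} (e : X.obj ≅ Y.obj) :
    HallAlg.cls X = HallAlg.cls Y := by
  rw [cls, cls, IsoClass.mk_eq_of_iso e]

/-- The basis element of an isomorphism class. -/
noncomputable def HallAlg.bas (x : IsoClass P) : HallAlg P := Finsupp.single x (1 : ℚ)

lemma hallMul_bas (a c : IsoClass P) :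
    hallMul (HallAlg.bas a) (HallAlg.bas c) = hallProd a c := by
  have h₁ : hallMul (HallAlg.bas a) = (Finsupp.linearCombination ℚ
      (fun c : IsoClass P ↦ hallProd a c) : (IsoClass P →₀ ℚ) →ₗ[ℚ] HallAlg P) := by
    unfold hallMul HallAlg.bas
    exact (Finsupp.linearCombination_single _ _ _).trans (one_smul _ _)
  rw [h₁]
  exact (Finsupp.linearCombination_single _ _ _).trans (one_smul _ _)

@[elab_as_elim]
lemma HallAlg.induction {p : HallAlg P → Prop} (x : HallAlg P) (zero : p 0)
    (add : ∀ x y, p x → p y → p (x + y)) (smul : ∀ (q : ℚ) x, p x → p (q • x))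
    (bas : ∀ a, p (HallAlg.bas a)) : p x := by
  refine Finsupp.induction_linear (motive := p) x zero add ?_
  intro a q
  have := smul q _ (bas a)
  have h : (Finsupp.single a q : IsoClass P →₀ ℚ) = q • Finsupp.single a (1 : ℚ) := by simp
  exact h ▸ this

lemma hallProd_eq_sum (a c : IsoClass P) :
    hallProd a c = ∑ b ∈ (finite_middle_isoClass a c).toFinset,
      hallNumber a.rep c.rep b.rep • HallAlg.bas b := by
  refine Finsupp.ext fun m ↦ ?_
  have h := Finsupp.finsetSum_apply (finite_middle_isoClass a c).toFinset
    (fun b ↦ (hallNumber a.rep c.rep b.rep • Finsupp.single b (1 : ℚ) : IsoClass P →₀ ℚ)) m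
  refine Eq.trans ?_ h.symm
  change hallNumber a.rep c.rep m.rep = _
  by_cases hm : m ∈ (finite_middle_isoClass a c).toFinset
  · rw [Finset.sum_eq_single_of_mem m hm]
    · simp
    · intro b _ hb
      simp [hb]
  · rw [Finset.sum_eq_zero]
    · by_contra h0
      exact hm (by simpa using (hallNumber_ne_zero_iff _ _ _).1 h0)
    · intro b hb
      have : b ≠ m := by rintro rfl; exact hm hb
      simp [this]

section Assoc

variable [P.IsClosedUnderExtensions]

lemma prop_of_SES {X Y Z : C} (w : SES X Y Z) (hX : P X) (hZ : P Z) : P Y :=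
  P.prop_X₂_of_shortExact w.isSES.shortExact hX hZ

/-- The associativity of the structure constants. -/
lemma hallNumber_assoc (a b c m : IsoClass P) :
    ∑ x ∈ (finite_middle_isoClass a b).toFinset,
      hallNumber a.rep b.rep x.rep * hallNumber x.rep c.rep m.rep =
    ∑ y ∈ (finite_middle_isoClass b c).toFinset,
      hallNumber b.rep c.rep y.rep * hallNumber a.rep y.rep m.rep := by
  have key := double_count
    (fun x : IsoClass P ↦ SES b.rep x.rep a.rep × SES c.rep m.rep x.rep)
    (fun y : IsoClass P ↦ SES c.rep y.rep b.rep × SES y.rep m.rep a.rep)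
    (fun _ _ e f ↦ Compat e.1 e.2 f.1 f.2)
    (fun x ↦ (Nat.card (x.rep ≅ x.rep) : ℚ)) (fun y ↦ (Nat.card (y.rep ≅ y.rep) : ℚ))
    (fun x ↦ card_aut_ne_zero _) (fun y ↦ card_aut_ne_zero _) ?_ ?_
    (finite_middle_isoClass a b).toFinset (by rintro x ⟨e⟩; simpa using ⟨e.1⟩)
    (finite_middle_isoClass b c).toFinset (by rintro x ⟨e⟩; simpa using ⟨e.1⟩)
  · have h₁ (x : IsoClass P) :
        hallNumber a.rep b.rep x.rep * hallNumber x.rep c.rep m.rep =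
          ((Nat.card (SES b.rep x.rep a.rep × SES c.rep m.rep x.rep) : ℚ) /
            Nat.card (x.rep ≅ x.rep)) / Nat.card (m.rep ≅ m.rep) := by
      rw [hallNumber_eq, hallNumber_eq, Nat.card_prod]
      push_cast
      ring
    have h₂ (y : IsoClass P) :
        hallNumber b.rep c.rep y.rep * hallNumber a.rep y.rep m.rep =
          ((Nat.card (SES c.rep y.rep b.rep × SES y.rep m.rep a.rep) : ℚ) /
            Nat.card (y.rep ≅ y.rep)) / Nat.card (m.rep ≅ m.rep) := by
      rw [hallNumber_eq, hallNumber_eq, Nat.card_prod]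
      push_cast
      ring
    simp_rw [h₁, h₂, ← Finset.sum_div]
    rw [key]
  · rintro x ⟨u, v⟩
    obtain ⟨Y₀, r, s, h₀⟩ := exists_compat_sub u v
    let Y : P.FullSubcategory := ⟨Y₀, prop_of_SES r c.rep_property b.rep_property⟩
    obtain ⟨e₀⟩ := IsoClass.nonempty_iso_rep Y
    refine ⟨IsoClass.mk Y, ?_, ?_⟩
    · rw [← Nat.card_congr (Equiv.ofBijective _ (compat_sub_bijective h₀ (IsoClass.mk Y).rep))]
      exact congrArg _ (Nat.card_congr ⟨fun φ ↦ φ ≪≫ e₀.symm, fun φ ↦ φ ≪≫ e₀,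
        fun φ ↦ by ext; simp, fun φ ↦ by ext; simp⟩)
    · intro y hy
      refine ⟨fun f ↦ hy ?_⟩
      obtain ⟨φ, -⟩ := (compat_sub_bijective h₀ y.rep).2 f
      exact IsoClass.eq_of_iso (φ ≪≫ e₀.symm)
  · rintro y ⟨r, s⟩
    obtain ⟨X₀, u, v, h₀⟩ := exists_compat_quot r s
    let X : P.FullSubcategory := ⟨X₀, prop_of_SES u b.rep_property a.rep_property⟩
    obtain ⟨e₀⟩ := IsoClass.nonempty_iso_rep X
    refine ⟨IsoClass.mk X, ?_, ?_⟩
    · rw [← Nat.card_congr (Equiv.ofBijective _ (compat_quot_bijective h₀ (IsoClass.mk X).rep))]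
      exact congrArg _ (Nat.card_congr ⟨fun φ ↦ e₀ ≪≫ φ, fun φ ↦ e₀.symm ≪≫ φ,
        fun φ ↦ by ext; simp, fun φ ↦ by ext; simp⟩)
    · intro x hx
      refine ⟨fun f ↦ hx ?_⟩
      obtain ⟨φ, -⟩ := (compat_quot_bijective h₀ x.rep).2 f
      exact IsoClass.eq_of_iso (φ.symm ≪≫ e₀.symm)

lemma hallMul_assoc (x y z : HallAlg P) :
    hallMul (hallMul x y) z = hallMul x (hallMul y z) := by
  refine HallAlg.induction x (by simp) (fun x x' h h' ↦ by simp [h, h'])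
    (fun q x h ↦ by simp [h]) fun a ↦ ?_
  refine HallAlg.induction y (by simp) (fun x x' h h' ↦ by simp [h, h'])
    (fun q x h ↦ by simp [h]) fun b ↦ ?_
  refine HallAlg.induction z (by simp) (fun x x' h h' ↦ by simp [h, h'])
    (fun q x h ↦ by simp [h]) fun c ↦ ?_
  rw [hallMul_bas, hallMul_bas, hallProd_eq_sum a b, hallProd_eq_sum b c]
  simp only [map_sum, map_smul, LinearMap.sum_apply, LinearMap.smul_apply, hallMul_bas]
  refine Finsupp.ext fun m ↦ ?_
  refine (Finsupp.finsetSum_apply (finite_middle_isoClass a b).toFinset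
    (fun x ↦ (hallNumber a.rep b.rep x.rep • hallProd x c : IsoClass P →₀ ℚ)) m).trans ?_
  refine Eq.trans ?_ (Finsupp.finsetSum_apply (finite_middle_isoClass b c).toFinset
    (fun y ↦ (hallNumber b.rep c.rep y.rep • hallProd a y : IsoClass P →₀ ℚ)) m).symm
  exact hallNumber_assoc a b c m

end Assoc

section Unit

variable [P.ContainsZero] [P.IsClosedUnderIsomorphisms]

variable (P) in
/-- The zero object. -/
noncomputable def zeroObj : P.FullSubcategory := ⟨0, P.prop_zero⟩

lemma ses_bijective_of_isZero_right {X Y Z : C} (hZ : IsZero Z) : Function.Bijective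
    (fun φ : X ≅ Y ↦ (⟨φ.hom, 0, by
      have : Epi (0 : Y ⟶ Z) := ⟨fun _ _ _ ↦ hZ.eq_of_src _ _⟩
      exact IsSES.mk' (by simp) (fun {T} f _ ↦ ⟨T, 𝟙 T, inferInstance, f ≫ φ.inv, by simp⟩)⟩ :
        SES X Y Z)) := by
  constructor
  · intro φ φ' h
    exact Iso.ext (congrArg SES.i h)
  · rintro ⟨i, p, h⟩
    have := h.mono
    obtain rfl : p = 0 := hZ.eq_of_tgt _ _
    obtain ⟨g, hg⟩ := h.lift (𝟙 Y) (by simp)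
    refine ⟨⟨i, g, ?_, hg⟩, rfl⟩
    rw [← cancel_mono i, Category.assoc, hg, Category.comp_id, Category.id_comp]

lemma ses_bijective_of_isZero_left {X Y Z : C} (hX : IsZero X) : Function.Bijective
    (fun φ : Y ≅ Z ↦ (⟨0, φ.hom, by
      have : Mono (0 : X ⟶ Y) := ⟨fun _ _ _ ↦ hX.eq_of_tgt _ _⟩
      refine IsSES.mk' (by simp) (fun {T} f hf ↦ ⟨T, 𝟙 T, inferInstance, 0, ?_⟩)
      rw [← cancel_mono φ.hom]
      simp [hf]⟩ : SES X Y Z)) := by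
  constructor
  · intro φ φ' h
    exact Iso.ext (congrArg SES.p h)
  · rintro ⟨i, p, h⟩
    have := h.epi
    obtain rfl : i = 0 := hX.eq_of_src _ _
    obtain ⟨g, hg⟩ := h.desc (𝟙 Y) (by simp)
    refine ⟨⟨p, g, hg, ?_⟩, rfl⟩
    rw [← cancel_epi p, reassoc_of% hg, Category.comp_id]

lemma bas_apply (a m : IsoClass P) :
    (HallAlg.bas a).coeff m =
      (Nat.card (a.rep ≅ m.rep) : ℚ) / Nat.card (m.rep ≅ m.rep) := by
  by_cases h : a = m
  · subst h
    rw [div_self (card_aut_ne_zero _)]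
    exact Finsupp.single_eq_same
  · have : IsEmpty (a.rep ≅ m.rep) := ⟨fun e ↦ h (IsoClass.eq_of_iso e)⟩
    rw [Nat.card_of_isEmpty, Nat.cast_zero, zero_div]
    exact Finsupp.single_eq_of_ne (Ne.symm h)

lemma isZero_rep_zeroObj : IsZero (IsoClass.mk (zeroObj P)).rep := by
  obtain ⟨e⟩ := IsoClass.nonempty_iso_rep (zeroObj P)
  exact (isZero_zero C).of_iso e

lemma zero_hallMul (x : HallAlg P) : hallMul (HallAlg.cls (zeroObj P)) x = x := by
  refine HallAlg.induction x (by simp) (fun x x' h h' ↦ by simp [h, h'])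
    (fun q x h ↦ by simp [h]) fun a ↦ ?_
  refine (hallMul_bas _ _).trans (Finsupp.ext fun m ↦ ?_)
  refine Eq.trans ?_ (bas_apply a m).symm
  change hallNumber _ _ _ = _
  rw [hallNumber_eq, ← Nat.card_congr
    (Equiv.ofBijective _ (ses_bijective_of_isZero_right (isZero_rep_zeroObj (P := P))))]

lemma hallMul_zero (x : HallAlg P) : hallMul x (HallAlg.cls (zeroObj P)) = x := by
  refine HallAlg.induction x (by simp) (fun x x' h h' ↦ by simp [h, h'])
    (fun q x h ↦ by simp [h]) fun a ↦ ?_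
  refine (hallMul_bas _ _).trans (Finsupp.ext fun m ↦ ?_)
  refine Eq.trans ?_ (bas_apply a m).symm
  change hallNumber _ _ _ = _
  rw [hallNumber_eq, ← Nat.card_congr
    (Equiv.ofBijective _ (ses_bijective_of_isZero_left (isZero_rep_zeroObj (P := P)))),
    Nat.card_congr ⟨Iso.symm, Iso.symm, fun _ ↦ rfl, fun _ ↦ rfl⟩]

end Unit

variable [P.IsClosedUnderExtensions] [P.ContainsZero] [P.IsClosedUnderIsomorphisms]

/-- The Hall algebra is an associative algebra with unit `[0]`. -/
noncomputable instance : Ring (HallAlg P) where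
  __ := (inferInstance : AddCommGroup (HallAlg P))
  mul x y := hallMul x y
  one := HallAlg.cls (zeroObj P)
  mul_assoc := hallMul_assoc
  one_mul := zero_hallMul
  mul_one := hallMul_zero
  left_distrib x y z := map_add (hallMul x) y z
  right_distrib x y z := LinearMap.map_add₂ hallMul x y z
  zero_mul x := LinearMap.map_zero₂ hallMul x
  mul_zero x := map_zero (hallMul x)

noncomputable instance : Algebra ℚ (HallAlg P) :=
  Algebra.ofModule (fun q x y ↦ LinearMap.map_smul₂ hallMul q x y)
    (fun q x y ↦ map_smul (hallMul x) q y)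

/-- The coefficient of `[Y]` in `[Z] ⬦ [X]` is `|Ext¹(Z, X)_Y| / |Hom(Z, X)|`. -/
lemma HallAlg.cls_mul_cls_apply (Z X Y : P.FullSubcategory) :
    (HallAlg.cls Z * HallAlg.cls X).coeff (IsoClass.mk Y) =
      hallNumber Z.obj X.obj Y.obj := by
  obtain ⟨a⟩ := IsoClass.nonempty_iso_rep Z
  obtain ⟨b⟩ := IsoClass.nonempty_iso_rep X
  obtain ⟨c⟩ := IsoClass.nonempty_iso_rep Y
  rw [← hallNumber_congr b c a]
  exact congrArg (fun x ↦ HallAlg.coeff x (IsoClass.mk Y))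
    (hallMul_bas (IsoClass.mk Z) (IsoClass.mk X))

end HallAlgebra


section Complexes

variable (A : Type u) [Category.{v} A] [Abelian A]

/-- The category of `ℤ/2`-graded complexes over `A`. -/
abbrev Z2Complex : Type (max u v) := HomologicalComplex A (ComplexShape.up (ZMod 2))

/-- Morphism spaces and first extension spaces are finite. For a category linear over a finite
field, this is the condition that they are finite dimensional. -/
class IsFinitary : Prop where
  finite_hom (X Y : A) : Finite (X ⟶ Y)
  finite_ext (X Y : A) : Finite (Ext.{max u v} X Y 1)

/-- `A` is hereditary: `Extⁱ(X, Y) = 0` for all `X`, `Y` and all `i ≥ 2`. -/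
class IsHereditary : Prop where
  hasProjectiveDimensionLT (X : A) : HasProjectiveDimensionLT X 2

variable {A}

instance HallFinite.of_isFinitary [IsFinitary A] : HallFinite A where
  finite_hom := IsFinitary.finite_hom
  finite_middle Z X := by
    have := IsFinitary.finite_ext Z X
    have key : Function.Injective
        (fun y : {y : Quotient (isIsomorphicSetoid A) | Nonempty (SES X y.out Z)} ↦
          y.2.some.isSES.extClass) := by
      intro y y' h
      obtain ⟨φ, -⟩ := IsSES.exists_iso_of_extClass_eq _ _ h
      apply Subtype.ext
      rw [← Quotient.out_eq y.1, ← Quotient.out_eq y'.1]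
      exact Quotient.sound ⟨φ⟩
    have := Finite.of_injective _ key
    exact Set.toFinite _

lemma IsSES.eval {X Y Z : Z2Complex A} {i : X ⟶ Y} {p : Y ⟶ Z} (h : IsSES i p) (n : ZMod 2) :
    IsSES (i.f n) (p.f n) :=
  ⟨by rw [← HomologicalComplex.comp_f, h.zero, HomologicalComplex.zero_f],
    h.shortExact.map_of_exact (HomologicalComplex.eval A _ n)⟩

instance HallFinite.z2Complex [HallFinite A] : HallFinite (Z2Complex A) where
  finite_hom K L := Finite.of_injective (fun f ↦ f.f) (fun _ _ h ↦ HomologicalComplex.hom_ext _ _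
    (congrFun h))
  finite_middle L K := by
    let F (n : ZMod 2) : Set (Quotient (isIsomorphicSetoid A)) :=
      {y | Nonempty (SES (K.X n) y.out (L.X n))}
    have hF (n : ZMod 2) : Finite (F n) := HallFinite.finite_middle (L.X n) (K.X n)
    let D := Σ y : (∀ n, F n), ∀ i j : ZMod 2, (y i).1.out ⟶ (y j).1.out
    have hD : Finite D := inferInstance
    let S : Set (Quotient (isIsomorphicSetoid (Z2Complex A))) := {y | Nonempty (SES K y.out L)}
    let e (M : Z2Complex A) (n : ZMod 2) :
        (Quotient.mk (isIsomorphicSetoid A) (M.X n)).out ≅ M.X n :=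
      (Quotient.mk_out (s := isIsomorphicSetoid A) (M.X n)).some
    let g (s : S) : D := ⟨fun n ↦ ⟨Quotient.mk _ (s.1.out.X n), by
        obtain ⟨w⟩ := s.2
        exact ⟨SES.congr (Iso.refl _) (e _ n).symm (Iso.refl _) ⟨_, _, w.isSES.eval n⟩⟩⟩,
      fun i j ↦ (e _ i).hom ≫ s.1.out.d i j ≫ (e _ j).inv⟩
    have hg : Function.Injective g := by
      intro s s' h
      have key (p p' : D) (hp : p = p') (M M' : Z2Complex A)
          (a : ∀ n, (p.1 n).1.out ≅ M.X n) (a' : ∀ n, (p'.1 n).1.out ≅ M'.X n)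
          (h : ∀ i j, p.2 i j = (a i).hom ≫ M.d i j ≫ (a j).inv)
          (h' : ∀ i j, p'.2 i j = (a' i).hom ≫ M'.d i j ≫ (a' j).inv) : Nonempty (M ≅ M') := by
        subst hp
        refine ⟨HomologicalComplex.Hom.isoOfComponents (fun n ↦ (a n).symm ≪≫ a' n) ?_⟩
        intro i j _
        have := (h i j).symm.trans (h' i j)
        simp only [Iso.trans_hom, Iso.symm_hom, Category.assoc]
        rw [← cancel_epi (a i).hom, ← cancel_mono (a' j).inv]
        simp [this]
      obtain ⟨φ⟩ := key _ _ h s.1.out s'.1.out (fun n ↦ e _ n) (fun n ↦ e _ n)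
        (fun _ _ ↦ rfl) (fun _ _ ↦ rfl)
      apply Subtype.ext
      rw [← Quotient.out_eq s.1, ← Quotient.out_eq s'.1]
      exact Quotient.sound ⟨φ⟩
    have : Finite S := Finite.of_injective g hg
    exact this

end Complexes


section Tilting

variable {A : Type u} [Category.{v} A] [Abelian A]

/-- `add T`: the direct summands of finite direct sums of copies of `T`. -/
def addClosure (T : A) : ObjectProperty A :=
  fun X ↦ ∃ n : ℕ, Nonempty (Retract X (⨁ fun _ : Fin n ↦ T))

/-- `Fac T`: the epimorphic images of objects of `add T`. -/
def facClosure (T : A) : ObjectProperty A :=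
  fun X ↦ ∃ (Y : A) (f : Y ⟶ X), addClosure T Y ∧ Epi f

/-- Torsion pairs of (replete) full subcategories. -/
structure IsTorsionPair (𝒯 ℱ : ObjectProperty A) : Prop where
  torsion_iso : 𝒯.IsClosedUnderIsomorphisms
  free_iso : ℱ.IsClosedUnderIsomorphisms
  hom_eq_zero {X Y : A} (hX : 𝒯 X) (hY : ℱ Y) (f : X ⟶ Y) : f = 0
  exists_ses (X : A) : ∃ (X' X'' : A) (i : X' ⟶ X) (p : X ⟶ X''), 𝒯 X' ∧ ℱ X'' ∧ IsSES i p

/-- Tilting objects, in the sense of Happel, Reiten and Smalø. -/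
class IsTilting (T : A) : Prop where
  exists_torsionPair : ∃ 𝒯 ℱ : ObjectProperty A, IsTorsionPair 𝒯 ℱ ∧
    (∀ X : A, ∃ (Y : A) (f : X ⟶ Y), 𝒯 Y ∧ Mono f) ∧
    𝒯 = facClosure T ∧
    (∀ X : A, 𝒯 X → ∀ i > 0, Subsingleton (Ext.{max u v} T X i)) ∧
    (∀ Z : A, 𝒯 Z → (∀ X : A, 𝒯 X → ∀ i > 0, Subsingleton (Ext.{max u v} Z X i)) →
      addClosure T Z) ∧
    (∀ X : A, (∀ i, Subsingleton (Ext.{max u v} T X i)) → IsZero X)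

lemma addClosure_of_sum {T X : A} {ι : Type*} [Fintype ι] (f : ι → (X ⟶ T)) (g : ι → (T ⟶ X))
    (h : ∑ a, f a ≫ g a = 𝟙 X) : addClosure T X := by
  let e := Fintype.equivFin ι
  refine ⟨Fintype.card ι, ⟨⟨biproduct.lift fun a ↦ f (e.symm a),
    biproduct.desc fun a ↦ g (e.symm a), ?_⟩⟩⟩
  rw [biproduct.lift_desc, ← h]
  exact e.symm.sum_comp (fun a ↦ f a ≫ g a)

lemma exists_sum_of_addClosure {T X : A} (h : addClosure T X) :
    ∃ (n : ℕ) (f : Fin n → (X ⟶ T)) (g : Fin n → (T ⟶ X)), ∑ a, f a ≫ g a = 𝟙 X := by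
  obtain ⟨n, ⟨r⟩⟩ := h
  refine ⟨n, fun a ↦ r.i ≫ biproduct.π _ a, fun a ↦ biproduct.ι (fun _ : Fin n ↦ T) a ≫ r.r, ?_⟩
  have := congrArg (fun x ↦ r.i ≫ x ≫ r.r) (biproduct.total (f := fun _ : Fin n ↦ T))
  simp only [Preadditive.sum_comp, Preadditive.comp_sum, Category.assoc, Category.id_comp,
    r.retract] at this
  simpa only [Category.assoc] using this

instance (T : A) : (addClosure T).IsClosedUnderIsomorphisms where
  of_iso e := by
    rintro ⟨n, ⟨r⟩⟩
    exact ⟨n, ⟨⟨e.inv ≫ r.i, r.r ≫ e.hom, by simp⟩⟩⟩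

instance (T : A) : (addClosure T).ContainsZero where
  exists_zero := ⟨0, isZero_zero A, 0, ⟨⟨0, 0, (isZero_zero A).eq_of_src _ _⟩⟩⟩

instance (T : A) [hT : IsTilting T] : (addClosure T).IsClosedUnderExtensions where
  prop_X₂_of_shortExact {S} hS h₁ h₃ := by
    obtain ⟨𝒯, ℱ, -, -, rfl, h, -, -⟩ := hT.exists_torsionPair
    have := h S.X₁ ⟨S.X₁, 𝟙 _, h₁, inferInstance⟩ 1 one_pos
    obtain ⟨n, f, g, hfg⟩ := exists_sum_of_addClosure h₁
    obtain ⟨m, f', g', hfg'⟩ := exists_sum_of_addClosure h₃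
    have hz : (Ext.mk₀ (𝟙 S.X₃)).comp hS.extClass (zero_add 1) = 0 := by
      rw [← hfg', Ext.mk₀_sum, Ext.sum_comp]
      refine Finset.sum_eq_zero fun a _ ↦ ?_
      rw [← Ext.mk₀_comp_mk₀_assoc, Subsingleton.elim ((Ext.mk₀ (g' a)).comp hS.extClass _) 0,
        Ext.comp_zero]
    obtain ⟨x, hx⟩ := Ext.covariant_sequence_exact₃ _ hS _ (zero_add 1) hz
    obtain ⟨s, rfl⟩ := (Ext.mk₀_bijective _ _).2 x
    have hs : s ≫ S.g = 𝟙 _ := by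
      apply (Ext.mk₀_bijective _ _).1
      rw [← hx, Ext.mk₀_comp_mk₀]
    let σ := ShortComplex.Splitting.ofExactOfSection S hS.exact s hs hS.mono_f
    refine addClosure_of_sum (ι := Fin n ⊕ Fin m)
      (Sum.elim (fun a ↦ σ.r ≫ f a) (fun a ↦ S.g ≫ f' a))
      (Sum.elim (fun a ↦ g a ≫ S.f) (fun a ↦ g' a ≫ σ.s)) ?_
    rw [Fintype.sum_sum_type, ← σ.id]
    have e₁ : σ.r ≫ (∑ a, f a ≫ g a) ≫ S.f = σ.r ≫ S.f := by rw [hfg, Category.id_comp]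
    have e₂ : S.g ≫ (∑ a, f' a ≫ g' a) ≫ σ.s = S.g ≫ σ.s := by rw [hfg', Category.id_comp]
    rw [← e₁, ← e₂]
    simp [Preadditive.comp_sum, Preadditive.sum_comp]

/-- The `ℤ/2`-graded complexes with components satisfying `P`. -/
def complexesIn (P : ObjectProperty A) : ObjectProperty (Z2Complex A) :=
  fun K ↦ ∀ i, P (K.X i)

instance (P : ObjectProperty A) [P.IsClosedUnderIsomorphisms] :
    (complexesIn P).IsClosedUnderIsomorphisms where
  of_iso e h i := P.prop_of_iso ((HomologicalComplex.eval A _ i).mapIso e) (h i)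

instance (P : ObjectProperty A) [P.IsClosedUnderIsomorphisms] [P.ContainsZero] :
    (complexesIn P).ContainsZero where
  exists_zero := ⟨0, isZero_zero _, fun i ↦ P.prop_of_isZero
    ((HomologicalComplex.eval A _ i).map_isZero (isZero_zero _))⟩

instance (P : ObjectProperty A) [P.IsClosedUnderExtensions] :
    (complexesIn P).IsClosedUnderExtensions where
  prop_X₂_of_shortExact hS h₁ h₃ i :=
    P.prop_X₂_of_shortExact (hS.map_of_exact (HomologicalComplex.eval A _ i)) (h₁ i) (h₃ i)

/-- A `T`-resolution of a complex `M`: short exact sequences `0 ⟶ M ⟶ X ⟶ T₂ ⟶ 0` and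
`0 ⟶ T₁ ⟶ T₀ ⟶ X ⟶ 0` of complexes, where `M ⟶ X` and `T₀ ⟶ X` are quasi-isomorphisms, `X` has
components in the torsion class `Fac T` and `T₀`, `T₁`, `T₂` have components in `add T`. -/
structure TResolution (T : A) (M : Z2Complex A) where
  X : Z2Complex A
  T₀ : (complexesIn (addClosure T)).FullSubcategory
  T₁ : (complexesIn (addClosure T)).FullSubcategory
  T₂ : (complexesIn (addClosure T)).FullSubcategory
  w : M ⟶ X
  v : X ⟶ T₂.obj
  u₁ : T₁.obj ⟶ T₀.obj
  u₀ : T₀.obj ⟶ X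
  prop_X : complexesIn (facClosure T) X
  isSES_wv : IsSES w v
  isSES_u : IsSES u₁ u₀
  quasiIso_w : QuasiIso w
  quasiIso_u₀ : QuasiIso u₀

end Tilting

section Localization

variable {R : Type u} [Ring R] [Algebra ℚ R] (S : Set R)

/-- The relations defining the universal `S`-inverting `ℚ`-algebra. -/
inductive InvRel : FreeAlgebra ℚ (R ⊕ S) → FreeAlgebra ℚ (R ⊕ S) → Prop
  | add (a b : R) : InvRel (FreeAlgebra.ι ℚ (Sum.inl (a + b)))
      (FreeAlgebra.ι ℚ (Sum.inl a) + FreeAlgebra.ι ℚ (Sum.inl b))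
  | mul (a b : R) : InvRel (FreeAlgebra.ι ℚ (Sum.inl (a * b)))
      (FreeAlgebra.ι ℚ (Sum.inl a) * FreeAlgebra.ι ℚ (Sum.inl b))
  | algebraMap (q : ℚ) : InvRel (FreeAlgebra.ι ℚ (Sum.inl (algebraMap ℚ R q)))
      (algebraMap ℚ (FreeAlgebra ℚ (R ⊕ S)) q)
  | mul_inv (s : S) : InvRel
      (FreeAlgebra.ι ℚ (Sum.inl s.1) * FreeAlgebra.ι ℚ (Sum.inr s)) 1
  | inv_mul (s : S) : InvRel
      (FreeAlgebra.ι ℚ (Sum.inr s) * FreeAlgebra.ι ℚ (Sum.inl s.1)) 1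

/-- The universal `S`-inverting algebra `R[S⁻¹]`. -/
abbrev Localized : Type u := RingQuot (InvRel S)

/-- The canonical homomorphism `R → R[S⁻¹]`. -/
noncomputable def toLocalized : R →ₐ[ℚ] Localized S :=
  AlgHom.ofLinearMap
    { toFun a := RingQuot.mkAlgHom ℚ (InvRel S) (FreeAlgebra.ι ℚ (Sum.inl a))
      map_add' a b := by rw [RingQuot.mkAlgHom_rel ℚ (InvRel.add a b), map_add]
      map_smul' q a := by
        rw [Algebra.smul_def, RingQuot.mkAlgHom_rel ℚ (InvRel.mul _ a), map_mul,
          RingQuot.mkAlgHom_rel ℚ (InvRel.algebraMap q), AlgHom.commutes, RingHom.id_apply,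
          Algebra.smul_def] }
    (by
      have := RingQuot.mkAlgHom_rel ℚ (InvRel.algebraMap (S := S) 1)
      simpa using this)
    (fun a b ↦ by
      change RingQuot.mkAlgHom ℚ (InvRel S) _ = _
      rw [RingQuot.mkAlgHom_rel ℚ (InvRel.mul a b), map_mul]
      rfl)

/-- `f : R → R'` is a right localization of `R` at the multiplicatively closed subset `S`
(a ring of right fractions). -/
structure IsRightLocalization {R' : Type*} [Ring R'] [Algebra ℚ R'] (f : R →ₐ[ℚ] R') : Prop where
  one_mem : (1 : R) ∈ S
  mul_mem {s t : R} (hs : s ∈ S) (ht : t ∈ S) : s * t ∈ S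
  isUnit {s : R} (hs : s ∈ S) : IsUnit (f s)
  exists_fraction (x : R') : ∃ a : R, ∃ s ∈ S, x * f s = f a
  map_eq_iff (a b : R) : f a = f b ↔ ∃ t ∈ S, a * t = b * t

end Localization

/-- The multiplicative Euler form `⟨M, K⟩ = ∏_p |Extᵖ(M, K)|^((-1)^p)`. -/
noncomputable def eulerForm {C : Type u} [Category.{v} C] [Abelian C] (M K : C) : ℚ :=
  ∏ᶠ p : ℕ, (Nat.card (Ext.{max u v} M K p) : ℚ) ^ ((-1 : ℤ) ^ p)

section ModifiedHallAlgebra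

variable (A : Type u) [Category.{v} A] [Abelian A]

/-- The Hall algebra of the category of `ℤ/2`-graded complexes over `A`. -/
abbrev ComplexHallAlg : Type (max u v) := HallAlg (⊤ : ObjectProperty (Z2Complex A))

/-- The Hall algebra of the exact category of `ℤ/2`-graded complexes over `add T`. -/
abbrev AddHallAlg {A : Type u} [Category.{v} A] [Abelian A] (T : A) : Type (max u v) :=
  HallAlg (complexesIn (addClosure T))

variable {A} in
/-- The class `[M]` of a complex. -/
noncomputable def complexCls (M : Z2Complex A) : ComplexHallAlg A := HallAlg.cls ⟨M, trivial⟩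

/-- The relations `[L] = [K ⊕ M]`, for `0 ⟶ K ⟶ L ⟶ M ⟶ 0` a short exact sequence of complexes
with `K` acyclic. -/
inductive AcyclicRel : ComplexHallAlg A → ComplexHallAlg A → Prop
  | of {K L M : Z2Complex A} (i : K ⟶ L) (p : L ⟶ M) (h : IsSES i p) (hK : K.Acyclic) :
      AcyclicRel (complexCls L) (complexCls (K ⊞ M))

variable [IsFinitary A]

/-- The quotient of the Hall algebra of complexes by the two-sided ideal generated by the
differences `[L] - [K ⊕ M]`, for `0 ⟶ K ⟶ L ⟶ M ⟶ 0` short exact with `K` acyclic. -/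
abbrev QuotientHallAlg : Type (max u v) := RingQuot (AcyclicRel A)

/-- The set of the `q [K]`, with `q ∈ ℚˣ` and `K` an acyclic complex, in the quotient algebra. -/
def acyclicSet : Set (QuotientHallAlg A) :=
  {x | ∃ (q : ℚ) (K : Z2Complex A), q ≠ 0 ∧ K.Acyclic ∧
    x = q • RingQuot.mkAlgHom ℚ (AcyclicRel A) (complexCls K)}

/-- The modified Ringel-Hall algebra of `A`. -/
abbrev ModifiedHallAlg : Type (max u v) := Localized (acyclicSet A)

/-- The canonical homomorphism from the Hall algebra of complexes to the modified
Ringel-Hall algebra. -/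
noncomputable def toModifiedHallAlg : ComplexHallAlg A →ₐ[ℚ] ModifiedHallAlg A :=
  (toLocalized (acyclicSet A)).comp (RingQuot.mkAlgHom ℚ (AcyclicRel A))

variable {A} (T : A) [IsTilting T]

/-- The set of the `q [K]`, with `q ∈ ℚˣ` and `K` an acyclic complex over `add T`. -/
def addAcyclicSet : Set (AddHallAlg T) :=
  {x | ∃ (q : ℚ) (K : (complexesIn (addClosure T)).FullSubcategory), q ≠ 0 ∧ K.obj.Acyclic ∧
    x = q • HallAlg.cls K}

/-- The localization of the Hall algebra of complexes over `add T` at the acyclic complexes. -/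
abbrev LocalizedAddHallAlg : Type (max u v) := Localized (addAcyclicSet T)

/-- The direct sum `T₁ ⊕ T₂` of the last two terms of a `T`-resolution, as a complex over
`add T`. -/
noncomputable def TResolution.sum {T : A} [IsTilting T] {M : Z2Complex A} (r : TResolution T M) :
    (complexesIn (addClosure T)).FullSubcategory :=
  ⟨r.T₁.obj ⊞ r.T₂.obj, ObjectProperty.prop_biprod _ r.T₁.property r.T₂.property⟩

end ModifiedHallAlgebra

end ModifiedHall

/-! The inverse isomorphism is constructed by hand. Write χ = |Hom| / |Ext¹|. Formula (ii) dictates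
its value `psi T M` on `[M]`, which is defined in two stages: embed `M` in a complex `X` over `Fac
T` with cokernel `U` acyclic over `add T` and impose `[X] = χ(M,U) [M][U]`; then cover `X` by a
complex `V` over `add T` with kernel `U'` acyclic over `add T` and impose `[V] = χ(X,U') [X][U']`.
It has to be shown that `psi` is well defined, respects the relations, makes acyclic complexes
invertible and is multiplicative.

Everything rests on one fact: an acyclic complex over `add T` is contractible, a retract of a sum of
disks `P = P` (`contractiblesIn_of_acyclic`). Disk functors are adjoint to evaluation, so extension
groups from or into such a complex `K` are controlled by those of `A`: they vanish in degrees at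
least 2, and in degree 1 from `K` to `Fac T` and from `add T` to `K`. Hence χ(-,K) and χ(K,-) are
multiplicative on extensions and `[K]` commutes up to scalars with every class over `add T`. This
gives the Ore conditions over `add T`. Pullbacks and pushouts compare resolutions
(`IsFacCls.unique`, `IsCls.unique`), and `psi_sub`, `psi_quot` evaluate `psi` on extensions with
such a `K` at one end.

The main step is `isPsiMul`: the average of `psi (mid e)` over `e` in `Ext¹(L,N)` is χ(L,N)
ψ(L)ψ(N). Over `add T` this is the Hall product itself, and it is carried to all complexes by
replacing `L` and `N` along their resolutions. These replacements induce surjections on `Ext¹`,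
except for `N ⊂ N'`. The classes missed there can be chosen to be pulled back from a disk complex
containing `L`, and `psi_mid_add` shows that adding such classes does not change `psi (mid e)`.

Conversely, the defining relations of the quotient algebra only treat acyclic subobjects.
`exists_quotCls_mul_eq` deduces the rule for a quotient acyclic over `add T`, after multiplication
by an acyclic class. The resolution formula therefore holds in the modified Hall algebra, so the two
homomorphisms are mutually inverse (`exists_comparison`). The Ore property of the acyclic classes
over `A` comes last, as a consequence of the isomorphism. -/

namespace ModifiedHall

/-! ### Effaceability of higher extension classes -/

section Effaceability

open HomologicalComplex DerivedCategory

variable {C : Type u} [Category.{v} C] [Abelian C]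

/-- Since `K` vanishes above degree `i`, all of `K.X i` consists of cycles. The projection to
homology followed by the isomorphism with `X` is the desired epimorphism. -/
lemma exists_epi_comp_single_of_quasiIsoAt {X : C} {K : CochainComplex C ℤ} {i : ℤ}
    (π : K ⟶ (single C (ComplexShape.up ℤ) i).obj X) [K.IsStrictlyLE i] [QuasiIsoAt π i] :
    ∃ (α : K.X i ⟶ X) (s : (single C (ComplexShape.up ℤ) i).obj (K.X i) ⟶ K), Epi α ∧
      s ≫ π = (single C (ComplexShape.up ℤ) i).map α := by
  have hK : IsZero (K.X (i + 1)) := K.isZero_of_isStrictlyLE i (i + 1) (by simp)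
  let e := K.iCyclesIso i (i + 1) (by simp) (hK.eq_of_tgt _ _)
  let α := e.inv ≫ K.homologyπ i ≫ homologyMap π i ≫ (singleObjHomologySelfIso _ _ _).hom
  have hα : Epi α := by
    have := (quasiIsoAt_iff_isIso_homologyMap π i).1 inferInstance
    exact epi_comp' inferInstance (epi_comp' inferInstance (epi_comp' inferInstance inferInstance))
  have : π.f i = α ≫ (singleObjXSelf (ComplexShape.up ℤ) i X).inv := by
    rw [← cancel_epi e.hom]
    dsimp only [α, e]
    rw [Category.assoc, Category.assoc, Category.assoc, Iso.hom_inv_id_assoc,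
      homologyπ_naturality_assoc, homologyπ_singleObjHomologySelfIso_hom_assoc,
      ← singleObjCyclesSelfIso_inv_iCycles, Iso.hom_inv_id_assoc, cyclesMap_i, iCyclesIso_hom]
  refine ⟨α, mkHomFromSingle (𝟙 _) fun j hj ↦ ?_, hα, ?_⟩
  · obtain rfl : i + 1 = j := hj
    exact hK.eq_of_tgt _ _
  · apply from_single_hom_ext
    rw [comp_f, mkHomFromSingle_f, Category.assoc, this, Category.id_comp]
    exact (single_map_f_self (c := ComplexShape.up ℤ) i α).symm

/-- Higher extension classes are effaceable. -/
lemma exists_epi_mk₀_comp_eq_zero [HasExt.{w} C] {X Y : C} {n : ℕ} (e : Ext.{w} X Y (n + 1)) :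
    ∃ (X' : C) (π : X' ⟶ X), Epi π ∧ (Ext.mk₀ π).comp e (zero_add _) = 0 := by
  let := HasDerivedCategory.standard C
  -- The class is a morphism in the derived category into `Y` placed in degree `-(n+1)`. It is
  -- represented by a roof whose apex `K` lives in degrees at most 0.
  let τ := ((singleFunctors C).shiftIso (n + 1) (-(n + 1)) 0 (by lia)).hom.app Y
  obtain ⟨K, _, π, h, g, hg⟩ := right_fac_of_isStrictlyLE
    (X := (CochainComplex.singleFunctor C 0).obj X)
    (Y := (CochainComplex.singleFunctor C (-(n + 1))).obj Y) (e.hom ≫ τ) 0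
  have : QuasiIsoAt π 0 := by
    rw [isIso_Q_map_iff_quasiIso] at h
    infer_instance
  obtain ⟨α, s, hα, hs⟩ := @exists_epi_comp_single_of_quasiIsoAt _ _ _ _ _ _ π inferInstance this
  refine ⟨_, α, hα, ?_⟩
  apply Ext.homEquiv.injective
  simp only [← cancel_mono τ, Ext.zero_hom, Limits.zero_comp]
  have h₁ : ((Ext.mk₀ α).comp e (zero_add _)).hom = (singleFunctor C 0).map α ≫ e.hom := by
    rw [Ext.comp_hom, Ext.mk₀_hom]
    exact ShiftedHom.mk₀_comp (0 : ℤ) rfl ((singleFunctor C 0).map α) e.hom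
  -- The source of `s` sits in degree 0 and the target of `g` in degree `-(n+1)`, so the composite
  -- already vanishes as a chain map.
  have h₂ : s ≫ g = 0 := by
    apply HomologicalComplex.from_single_hom_ext
    apply ((CochainComplex.singleFunctor C (-((n:ℤ) + 1))).obj Y).isZero_of_isStrictlyLE
      (-(n + 1)) 0 (by lia) |>.eq_of_tgt
  have h₁' : ((Ext.mk₀ α).comp e (zero_add _)).hom ≫ τ =
      Q.map ((CochainComplex.singleFunctor C 0).map α) ≫ e.hom ≫ τ := by
    rw [h₁, Category.assoc]; rfl
  refine h₁'.trans ?_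
  refine (congrArg (fun z ↦ Q.map z ≫ e.hom ≫ τ) hs.symm).trans ((congrArg _ hg).trans ?_)
  have h₃ : Q.map (s ≫ π) ≫ inv (Q.map π) ≫ Q.map g = 0 := by
    rw [Q.map_comp, Category.assoc, IsIso.hom_inv_id_assoc, ← Q.map_comp, h₂, Q.map_zero]
  exact h₃

end Effaceability

/-! ### Extension groups and pairs of exact functors -/

section Adjunction

variable {C : Type u} [Category.{v} C] [Abelian C] [HasExt.{w} C]
  {D : Type*} [Category* D] [Abelian D] [HasExt.{w} D]
  {F : C ⥤ D} {G : D ⥤ C} [F.Additive] [PreservesFiniteLimits F] [PreservesFiniteColimits F]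
  [G.Additive] [PreservesFiniteLimits G] [PreservesFiniteColimits G]

/-- Dimension shifting: an epimorphism killing `e` exhibits it as a Yoneda product with the class of
a short exact sequence. Inductions on the degree thus need no projectives. The end term is
identified with `X` by an equation so that it can be substituted. -/
lemma exists_eq_extClass_comp {X Y : C} {n : ℕ} (e : Ext.{w} X Y (n + 1)) :
    ∃ (S : ShortComplex C) (hS : S.ShortExact) (h : S.X₃ = X) (b : Ext.{w} S.X₁ Y n),
      h ▸ e = hS.extClass.comp b (add_comm 1 n) := by
  obtain ⟨X', π, _, h⟩ := exists_epi_mk₀_comp_eq_zero e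
  let S := ShortComplex.mk _ _ (kernel.condition π)
  have hS : S.ShortExact := { exact := ShortComplex.exact_kernel π }
  obtain ⟨b, hb⟩ := Ext.contravariant_sequence_exact₃ hS Y e h (add_comm 1 n)
  exact ⟨S, hS, rfl, b, hb.symm⟩

lemma mapExactFunctor_extClass_comp {S : ShortComplex C} (hS : S.ShortExact) :
    (hS.extClass.mapExactFunctor F).mapExactFunctor G =
      ((hS.map_of_exact F).map_of_exact G).extClass :=
  (congrArg _ (Ext.mapExactFunctor_extClass F hS)).trans
    (Ext.mapExactFunctor_extClass G (hS.map_of_exact F))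

/-- Naturality of the maps on extension groups with respect to `F ⋙ G ⟶ 𝟭`. -/
lemma mapExactFunctor_counit (τ : F ⋙ G ⟶ 𝟭 C) {X Y : C} {n : ℕ} (e : Ext.{w} X Y n) :
    ((e.mapExactFunctor F).mapExactFunctor G).comp (Ext.mk₀ (τ.app Y)) (add_zero n) =
      (Ext.mk₀ (τ.app X)).comp e (zero_add n) := by
  induction n generalizing X with
  | zero =>
    obtain ⟨f, rfl⟩ := (Ext.mk₀_bijective _ _).2 e
    have := τ.naturality f
    simp only [Functor.comp_map, Functor.id_map] at this
    rw [Ext.mapExactFunctor_mk₀, Ext.mapExactFunctor_mk₀]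
    exact (Ext.mk₀_comp_mk₀ _ _).trans ((congrArg _ this).trans (Ext.mk₀_comp_mk₀ _ _).symm)
  | succ n ih =>
    obtain ⟨S, hS, rfl, b, h⟩ := exists_eq_extClass_comp e
    dsimp only at h
    subst h
    have h₁ : ((hS.extClass.mapExactFunctor F).mapExactFunctor G).comp (Ext.mk₀ (τ.app S.X₁))
        (add_zero 1) = (Ext.mk₀ (τ.app S.X₃)).comp hS.extClass (zero_add 1) := by
      rw [mapExactFunctor_extClass_comp]
      exact ((hS.map_of_exact F).map_of_exact G).extClass_naturality hS (S.mapNatTrans τ)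
    rw [Ext.mapExactFunctor_comp _ _ _ (add_comm 1 n),
      Ext.mapExactFunctor_comp _ _ _ (add_comm 1 n),
      Ext.comp_assoc_of_third_deg_zero, ih b, ← Ext.comp_assoc_of_second_deg_zero]
    refine (congrArg (fun x ↦ Ext.comp x b (add_comm 1 n)) h₁).trans ?_
    exact Ext.comp_assoc _ _ _ _ _ (by lia)

/-- Naturality of the maps on extension groups with respect to `𝟭 ⟶ F ⋙ G`. -/
lemma mapExactFunctor_unit (τ : 𝟭 C ⟶ F ⋙ G) {X Y : C} {n : ℕ} (e : Ext.{w} X Y n) :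
    (Ext.mk₀ (τ.app X)).comp ((e.mapExactFunctor F).mapExactFunctor G) (zero_add n) =
      e.comp (Ext.mk₀ (τ.app Y)) (add_zero n) := by
  induction n generalizing X with
  | zero =>
    obtain ⟨f, rfl⟩ := (Ext.mk₀_bijective _ _).2 e
    have := τ.naturality f
    simp only [Functor.comp_map, Functor.id_map] at this
    rw [Ext.mapExactFunctor_mk₀, Ext.mapExactFunctor_mk₀]
    exact (Ext.mk₀_comp_mk₀ _ _).trans ((congrArg _ this.symm).trans (Ext.mk₀_comp_mk₀ _ _).symm)
  | succ n ih =>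
    obtain ⟨S, hS, rfl, b, h⟩ := exists_eq_extClass_comp e
    dsimp only at h
    subst h
    have h₁ : hS.extClass.comp (Ext.mk₀ (τ.app S.X₁)) (add_zero 1) = (Ext.mk₀ (τ.app S.X₃)).comp
        ((hS.extClass.mapExactFunctor F).mapExactFunctor G) (zero_add 1) := by
      rw [mapExactFunctor_extClass_comp]
      exact hS.extClass_naturality ((hS.map_of_exact F).map_of_exact G) (S.mapNatTrans τ)
    rw [Ext.mapExactFunctor_comp _ _ _ (add_comm 1 n),
      Ext.mapExactFunctor_comp _ _ _ (add_comm 1 n),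
      Ext.comp_assoc_of_third_deg_zero, ← ih b, ← Ext.comp_assoc_of_second_deg_zero]
    refine Eq.trans ?_ (congrArg (fun x ↦ Ext.comp x _ (add_comm 1 n)) h₁.symm)
    exact (Ext.comp_assoc _ _ _ _ _ (by lia)).symm

/-- Only the injective half of the adjunction isomorphism is needed: `e` is recovered from its
transpose in `Ext(P, F M)` by applying `G` and composing with the counit. One triangle identity,
`hs`, suffices for that. -/
lemma subsingleton_ext_of_counit (τ : F ⋙ G ⟶ 𝟭 C) {P : D} (s : P ⟶ F.obj (G.obj P))
    (hs : G.map s ≫ τ.app (G.obj P) = 𝟙 _) (M : C) (n : ℕ)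
    [Subsingleton (Ext.{w} P (F.obj M) n)] : Subsingleton (Ext.{w} (G.obj P) M n) := by
  refine subsingleton_of_forall_eq 0 fun e ↦ ?_
  have h₁ := mapExactFunctor_counit τ e
  have h₂ := congrArg (fun x ↦ (x.mapExactFunctor G))
    (Subsingleton.elim ((Ext.mk₀ s).comp (e.mapExactFunctor F) (zero_add n)) 0)
  simp only [Ext.mapExactFunctor_comp, Ext.mapExactFunctor_mk₀, Ext.mapExactFunctor_zero] at h₂
  have h₃ := congrArg (fun x ↦ (Ext.mk₀ (G.map s)).comp x (zero_add n)) h₁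
  rw [← Ext.comp_assoc_of_third_deg_zero, h₂, Ext.zero_comp] at h₃
  refine Eq.trans ?_ h₃.symm
  refine Eq.trans ?_ (Ext.mk₀_comp_mk₀_assoc _ _ _).symm
  rw [hs, Ext.mk₀_id_comp]

lemma subsingleton_ext_of_unit (τ : 𝟭 C ⟶ F ⋙ G) {P : D} (s : F.obj (G.obj P) ⟶ P)
    (hs : τ.app (G.obj P) ≫ G.map s = 𝟙 _) (M : C) (n : ℕ)
    [Subsingleton (Ext.{w} (F.obj M) P n)] : Subsingleton (Ext.{w} M (G.obj P) n) := by
  refine subsingleton_of_forall_eq 0 fun e ↦ ?_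
  have h₁ := mapExactFunctor_unit τ e
  have h₂ := congrArg (fun x ↦ (x.mapExactFunctor G))
    (Subsingleton.elim ((e.mapExactFunctor F).comp (Ext.mk₀ s) (add_zero n)) 0)
  simp only [Ext.mapExactFunctor_comp, Ext.mapExactFunctor_mk₀, Ext.mapExactFunctor_zero] at h₂
  have h₃ := congrArg (fun x ↦ x.comp (Ext.mk₀ (G.map s)) (add_zero n)) h₁
  rw [Ext.comp_assoc_of_third_deg_zero, h₂, Ext.comp_zero] at h₃
  refine Eq.trans ?_ h₃.symm
  rw [Ext.comp_assoc_of_third_deg_zero]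
  refine Eq.trans ?_ (congrArg (fun x ↦ e.comp x (add_zero n)) (Ext.mk₀_comp_mk₀ _ _).symm)
  rw [hs]
  exact (Ext.comp_mk₀_id e).symm

end Adjunction

/-! ### Pushouts, pullbacks and middle terms of extensions -/

section Middle

variable {C : Type u} [Category.{v} C] [Abelian C]

namespace IsSES

variable {X Y Z : C} {i : X ⟶ Y} {p : Y ⟶ Z}

/-- Pushing out a short exact sequence. -/
lemma of_isPushout (h : IsSES i p) {X' Y' : C} {f : X ⟶ X'} {g : Y ⟶ Y'} {i' : X' ⟶ Y'}
    (sq : IsPushout i f g i') {p' : Y' ⟶ Z} (h₁ : g ≫ p' = p) (h₂ : i' ≫ p' = 0) :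
    IsSES i' p' := by
  have := h.mono
  have := h.epi
  have : Mono i' := Abelian.mono_inr_of_isColimit _ _ sq.isColimit
  have : Epi (g ≫ p') := by rw [h₁]; infer_instance
  have : Epi p' := epi_of_epi g p'
  refine mk' h₂ fun {T} t ht ↦ ?_
  -- `Y'` is a quotient of `Y ⊞ X'`, so locally `t` has the form `g y + i' x'`. If `t` dies in `Z`,
  -- then `y` comes from `X`, and the square moves `g y` into `X'`.
  have : Epi (biprod.desc g i') := by
    refine Preadditive.epi_of_cancel_zero _ fun {W} k hk ↦ ?_
    refine sq.hom_ext ?_ ?_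
    · simpa using biprod.inl ≫= hk
    · simpa using biprod.inr ≫= hk
  obtain ⟨T', π, hπ, a, ha⟩ := surjective_up_to_refinements_of_epi (biprod.desc g i') t
  obtain ⟨b, hb⟩ := h.lift (a ≫ biprod.fst) (by
    have := π ≫= ht
    rw [reassoc_of% ha] at this
    rw [Category.assoc, ← h₁]
    have e : biprod.desc g i' ≫ p' = biprod.fst ≫ g ≫ p' := by ext <;> simp [h₂]
    rw [← e, this, comp_zero])
  refine ⟨T', π, hπ, a ≫ biprod.snd + b ≫ f, ?_⟩
  have e : biprod.desc g i' = biprod.fst ≫ g + biprod.snd ≫ i' := by ext <;> simp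
  rw [ha, Preadditive.add_comp, e, Preadditive.comp_add, Category.assoc, Category.assoc, ← sq.w,
    reassoc_of% hb, add_comm]

/-- Pulling back a short exact sequence. -/
lemma of_isPullback (h : IsSES i p) {Y' Z' : C} {f : Z' ⟶ Z} {g : Y' ⟶ Y} {p' : Y' ⟶ Z'}
    (sq : IsPullback g p' p f) {i' : X ⟶ Y'} (h₁ : i' ≫ g = i) (h₂ : i' ≫ p' = 0) :
    IsSES i' p' := by
  have := h.mono
  have := h.epi
  have : Epi p' := Abelian.epi_snd_of_isLimit _ _ sq.isLimit
  have : Mono (i' ≫ g) := by rw [h₁]; infer_instance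
  have : Mono i' := mono_of_mono i' g
  refine mk' h₂ fun {T} t ht ↦ ?_
  obtain ⟨b, hb⟩ := h.lift (t ≫ g) (by rw [Category.assoc, sq.w, reassoc_of% ht, zero_comp])
  refine ⟨T, 𝟙 T, inferInstance, b, sq.hom_ext ?_ ?_⟩
  · simp [h₁, hb]
  · simp [h₂, ht]

lemma exists_pushout (h : IsSES i p) {X' : C} (f : X ⟶ X') :
    ∃ (Y' : C) (g : Y ⟶ Y') (i' : X' ⟶ Y') (p' : Y' ⟶ Z), IsPushout i f g i' ∧
      g ≫ p' = p ∧ IsSES i' p' := by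
  have sq := IsPushout.of_hasPushout i f
  have e := pushout.inl_desc (f := i) (g := f) p 0 (by simp [h.zero])
  exact ⟨_, _, _, pushout.desc p 0 (by simp [h.zero]), sq, e,
    h.of_isPushout sq e (pushout.inr_desc _ _ _)⟩

lemma exists_pullback (h : IsSES i p) {Z' : C} (f : Z' ⟶ Z) :
    ∃ (Y' : C) (g : Y' ⟶ Y) (i' : X ⟶ Y') (p' : Y' ⟶ Z'), IsPullback g p' p f ∧
      i' ≫ g = i ∧ IsSES i' p' := by
  have sq := IsPullback.of_hasPullback p f
  have e := pullback.lift_fst (f := p) (g := f) i 0 (by simp [h.zero])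
  exact ⟨_, _, pullback.lift i 0 (by simp [h.zero]), _, sq, e,
    h.of_isPullback sq e (pullback.lift_snd _ _ _)⟩

/-- The pushout along a monomorphism has the same cokernel. -/
lemma exists_of_isPushout {X' Y' W : C} {f : X ⟶ X'} {g : Y ⟶ Y'} {i' : X' ⟶ Y'}
    (sq : IsPushout i f g i') {q : X' ⟶ W} (hf : IsSES f q) : ∃ q' : Y' ⟶ W, IsSES g q' := by
  refine ⟨sq.desc 0 q (by simp [hf.zero]), hf.of_isPushout sq.flip (sq.inr_desc _ _ _)
    (sq.inl_desc _ _ _)⟩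

/-- The pullback along an epimorphism has the same kernel. -/
lemma exists_of_isPullback {Y' Z' W : C} {f : Z' ⟶ Z} {g : Y' ⟶ Y} {p' : Y' ⟶ Z'}
    (sq : IsPullback g p' p f) {k : W ⟶ Z'} (hf : IsSES k f) : ∃ k' : W ⟶ Y', IsSES k' g := by
  refine ⟨sq.lift 0 k (by simp [hf.zero]), hf.of_isPullback sq.flip (sq.lift_snd _ _ _)
    (sq.lift_fst _ _ _)⟩

lemma extClass_naturality (h : IsSES i p) {X' Y' Z' : C} {i' : X' ⟶ Y'} {p' : Y' ⟶ Z'}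
    (h' : IsSES i' p') (a : X ⟶ X') (b : Y ⟶ Y') (c : Z ⟶ Z') (h₁ : i ≫ b = a ≫ i')
    (h₂ : b ≫ p' = p ≫ c) :
    h.extClass.comp (Ext.mk₀ a) (add_zero 1) = (Ext.mk₀ c).comp h'.extClass (zero_add 1) :=
  h.shortExact.extClass_naturality h'.shortExact
    { τ₁ := a, τ₂ := b, τ₃ := c, comm₁₂ := h₁.symm, comm₂₃ := h₂ }

lemma biprod (X Y : C) : IsSES (biprod.inl : X ⟶ X ⊞ Y) biprod.snd := by
  refine mk' (by simp) fun {T} t ht ↦ ⟨T, 𝟙 T, inferInstance, t ≫ biprod.fst, ?_⟩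
  ext <;> simp [ht]

lemma biprod' (X Y : C) : IsSES (biprod.inr : Y ⟶ X ⊞ Y) biprod.fst := by
  refine mk' (by simp) fun {T} t ht ↦ ⟨T, 𝟙 T, inferInstance, t ≫ biprod.snd, ?_⟩
  ext <;> simp [ht]

/-- The direct sum of a short exact sequence with an object on the left. -/
lemma biprodMap (W : C) (h : IsSES i p) :
    IsSES (biprod.map (𝟙 W) i) (biprod.snd ≫ p) := by
  have := h.mono
  have := h.epi
  refine mk' (by simp [h.zero]) fun {T} t ht ↦ ?_
  obtain ⟨g, hg⟩ := h.lift (t ≫ biprod.snd) (by simpa using ht)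
  refine ⟨T, 𝟙 T, inferInstance, biprod.lift (t ≫ biprod.fst) g, ?_⟩
  ext <;> simp [hg]

/-- The direct sum of a short exact sequence with an object on the right. -/
lemma biprodMap' (W : C) (h : IsSES i p) :
    IsSES (i ≫ biprod.inr) (biprod.map (𝟙 W) p) := by
  have := h.mono
  have := h.epi
  refine mk' (by ext <;> simp [h.zero]) fun {T} t ht ↦ ?_
  obtain ⟨g, hg⟩ := h.lift (t ≫ biprod.snd) (by simpa using ht =≫ biprod.snd)
  refine ⟨T, 𝟙 T, inferInstance, g, ?_⟩
  have := ht =≫ biprod.fst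
  ext
  · simpa using this
  · simp [hg]

lemma of_mono (f : X ⟶ Y) [Mono f] : IsSES f (cokernel.π f) :=
  ⟨cokernel.condition f, { exact := ShortComplex.exact_cokernel f }⟩

lemma of_epi (f : X ⟶ Y) [Epi f] : IsSES (kernel.ι f) f :=
  ⟨kernel.condition f, { exact := ShortComplex.exact_kernel f }⟩

/-- A short exact sequence with vanishing class splits. -/
lemma nonempty_iso_biprod (h : IsSES i p) (h₀ : h.extClass = 0) : Nonempty (Y ≅ X ⊞ Z) := by
  have hb : (biprod X Z).extClass = 0 := by
    have e : (Ext.mk₀ (biprod.inr : Z ⟶ X ⊞ Z)).comp ((Ext.mk₀ biprod.snd).comp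
        (biprod X Z).extClass (zero_add 1)) (zero_add 1) = 0 := by
      rw [show (Ext.mk₀ biprod.snd).comp (biprod X Z).extClass (zero_add 1) = 0 from
        (biprod X Z).shortExact.comp_extClass, Ext.comp_zero]
    rwa [Ext.mk₀_comp_mk₀_assoc, biprod.inr_snd, Ext.mk₀_id_comp] at e
  obtain ⟨φ, -⟩ := h.exists_iso_of_extClass_eq (biprod X Z) (h₀.trans hb.symm)
  exact ⟨φ⟩

lemma nonempty_iso_biprod_of_subsingleton (h : IsSES i p) [Subsingleton (Ext.{max u v} Z X 1)] :
    Nonempty (Y ≅ X ⊞ Z) :=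
  h.nonempty_iso_biprod (Subsingleton.elim _ _)

end IsSES

/-- An epimorphism `π` killing `e` makes `e` the pushforward of the class of the kernel sequence of
`π` along some map `ker π ⟶ X`; a pushout of that sequence realizes it. -/
lemma exists_isSES {X Z : C} (e : Ext.{max u v} Z X 1) :
    ∃ (Y : C) (i : X ⟶ Y) (p : Y ⟶ Z) (h : IsSES i p), h.extClass = e := by
  obtain ⟨Z', π, hπ, h₀⟩ := exists_epi_mk₀_comp_eq_zero (n := 0) e
  have h := IsSES.of_epi π
  obtain ⟨b, hb⟩ := Ext.contravariant_sequence_exact₃ h.shortExact X e h₀ (add_zero 1)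
  obtain ⟨f, rfl⟩ := (Ext.mk₀_bijective _ _).2 b
  obtain ⟨Y, g, i, p, sq, h₁, h₂⟩ := h.exists_pushout f
  refine ⟨Y, i, p, h₂, ?_⟩
  have := h.extClass_naturality h₂ f g (𝟙 Z) sq.w (by simp [h₁])
  rw [Ext.mk₀_id_comp] at this
  exact this.symm.trans hb

/-- A middle term of an extension. -/
noncomputable def mid {X Z : C} (e : Ext.{max u v} Z X 1) : C := (exists_isSES e).choose

lemma exists_isSES_mid {X Z : C} (e : Ext.{max u v} Z X 1) :
    ∃ (i : X ⟶ mid e) (p : mid e ⟶ Z) (h : IsSES i p), h.extClass = e :=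
  (exists_isSES e).choose_spec

lemma IsSES.nonempty_iso_mid {X Y Z : C} {i : X ⟶ Y} {p : Y ⟶ Z} (h : IsSES i p)
    {e : Ext.{max u v} Z X 1} (he : h.extClass = e) : Nonempty (Y ≅ mid e) := by
  obtain ⟨i', p', h', he'⟩ := exists_isSES_mid e
  obtain ⟨φ, -⟩ := h.exists_iso_of_extClass_eq h' (he.trans he'.symm)
  exact ⟨φ⟩

/-- There is a short exact sequence `0 ⟶ X ⟶ Y ⟶ Z ⟶ 0`. -/
def IsExtension (X Y Z : C) : Prop := Nonempty (SES X Y Z)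

lemma IsSES.isExtension {X Y Z : C} {i : X ⟶ Y} {p : Y ⟶ Z} (h : IsSES i p) :
    IsExtension X Y Z := ⟨⟨i, p, h⟩⟩

lemma IsExtension.congr {X Y Z X' Y' Z' : C} (h : IsExtension X Y Z) (a : X ≅ X') (b : Y ≅ Y')
    (c : Z ≅ Z') : IsExtension X' Y' Z' := by
  obtain ⟨w⟩ := h
  exact ⟨SES.congr a b c w⟩

lemma IsExtension.exists_mid {X Y Z : C} (h : IsExtension X Y Z) :
    ∃ e : Ext.{max u v} Z X 1, Nonempty (Y ≅ mid e) := by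
  obtain ⟨w⟩ := h
  exact ⟨_, w.isSES.nonempty_iso_mid rfl⟩

lemma isExtension_mid {X Z : C} (e : Ext.{max u v} Z X 1) : IsExtension X (mid e) Z := by
  obtain ⟨i, p, h, -⟩ := exists_isSES_mid e
  exact h.isExtension

lemma nonempty_mid_zero_iso (X Z : C) : Nonempty (mid (0 : Ext.{max u v} Z X 1) ≅ X ⊞ Z) := by
  obtain ⟨i, p, h, he⟩ := exists_isSES_mid (0 : Ext.{max u v} Z X 1)
  exact h.nonempty_iso_biprod he

/-- The restricted extension is the preimage of `L` in the middle term, with quotient `X / L = U`.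
This lemma and the next three follow the middle term under the functoriality of `Ext¹` along
monomorphisms and epimorphisms in either variable. -/
lemma isExtension_mid_precomp_mono {L X U : C} {i : L ⟶ X} {q : X ⟶ U} (h : IsSES i q) {N : C}
    (e : Ext.{max u v} X N 1) :
    IsExtension (mid ((Ext.mk₀ i).comp e (zero_add 1))) (mid e) U := by
  obtain ⟨a, b, hab, he⟩ := exists_isSES_mid e
  obtain ⟨Y, r, s, h₁, h₂, h₃⟩ := exists_compat_sub ⟨i, q, h⟩ ⟨a, b, hab⟩
  have := r.isSES.extClass_naturality hab (𝟙 N) s.i i (by simpa using h₂) h₃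
  rw [Ext.comp_mk₀_id, he] at this
  obtain ⟨φ⟩ := r.isSES.nonempty_iso_mid this
  exact s.isSES.isExtension.congr φ (Iso.refl _) (Iso.refl _)

lemma isExtension_mid_precomp_epi {U X' X : C} {i : U ⟶ X'} {p : X' ⟶ X} (h : IsSES i p) {N : C}
    (e : Ext.{max u v} X N 1) :
    IsExtension U (mid ((Ext.mk₀ p).comp e (zero_add 1))) (mid e) := by
  obtain ⟨a, b, hab, he⟩ := exists_isSES_mid e
  obtain ⟨Y, g, i', p', sq, h₁, h₂⟩ := hab.exists_pullback p
  have := h₂.extClass_naturality hab (𝟙 N) g p (by simpa using h₁) sq.w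
  rw [Ext.comp_mk₀_id, he] at this
  obtain ⟨φ⟩ := h₂.nonempty_iso_mid this
  obtain ⟨k, hk⟩ := IsSES.exists_of_isPullback sq h
  exact hk.isExtension.congr (Iso.refl _) φ (Iso.refl _)

lemma isExtension_mid_postcomp_mono {N Y U : C} {i : N ⟶ Y} {q : Y ⟶ U} (h : IsSES i q) {L : C}
    (e : Ext.{max u v} L N 1) :
    IsExtension (mid e) (mid (e.comp (Ext.mk₀ i) (add_zero 1))) U := by
  obtain ⟨a, b, hab, he⟩ := exists_isSES_mid e
  obtain ⟨Y', g, i', p', sq, h₁, h₂⟩ := hab.exists_pushout i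
  have := hab.extClass_naturality h₂ i g (𝟙 L) sq.w (by simp [h₁])
  rw [Ext.mk₀_id_comp, he] at this
  obtain ⟨φ⟩ := h₂.nonempty_iso_mid this.symm
  obtain ⟨k, hk⟩ := IsSES.exists_of_isPushout sq h
  exact hk.isExtension.congr (Iso.refl _) φ (Iso.refl _)

lemma isExtension_mid_postcomp_epi {U N' N : C} {i : U ⟶ N'} {p : N' ⟶ N} (h : IsSES i p) {L : C}
    (e : Ext.{max u v} L N' 1) :
    IsExtension U (mid e) (mid (e.comp (Ext.mk₀ p) (add_zero 1))) := by
  obtain ⟨a, b, hab, he⟩ := exists_isSES_mid e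
  obtain ⟨X, w, s, h₁, h₂, h₃⟩ := exists_compat_quot ⟨i, p, h⟩ ⟨a, b, hab⟩
  have := hab.extClass_naturality w.isSES p s.p (𝟙 L) h₃ (by simpa using h₁.symm)
  rw [Ext.mk₀_id_comp, he] at this
  obtain ⟨φ⟩ := w.isSES.nonempty_iso_mid this.symm
  exact s.isSES.isExtension.congr (Iso.refl _) (Iso.refl _) φ

end Middle

/-! ### Counting in finite groups -/

section FiniteGroups

/-- Evaluate the sum of `g (f a + x)` over all pairs in both orders: for fixed `a` the translation
is absorbed by `x`, and for fixed `x = f b + v` the period `v` drops out and `b` is absorbed by `a`.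
Surjectivity of `f` is replaced by the requirement that periods of `g` fill up what its image
misses. -/
lemma card_smul_sum_eq_card_smul_sum_comp {G H V : Type*} [AddGroup G] [AddGroup H] [Fintype G]
    [Fintype H] [AddCommMonoid V] (f : H →+ G) (g : G → V)
    (h : ∀ x, ∃ a v, x = f a + v ∧ ∀ y, g (y + v) = g y) :
    Fintype.card H • ∑ x, g x = Fintype.card G • ∑ a, g (f a) := by
  have h₁ : ∑ a : H, ∑ x : G, g (f a + x) = Fintype.card H • ∑ x, g x := by
    rw [← Finset.card_univ, ← Finset.sum_const]
    exact Finset.sum_congr rfl fun a _ ↦ Equiv.sum_comp (Equiv.addLeft (f a)) g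
  have h₂ : ∑ x : G, ∑ a : H, g (f a + x) = Fintype.card G • ∑ a, g (f a) := by
    rw [← Finset.card_univ, ← Finset.sum_const]
    refine Finset.sum_congr rfl fun x _ ↦ ?_
    obtain ⟨b, v, rfl, hv⟩ := h x
    simp_rw [← add_assoc, hv, ← map_add]
    exact Equiv.sum_comp (Equiv.addRight b) fun a ↦ g (f a)
  rw [← h₁, ← h₂, Finset.sum_comm]

lemma card_eq_card_ker_mul {A B : Type*} [AddGroup A] [AddGroup B] (f : A →+ B) :
    Nat.card A = Nat.card f.ker * Nat.card f.range := by
  rw [← AddSubgroup.index_ker, AddSubgroup.card_mul_index]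

lemma card_mul_of_exact {A₁ A₂ A₃ A₄ A₅ A₆ : Type*} [AddGroup A₁] [AddGroup A₂] [AddGroup A₃]
    [AddGroup A₄] [AddGroup A₅] [AddGroup A₆] (f₁ : A₁ →+ A₂) (f₂ : A₂ →+ A₃) (f₃ : A₃ →+ A₄)
    (f₄ : A₄ →+ A₅) (f₅ : A₅ →+ A₆) (h₁ : Function.Injective f₁) (h₂ : f₁.range = f₂.ker)
    (h₃ : f₂.range = f₃.ker) (h₄ : f₃.range = f₄.ker) (h₅ : f₄.range = f₅.ker)
    (h₆ : Function.Surjective f₅) :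
    Nat.card A₁ * Nat.card A₃ * Nat.card A₅ = Nat.card A₂ * Nat.card A₄ * Nat.card A₆ := by
  have e₁ : Nat.card A₁ = Nat.card f₁.range := by
    rw [card_eq_card_ker_mul f₁, (AddMonoidHom.ker_eq_bot_iff f₁).2 h₁]; simp
  have e₆ : Nat.card A₆ = Nat.card f₅.range := by
    rw [AddMonoidHom.range_eq_top.2 h₆]; simp
  rw [e₁, e₆, card_eq_card_ker_mul f₂, card_eq_card_ker_mul f₃, card_eq_card_ker_mul f₄,
    card_eq_card_ker_mul f₅, h₂, h₃, h₄, h₅]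
  ring

end FiniteGroups

/-! ### The truncated Euler form -/

section EulerForm

variable {C : Type u} [Category.{v} C] [Abelian C] [HallFinite C]

/-- Finitely many isomorphism classes occur as middle terms, each of them carries finitely many
short exact sequences, and every class comes from one of these. -/
instance finite_ext_one (Z X : C) : Finite (Ext.{max u v} Z X 1) := by
  have : Finite {y : Quotient (isIsomorphicSetoid C) | Nonempty (SES X y.out Z)} :=
    HallFinite.finite_middle Z X
  let f (w : Σ y : {y : Quotient (isIsomorphicSetoid C) | Nonempty (SES X y.out Z)},
    SES X y.1.out Z) : Ext.{max u v} Z X 1 := w.2.isSES.extClass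
  refine Finite.of_surjective f fun e ↦ ?_
  obtain ⟨i, p, h, he⟩ := exists_isSES_mid e
  obtain ⟨φ⟩ := Quotient.mk_out (s := isIsomorphicSetoid C) (mid e)
  let w : SES X (Quotient.mk (isIsomorphicSetoid C) (mid e)).out Z :=
    ⟨i ≫ φ.inv, φ.hom ≫ p, h.comp_iso φ.symm⟩
  exact ⟨⟨⟨_, ⟨w⟩⟩, w⟩,
    (IsSES.extClass_eq_of_iso h w.isSES φ.inv rfl (by simp [w])).symm.trans he⟩

noncomputable instance (Z X : C) : Fintype (Ext.{max u v} Z X 1) := Fintype.ofFinite _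

/-- The truncated multiplicative Euler form `|Hom(M, N)| / |Ext¹(M, N)|`. -/
noncomputable def chi (M N : C) : ℚ :=
  (Nat.card (M ⟶ N) : ℚ) / Nat.card (Ext.{max u v} M N 1)

lemma card_hom_ne_zero (M N : C) : (Nat.card (M ⟶ N) : ℚ) ≠ 0 := by
  exact_mod_cast Nat.card_pos.ne'

lemma card_ext_ne_zero (M N : C) : (Nat.card (Ext.{max u v} M N 1) : ℚ) ≠ 0 := by
  exact_mod_cast Nat.card_pos.ne'

lemma chi_ne_zero (M N : C) : chi M N ≠ 0 :=
  div_ne_zero (card_hom_ne_zero M N) (card_ext_ne_zero M N)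

lemma card_ext_zero (M N : C) : Nat.card (Ext.{max u v} M N 0) = Nat.card (M ⟶ N) :=
  Nat.card_congr Ext.homEquiv₀

/-- Surjectivity of the last restriction map cuts the long exact sequence down to six terms. It is
assumed in place of the vanishing of `Ext²`, which need not hold between arbitrary complexes. -/
lemma chi_mul_left_of_surjective {M E M' : C} {i : M ⟶ E} {p : E ⟶ M'} (h : IsSES i p) (N : C)
    (hs : Function.Surjective fun e : Ext.{max u v} E N 1 ↦ (Ext.mk₀ i).comp e (zero_add 1)) :
    chi E N = chi M N * chi M' N := by
  have hS := h.shortExact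
  have key := card_mul_of_exact ((Ext.mk₀ p).precomp N (zero_add 0))
    ((Ext.mk₀ i).precomp N (zero_add 0)) (hS.extClass.precomp N (add_zero 1))
    ((Ext.mk₀ p).precomp N (zero_add 1)) ((Ext.mk₀ i).precomp N (zero_add 1))
    (by have := h.epi; exact Ext.precomp_mk₀_injective_of_epi N p) ?_ ?_ ?_ ?_ hs
  · simp only [card_ext_zero] at key
    have := card_ext_ne_zero E N
    have := card_ext_ne_zero M N
    have := card_ext_ne_zero M' N
    rw [chi, chi, chi]
    field_simp
    norm_cast
    linarith
  · ext x
    refine ⟨?_, fun hx ↦ Ext.contravariant_sequence_exact₂ hS N x hx⟩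
    rintro ⟨y, rfl⟩
    change (Ext.mk₀ i).comp ((Ext.mk₀ p).comp y (zero_add _)) (zero_add _) = 0
    rw [Ext.mk₀_comp_mk₀_assoc, h.zero, Ext.mk₀_zero, Ext.zero_comp]
  · ext x
    refine ⟨?_, fun hx ↦ Ext.contravariant_sequence_exact₁ hS N x (add_zero 1) hx⟩
    rintro ⟨y, rfl⟩
    exact hS.extClass_comp_assoc y (h := add_zero 1)
  · ext x
    refine ⟨?_, fun hx ↦ Ext.contravariant_sequence_exact₃ hS N x hx (add_zero 1)⟩
    rintro ⟨y, rfl⟩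
    exact hS.comp_extClass_assoc y (add_zero 1)
  · ext x
    refine ⟨?_, fun hx ↦ Ext.contravariant_sequence_exact₂ hS N x hx⟩
    rintro ⟨y, rfl⟩
    change (Ext.mk₀ i).comp ((Ext.mk₀ p).comp y (zero_add _)) (zero_add _) = 0
    rw [Ext.mk₀_comp_mk₀_assoc, h.zero, Ext.mk₀_zero, Ext.zero_comp]

lemma chi_mul_right_of_surjective {N E N' : C} {i : N ⟶ E} {p : E ⟶ N'} (h : IsSES i p) (M : C)
    (hs : Function.Surjective fun e : Ext.{max u v} M E 1 ↦ e.comp (Ext.mk₀ p) (add_zero 1)) :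
    chi M E = chi M N * chi M N' := by
  have hS := h.shortExact
  have key := card_mul_of_exact ((Ext.mk₀ i).postcomp M (add_zero 0))
    ((Ext.mk₀ p).postcomp M (add_zero 0)) (hS.extClass.postcomp M (zero_add 1))
    ((Ext.mk₀ i).postcomp M (add_zero 1)) ((Ext.mk₀ p).postcomp M (add_zero 1))
    (by have := h.mono; exact Ext.postcomp_mk₀_injective_of_mono M i) ?_ ?_ ?_ ?_ hs
  · simp only [card_ext_zero] at key
    have := card_ext_ne_zero M E
    have := card_ext_ne_zero M N
    have := card_ext_ne_zero M N'
    rw [chi, chi, chi]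
    field_simp
    norm_cast
    linarith
  · ext x
    refine ⟨?_, fun hx ↦ Ext.covariant_sequence_exact₂ M hS x hx⟩
    rintro ⟨y, rfl⟩
    change (y.comp (Ext.mk₀ i) (add_zero _)).comp (Ext.mk₀ p) (add_zero _) = 0
    rw [Ext.comp_assoc_of_third_deg_zero, Ext.mk₀_comp_mk₀, h.zero, Ext.mk₀_zero, Ext.comp_zero]
  · ext x
    refine ⟨?_, fun hx ↦ Ext.covariant_sequence_exact₃ M hS x (zero_add 1) hx⟩
    rintro ⟨y, rfl⟩
    change (y.comp (Ext.mk₀ p) (add_zero 0)).comp hS.extClass (zero_add 1) = 0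
    rw [Ext.comp_assoc_of_second_deg_zero, hS.comp_extClass, Ext.comp_zero]
  · ext x
    refine ⟨?_, fun hx ↦ Ext.covariant_sequence_exact₁ M hS x hx (zero_add 1)⟩
    rintro ⟨y, rfl⟩
    change (y.comp hS.extClass (zero_add 1)).comp (Ext.mk₀ i) (add_zero 1) = 0
    rw [Ext.comp_assoc_of_third_deg_zero, hS.extClass_comp, Ext.comp_zero]
  · ext x
    refine ⟨?_, fun hx ↦ Ext.covariant_sequence_exact₂ M hS x hx⟩
    rintro ⟨y, rfl⟩
    change (y.comp (Ext.mk₀ i) (add_zero _)).comp (Ext.mk₀ p) (add_zero _) = 0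
    rw [Ext.comp_assoc_of_third_deg_zero, Ext.mk₀_comp_mk₀, h.zero, Ext.mk₀_zero, Ext.comp_zero]

section

variable {X Y Z : C} {i : X ⟶ Y} {p : Y ⟶ Z} (h : IsSES i p)
include h

lemma surjective_precomp (N : C) (n : ℕ) [Subsingleton (Ext.{max u v} Z N (n + 1))] :
    Function.Surjective fun e : Ext.{max u v} Y N n ↦ (Ext.mk₀ i).comp e (zero_add n) :=
  fun x ↦ Ext.contravariant_sequence_exact₁ h.shortExact N x (add_comm 1 n)
    (Subsingleton.elim _ _)

lemma surjective_postcomp (M : C) (n : ℕ) [Subsingleton (Ext.{max u v} M X (n + 1))] :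
    Function.Surjective fun e : Ext.{max u v} M Y n ↦ e.comp (Ext.mk₀ p) (add_zero n) :=
  fun x ↦ Ext.covariant_sequence_exact₃ M h.shortExact x rfl (Subsingleton.elim _ _)

end

lemma chi_mul_left {M E M' : C} (h : IsExtension M E M') (N : C)
    [Subsingleton (Ext.{max u v} M' N 2)] : chi E N = chi M N * chi M' N := by
  obtain ⟨⟨i, p, h⟩⟩ := h
  exact chi_mul_left_of_surjective h N (surjective_precomp h N 1)

lemma chi_mul_right {N E N' : C} (h : IsExtension N E N') (M : C)
    [Subsingleton (Ext.{max u v} M N 2)] : chi M E = chi M N * chi M N' := by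
  obtain ⟨⟨i, p, h⟩⟩ := h
  exact chi_mul_right_of_surjective h M (surjective_postcomp h M 1)

lemma chi_biprod_left (M M' N : C) : chi (M ⊞ M') N = chi M N * chi M' N := by
  refine chi_mul_left_of_surjective (IsSES.biprod M M') N fun e ↦
    ⟨(Ext.mk₀ biprod.fst).comp e (zero_add 1), ?_⟩
  dsimp only
  rw [Ext.mk₀_comp_mk₀_assoc, biprod.inl_fst, Ext.mk₀_id_comp]

lemma chi_biprod_right (M N N' : C) : chi M (N ⊞ N') = chi M N * chi M N' := by
  refine chi_mul_right_of_surjective (IsSES.biprod N N') M fun e ↦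
    ⟨e.comp (Ext.mk₀ biprod.inr) (add_zero 1), ?_⟩
  dsimp only
  rw [Ext.comp_assoc_of_third_deg_zero, Ext.mk₀_comp_mk₀, biprod.inr_snd, Ext.comp_mk₀_id]

lemma chi_congr {M M' N N' : C} (a : M ≅ M') (b : N ≅ N') : chi M N = chi M' N' := by
  have e : (Ext.{max u v} M N 1) ≃ (Ext.{max u v} M' N' 1) :=
    { toFun x := (Ext.mk₀ a.inv).comp (x.comp (Ext.mk₀ b.hom) (add_zero 1)) (zero_add 1)
      invFun x := (Ext.mk₀ a.hom).comp (x.comp (Ext.mk₀ b.inv) (add_zero 1)) (zero_add 1)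
      left_inv x := by
        dsimp only
        rw [Ext.comp_assoc_of_third_deg_zero, Ext.comp_assoc_of_third_deg_zero]
        simp
      right_inv x := by
        dsimp only
        rw [Ext.comp_assoc_of_third_deg_zero, Ext.comp_assoc_of_third_deg_zero]
        simp }
  rw [chi, chi, Nat.card_congr e, Nat.card_congr (Iso.homCongr a b)]

end EulerForm

/-! ### The Hall product as a sum over `Ext¹` -/

section Product

variable {C : Type u} [Category.{v} C] [Abelian C] [HallFinite C] {P : ObjectProperty C}
  [P.IsClosedUnderExtensions] [P.ContainsZero] [P.IsClosedUnderIsomorphisms]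

lemma prop_mid (L N : P.FullSubcategory) (e : Ext.{max u v} L.obj N.obj 1) : P (mid e) := by
  obtain ⟨w⟩ := isExtension_mid e
  exact prop_of_SES w N.property L.property

/-- The Hall product, as a sum over an extension group. -/
lemma HallAlg.cls_mul_cls (L N : P.FullSubcategory) :
    HallAlg.cls L * HallAlg.cls N = (Nat.card (L.obj ⟶ N.obj) : ℚ)⁻¹ •
      ∑ e : Ext.{max u v} L.obj N.obj 1, HallAlg.cls ⟨mid e, prop_mid L N e⟩ := by
  classical
  refine Finsupp.ext fun b ↦ ?_
  have hb : IsoClass.mk ⟨b.rep, b.rep_property⟩ = b := IsoClass.mk_rep b b.rep_property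
  have h₁ : (HallAlg.cls L * HallAlg.cls N).coeff b = hallNumber L.obj N.obj b.rep := by
    conv_lhs => rw [← hb]
    exact HallAlg.cls_mul_cls_apply L N ⟨b.rep, b.rep_property⟩
  refine h₁.trans ?_
  have h₂ : ((Nat.card (L.obj ⟶ N.obj) : ℚ)⁻¹ •
      ∑ e : Ext.{max u v} L.obj N.obj 1, HallAlg.cls (P := P) ⟨mid e, prop_mid L N e⟩).coeff b =
      (Nat.card (L.obj ⟶ N.obj) : ℚ)⁻¹ * ∑ e : Ext.{max u v} L.obj N.obj 1,
        if IsoClass.mk (P := P) ⟨mid e, prop_mid L N e⟩ = b then 1 else 0 := by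
    refine congrArg ((Nat.card (L.obj ⟶ N.obj) : ℚ)⁻¹ * ·) ?_
    refine (Finsupp.finsetSum_apply Finset.univ (fun e : Ext.{max u v} L.obj N.obj 1 ↦
      (Finsupp.single (IsoClass.mk (P := P) ⟨mid e, prop_mid L N e⟩) (1 : ℚ))) b).trans ?_
    exact Finset.sum_congr rfl fun e _ ↦ Finsupp.single_apply
  refine Eq.trans ?_ h₂.symm
  -- It remains to identify `extWithMiddle` with the set of classes `e` for which `mid e` lies in
  -- the isomorphism class `b`.
  rw [hallNumber, div_eq_inv_mul, Finset.sum_boole]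
  congr 2
  rw [Nat.card_eq_fintype_card, Fintype.card_subtype]
  congr 1
  ext e
  simp only [Finset.mem_filter, Finset.mem_univ, true_and]
  constructor
  · rintro ⟨i, p, h, he⟩
    obtain ⟨φ⟩ := h.nonempty_iso_mid he
    rw [← hb]
    exact IsoClass.mk_eq_of_iso φ.symm
  · intro h
    obtain ⟨φ⟩ := IsoClass.nonempty_iso_rep (P := P) ⟨mid e, prop_mid L N e⟩
    rw [h] at φ
    obtain ⟨i, p, h', he⟩ := exists_isSES_mid e
    refine ⟨_, _, h'.comp_iso φ.symm, ?_⟩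
    exact (IsSES.extClass_eq_of_iso h' (h'.comp_iso φ.symm) φ.inv rfl (by simp)).symm.trans he

lemma HallAlg.cls_mul_cls_of_subsingleton (L N : P.FullSubcategory)
    [Subsingleton (Ext.{max u v} L.obj N.obj 1)] (X : P.FullSubcategory)
    (h : Nonempty (X.obj ≅ N.obj ⊞ L.obj)) :
    HallAlg.cls X = chi L.obj N.obj • (HallAlg.cls L * HallAlg.cls N) := by
  obtain ⟨φ⟩ := nonempty_mid_zero_iso N.obj L.obj
  obtain ⟨ψ⟩ := h
  have h₁ : HallAlg.cls X = HallAlg.cls (P := P) ⟨mid (0 : Ext.{max u v} L.obj N.obj 1),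
    prop_mid L N 0⟩ := HallAlg.cls_eq_of_iso (ψ ≪≫ φ.symm)
  have h₂ : Nat.card (Ext.{max u v} L.obj N.obj 1) = 1 := Nat.card_unique
  rw [HallAlg.cls_mul_cls, Fintype.sum_subsingleton _ (0 : Ext.{max u v} L.obj N.obj 1), ← h₁, chi,
    h₂, Nat.cast_one, div_one, smul_smul, mul_inv_cancel₀ (card_hom_ne_zero _ _), one_smul]

end Product

/-! ### Disk complexes and their extension groups -/

section Contractible

variable {A : Type u} [Category.{v} A] [Abelian A]

lemma zmod_two_cases (i j : ZMod 2) : i = j ∨ i = j + 1 := by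
  revert i j; decide

lemma zmod_two_add_one_ne (j : ZMod 2) : j + 1 ≠ j := by
  revert j; decide

lemma zmod_two_add_add (j : ZMod 2) : j + 1 + 1 = j := by
  revert j; decide

variable (A) in
/-- The functor sending `P` to the contractible complex `P ⟶ P` (the identity), with nonzero
differential starting in degree `j`. -/
@[simps]
def disk (j : ZMod 2) : A ⥤ Z2Complex A where
  obj P :=
    { X := fun _ ↦ P
      d := fun a b ↦ if a = j ∧ b = j + 1 then 𝟙 P else 0
      shape := fun a b h ↦ if_neg (by rintro ⟨rfl, rfl⟩; exact h rfl)
      d_comp_d' := fun a b c _ _ ↦ by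
        by_cases hb : b = j + 1
        · rw [if_neg (c := b = j ∧ c = j + 1), comp_zero]
          rintro ⟨h, -⟩
          exact zmod_two_add_one_ne j (hb.symm.trans h)
        · rw [if_neg (c := a = j ∧ b = j + 1), zero_comp]
          exact fun h ↦ hb h.2 }
  map f :=
    { f := fun _ ↦ f
      comm' := fun a b _ ↦ by
        by_cases h : a = j ∧ b = j + 1
        · simp [if_pos h]
        · simp [if_neg h] }

instance (j : ZMod 2) : (disk A j).Additive where
  map_add := rfl

instance (j : ZMod 2) : PreservesFiniteLimits (disk A j) where
  preservesFiniteLimits J _ _ :=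
    HomologicalComplex.preservesLimitsOfShape_of_eval _ fun _ ↦
      inferInstanceAs (PreservesLimitsOfShape J (𝟭 A))

instance (j : ZMod 2) : PreservesFiniteColimits (disk A j) where
  preservesFiniteColimits J _ _ :=
    HomologicalComplex.preservesColimitsOfShape_of_eval _ fun _ ↦
      inferInstanceAs (PreservesColimitsOfShape J (𝟭 A))

lemma z2_hom_ext {K L : Z2Complex A} {f g : K ⟶ L} (j : ZMod 2) (h₁ : f.f j = g.f j)
    (h₂ : f.f (j + 1) = g.f (j + 1)) : f = g := by
  ext i
  obtain rfl | rfl := zmod_two_cases i j <;> assumption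

/-- The components of the canonical morphism `P_j ⟶ M` for `P = M^j`. -/
noncomputable def diskCounitAux (j : ZMod 2) (M : Z2Complex A) (i : ZMod 2) : M.X j ⟶ M.X i :=
  if h : i = j then (M.XIsoOfEq h.symm).hom else M.d j i

lemma diskCounitAux_self (j : ZMod 2) (M : Z2Complex A) : diskCounitAux j M j = 𝟙 _ := by
  simp [diskCounitAux]

lemma diskCounitAux_succ (j : ZMod 2) (M : Z2Complex A) :
    diskCounitAux j M (j + 1) = M.d j (j + 1) := by
  simp [diskCounitAux]

/-- The components of the canonical morphism `M ⟶ P_j` for `P = M^(j+1)`. -/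
noncomputable def diskUnitAux (j : ZMod 2) (M : Z2Complex A) (i : ZMod 2) :
    M.X i ⟶ M.X (j + 1) :=
  if h : i = j + 1 then (M.XIsoOfEq h).hom else M.d i (j + 1)

lemma diskUnitAux_succ (j : ZMod 2) (M : Z2Complex A) : diskUnitAux j M (j + 1) = 𝟙 _ := by
  simp [diskUnitAux]

lemma diskUnitAux_self (j : ZMod 2) (M : Z2Complex A) :
    diskUnitAux j M j = M.d j (j + 1) := by
  simp [diskUnitAux]

lemma disk_d_self (j : ZMod 2) (P : A) : ((disk A j).obj P).d j (j + 1) = 𝟙 P :=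
  if_pos ⟨rfl, rfl⟩

lemma disk_d_succ (j : ZMod 2) (P : A) : ((disk A j).obj P).d (j + 1) j = 0 :=
  if_neg fun h ↦ zmod_two_add_one_ne j h.1

/-- Morphisms of complexes from their components. -/
def z2Hom {K L : Z2Complex A} (j : ZMod 2) (f : ∀ i, K.X i ⟶ L.X i)
    (h₁ : f j ≫ L.d j (j + 1) = K.d j (j + 1) ≫ f (j + 1))
    (h₂ : f (j + 1) ≫ L.d (j + 1) j = K.d (j + 1) j ≫ f j) : K ⟶ L where
  f := f
  comm' a b hab := by
    obtain rfl : a + 1 = b := hab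
    obtain rfl | rfl := zmod_two_cases a j
    · exact h₁
    · rw [zmod_two_add_add]
      exact h₂

/-- The counit `P_j ⟶ M` for `P = M^j`. -/
noncomputable def diskCounit (j : ZMod 2) :
    HomologicalComplex.eval A (ComplexShape.up (ZMod 2)) j ⋙ disk A j ⟶ 𝟭 (Z2Complex A) where
  app M := z2Hom (K := (disk A j).obj (M.X j)) (L := M) j (diskCounitAux j M)
    (by
      have h : diskCounitAux j M j ≫ M.d j (j + 1) = 𝟙 (M.X j) ≫ diskCounitAux j M (j + 1) := by
        rw [diskCounitAux_self, diskCounitAux_succ]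
      rw [disk_d_self]
      exact h)
    (by
      have h : diskCounitAux j M (j + 1) ≫ M.d (j + 1) j = 0 ≫ diskCounitAux j M j := by
        rw [diskCounitAux_succ, zero_comp, HomologicalComplex.d_comp_d]
      rw [disk_d_succ]
      exact h)
  naturality M N f := by
    refine z2_hom_ext j ?_ ?_
    · change f.f j ≫ diskCounitAux j N j = diskCounitAux j M j ≫ f.f j
      simp [diskCounitAux_self]
    · change f.f j ≫ diskCounitAux j N (j + 1) = diskCounitAux j M (j + 1) ≫ f.f (j + 1)
      simp [diskCounitAux_succ]

/-- The unit `M ⟶ P_j` for `P = M^(j+1)`. -/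
noncomputable def diskUnit (j : ZMod 2) :
    𝟭 (Z2Complex A) ⟶ HomologicalComplex.eval A (ComplexShape.up (ZMod 2)) (j + 1) ⋙ disk A j where
  app M := z2Hom (K := M) (L := (disk A j).obj (M.X (j + 1))) j (diskUnitAux j M)
    (by
      have h : diskUnitAux j M j ≫ 𝟙 _ = M.d j (j + 1) ≫ diskUnitAux j M (j + 1) := by
        rw [diskUnitAux_self, diskUnitAux_succ]
      rw [disk_d_self]
      exact h)
    (by
      have h : diskUnitAux j M (j + 1) ≫ 0 = M.d (j + 1) j ≫ diskUnitAux j M j := by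
        rw [diskUnitAux_self, comp_zero, HomologicalComplex.d_comp_d]
      rw [disk_d_succ]
      exact h)
  naturality M N f := by
    refine z2_hom_ext j ?_ ?_
    · change f.f j ≫ diskUnitAux j N j = diskUnitAux j M j ≫ f.f (j + 1)
      simp [diskUnitAux_self]
    · change f.f (j + 1) ≫ diskUnitAux j N (j + 1) = diskUnitAux j M (j + 1) ≫ f.f (j + 1)
      simp [diskUnitAux_succ]

/-- A triangle identity for the adjunction between `disk A j` and evaluation at `j`, all that
`subsingleton_ext_disk_left` uses of it. -/
lemma diskCounit_app_disk (j : ZMod 2) (P : A) : (diskCounit j).app ((disk A j).obj P) = 𝟙 _ := by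
  refine z2_hom_ext j ?_ ?_
  · exact diskCounitAux_self _ _
  · exact (diskCounitAux_succ _ _).trans (disk_d_self j P)

lemma diskUnit_app_disk (j : ZMod 2) (P : A) : (diskUnit j).app ((disk A j).obj P) = 𝟙 _ := by
  refine z2_hom_ext j ?_ ?_
  · exact (diskUnitAux_self _ _).trans (disk_d_self j P)
  · exact diskUnitAux_succ _ _

lemma subsingleton_ext_disk_left (j : ZMod 2) (P : A) (M : Z2Complex A) (n : ℕ)
    (h : Subsingleton (Ext.{max u v} P (M.X j) n)) :
    Subsingleton (Ext.{max u v} ((disk A j).obj P) M n) := by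
  have : Subsingleton (Ext.{max u v} P
    ((HomologicalComplex.eval A (ComplexShape.up (ZMod 2)) j).obj M) n) := h
  refine subsingleton_ext_of_counit (F := HomologicalComplex.eval A _ j) (diskCounit j)
    (P := P) (𝟙 P) ?_ M n
  rw [diskCounit_app_disk]
  exact (congrArg (· ≫ 𝟙 _) ((disk A j).map_id P)).trans (Category.comp_id _)

lemma subsingleton_ext_disk_right (j : ZMod 2) (P : A) (M : Z2Complex A) (n : ℕ)
    (h : Subsingleton (Ext.{max u v} (M.X (j + 1)) P n)) :
    Subsingleton (Ext.{max u v} M ((disk A j).obj P) n) := by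
  have : Subsingleton (Ext.{max u v}
    ((HomologicalComplex.eval A (ComplexShape.up (ZMod 2)) (j + 1)).obj M) P n) := h
  refine subsingleton_ext_of_unit (F := HomologicalComplex.eval A _ (j + 1)) (diskUnit j)
    (P := P) (𝟙 P) ?_ M n
  rw [diskUnit_app_disk]
  exact (congrArg (𝟙 _ ≫ ·) ((disk A j).map_id P)).trans (Category.comp_id _)

/-- The complex `P_0 ⊕ Q_1`. -/
noncomputable abbrev disks (P Q : A) : Z2Complex A := (disk A 0).obj P ⊞ (disk A 1).obj Q

/-- The contractible complexes with components in `P`. -/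
def contractiblesIn (P : ObjectProperty A) : ObjectProperty (Z2Complex A) :=
  fun K ↦ ∃ X Y : A, P X ∧ P Y ∧ Nonempty (Retract K (disks X Y))

lemma subsingleton_ext_biprod_left {C : Type u} [Category.{v} C] [Abelian C] (X Y Z : C) (n : ℕ)
    (h₁ : Subsingleton (Ext.{max u v} X Z n)) (h₂ : Subsingleton (Ext.{max u v} Y Z n)) :
    Subsingleton (Ext.{max u v} (X ⊞ Y) Z n) :=
  ⟨fun _ _ ↦ Ext.biprod_ext (Subsingleton.elim _ _) (Subsingleton.elim _ _)⟩

lemma subsingleton_ext_biprod_right {C : Type u} [Category.{v} C] [Abelian C] (X Y Z : C) (n : ℕ)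
    (h₁ : Subsingleton (Ext.{max u v} Z X n)) (h₂ : Subsingleton (Ext.{max u v} Z Y n)) :
    Subsingleton (Ext.{max u v} Z (X ⊞ Y) n) :=
  Ext.addEquivBiprod.subsingleton

lemma subsingleton_ext_of_retract_left {C : Type u} [Category.{v} C] [Abelian C] {X Y : C}
    (r : Retract X Y) (Z : C) (n : ℕ) (h : Subsingleton (Ext.{max u v} Y Z n)) :
    Subsingleton (Ext.{max u v} X Z n) := by
  refine subsingleton_of_forall_eq 0 fun e ↦ ?_
  have h₁ : (Ext.mk₀ r.i).comp ((Ext.mk₀ r.r).comp e (zero_add n)) (zero_add n) = e := by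
    rw [Ext.mk₀_comp_mk₀_assoc, r.retract, Ext.mk₀_id_comp]
  rw [← h₁, Subsingleton.elim ((Ext.mk₀ r.r).comp e (zero_add n)) 0, Ext.comp_zero]

lemma subsingleton_ext_of_retract_right {C : Type u} [Category.{v} C] [Abelian C] {X Y : C}
    (r : Retract X Y) (Z : C) (n : ℕ) (h : Subsingleton (Ext.{max u v} Z Y n)) :
    Subsingleton (Ext.{max u v} Z X n) := by
  refine subsingleton_of_forall_eq 0 fun e ↦ ?_
  have h₁ : (e.comp (Ext.mk₀ r.i) (add_zero n)).comp (Ext.mk₀ r.r) (add_zero n) = e := by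
    rw [Ext.comp_assoc_of_third_deg_zero, Ext.mk₀_comp_mk₀, r.retract, Ext.comp_mk₀_id]
  rw [← h₁, Subsingleton.elim (e.comp (Ext.mk₀ r.i) (add_zero n)) 0, Ext.zero_comp]

lemma subsingleton_ext_contractible_left {P : ObjectProperty A} {K : Z2Complex A}
    (hK : contractiblesIn P K) (M : Z2Complex A) (n : ℕ)
    (h : ∀ X, P X → ∀ i, Subsingleton (Ext.{max u v} X (M.X i) n)) :
    Subsingleton (Ext.{max u v} K M n) := by
  obtain ⟨X, Y, hX, hY, ⟨r⟩⟩ := hK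
  exact subsingleton_ext_of_retract_left r M n (subsingleton_ext_biprod_left _ _ _ _
    (subsingleton_ext_disk_left _ _ _ _ (h X hX _)) (subsingleton_ext_disk_left _ _ _ _ (h Y hY _)))

lemma subsingleton_ext_contractible_right {P : ObjectProperty A} {K : Z2Complex A}
    (hK : contractiblesIn P K) (M : Z2Complex A) (n : ℕ)
    (h : ∀ X, P X → ∀ i, Subsingleton (Ext.{max u v} (M.X i) X n)) :
    Subsingleton (Ext.{max u v} M K n) := by
  obtain ⟨X, Y, hX, hY, ⟨r⟩⟩ := hK
  exact subsingleton_ext_of_retract_right r M n (subsingleton_ext_biprod_right _ _ _ _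
    (subsingleton_ext_disk_right _ _ _ _ (h X hX _)) (subsingleton_ext_disk_right _ _ _ _ (h Y hY _)))

end Contractible

/-! ### Tilting theory in a hereditary category -/

section TiltingTheory

variable {A : Type u} [Category.{v} A] [Abelian A]

lemma subsingleton_ext_of_two_le [IsHereditary A] (X Y : A) (n : ℕ) (hn : 2 ≤ n) :
    Subsingleton (Ext.{max u v} X Y n) :=
  have := IsHereditary.hasProjectiveDimensionLT X
  HasProjectiveDimensionLT.subsingleton X 2 n hn Y

instance [IsHereditary A] (X Y : A) : Subsingleton (Ext.{max u v} X Y (1 + 1)) :=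
  subsingleton_ext_of_two_le X Y 2 le_rfl

lemma addClosure_self (T : A) : addClosure T T :=
  addClosure_of_sum (ι := Unit) (fun _ ↦ 𝟙 T) (fun _ ↦ 𝟙 T) (by simp)

lemma addClosure_biproduct (T : A) (n : ℕ) : addClosure T (⨁ fun _ : Fin n ↦ T) :=
  ⟨n, ⟨Retract.refl _⟩⟩

lemma addClosure_of_retract {T X Y : A} (r : Retract X Y) (h : addClosure T Y) :
    addClosure T X := by
  obtain ⟨n, ⟨s⟩⟩ := h
  exact ⟨n, ⟨r.trans s⟩⟩

lemma facClosure_of_addClosure {T X : A} (h : addClosure T X) : facClosure T X :=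
  ⟨X, 𝟙 X, h, inferInstance⟩

lemma facClosure_of_epi {T X Y : A} (f : X ⟶ Y) [Epi f] (h : facClosure T X) :
    facClosure T Y := by
  obtain ⟨Z, g, hZ, hg⟩ := h
  exact ⟨Z, g ≫ f, hZ, epi_comp _ _⟩

lemma subsingleton_ext_of_addClosure {T X Y : A} (hX : addClosure T X) (n : ℕ)
    (h : Subsingleton (Ext.{max u v} T Y n)) : Subsingleton (Ext.{max u v} X Y n) := by
  obtain ⟨m, f, g, hfg⟩ := exists_sum_of_addClosure hX
  refine subsingleton_of_forall_eq 0 fun e ↦ ?_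
  rw [← Ext.mk₀_id_comp e, ← hfg, Ext.mk₀_sum, Ext.sum_comp]
  refine Finset.sum_eq_zero fun a _ ↦ ?_
  rw [← Ext.mk₀_comp_mk₀_assoc, Subsingleton.elim ((Ext.mk₀ (g a)).comp e _) 0, Ext.comp_zero]

variable {T : A} [hT : IsTilting T]

lemma subsingleton_ext_add_fac {X Y : A} (hX : addClosure T X) (hY : facClosure T Y) (n : ℕ)
    (hn : 0 < n) : Subsingleton (Ext.{max u v} X Y n) := by
  obtain ⟨𝒯, ℱ, -, -, rfl, h, -, -⟩ := hT.exists_torsionPair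
  exact subsingleton_ext_of_addClosure hX n (h Y hY n hn)

section Hereditary

variable [IsHereditary A] [IsFinitary A]

lemma addClosure_of_ext {Z : A} (hZ : facClosure T Z)
    (h : ∀ X, facClosure T X → Subsingleton (Ext.{max u v} Z X 1)) : addClosure T Z := by
  obtain ⟨𝒯, ℱ, -, -, rfl, -, h', -⟩ := hT.exists_torsionPair
  refine h' Z hZ fun X hX i hi ↦ ?_
  obtain rfl | hi := (Nat.succ_le_iff.2 hi).eq_or_lt
  · exact h X hX
  · exact subsingleton_ext_of_two_le _ _ _ hi

/-- In the torsion sequence of `X`, the free part receives no map from `T`, and its `Ext¹` from `T`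
is a quotient of `Ext¹(T, X) = 0` by heredity. Hence the free part is zero by axiom (5). -/
lemma facClosure_of_ext {X : A} (h : Subsingleton (Ext.{max u v} T X 1)) : facClosure T X := by
  obtain ⟨𝒯, ℱ, h₁, -, rfl, -, -, h₂⟩ := hT.exists_torsionPair
  obtain ⟨X', X'', i, p, hX', hX'', hip⟩ := h₁.exists_ses X
  have h₃ : IsZero X'' := by
    refine h₂ X'' fun n ↦ ?_
    obtain rfl | rfl | hn : n = 0 ∨ n = 1 ∨ 2 ≤ n := by omega
    · refine subsingleton_of_forall_eq 0 fun e ↦ ?_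
      obtain ⟨f, rfl⟩ := (Ext.mk₀_bijective _ _).2 e
      rw [h₁.hom_eq_zero (facClosure_of_addClosure (addClosure_self T)) hX'' f, Ext.mk₀_zero]
    · exact (surjective_postcomp hip T 1).subsingleton
    · exact subsingleton_ext_of_two_le _ _ _ hn
  have := hip.epi
  obtain ⟨g, hg⟩ := hip.lift (𝟙 X) (h₃.eq_of_tgt _ _)
  have : Epi i := epi_of_epi_fac hg
  exact facClosure_of_epi i hX'

lemma facClosure_iff {X : A} : facClosure T X ↔ Subsingleton (Ext.{max u v} T X 1) :=
  ⟨fun h ↦ subsingleton_ext_add_fac (addClosure_self T) h 1 one_pos, facClosure_of_ext⟩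

lemma facClosure_of_isSES {X Y Z : A} {i : X ⟶ Y} {p : Y ⟶ Z} (h : IsSES i p)
    (hX : facClosure T X) (hZ : facClosure T Z) : facClosure T Y := by
  rw [facClosure_iff] at hX hZ ⊢
  refine subsingleton_of_forall_eq 0 fun e ↦ ?_
  obtain ⟨x, rfl⟩ := Ext.covariant_sequence_exact₂ _ h.shortExact e (Subsingleton.elim _ _)
  rw [Subsingleton.elim x 0, Ext.zero_comp]

/-- A subobject in `Fac T` of an object of `add T` lies in `add T`. -/
lemma addClosure_of_mono {X Y : A} (f : X ⟶ Y) [Mono f] (hX : facClosure T X)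
    (hY : addClosure T Y) : addClosure T X := by
  refine addClosure_of_ext hX fun Z hZ ↦ ?_
  have := subsingleton_ext_add_fac hY hZ 1 one_pos
  -- By heredity `Ext¹(Y, Z) ⟶ Ext¹(X, Z)` is onto, and its source is zero.
  exact (surjective_precomp (IsSES.of_mono f) Z 1).subsingleton

/-- As `Ext¹(T, Y) = 0`, the group `Ext¹(T, X)` is the cokernel of `Hom(T, Y) ⟶ Hom(T, Z)`, which
`hs` makes zero. So `X` is a subobject in `Fac T` of an object of `add T`. -/
lemma addClosure_kernel {X Y Z : A} {i : X ⟶ Y} {p : Y ⟶ Z} (h : IsSES i p)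
    (hY : addClosure T Y) (hs : ∀ g : T ⟶ Z, ∃ f : T ⟶ Y, f ≫ p = g) : addClosure T X := by
  have := h.mono
  refine addClosure_of_mono i (facClosure_of_ext (subsingleton_of_forall_eq 0 fun e ↦ ?_)) hY
  have := subsingleton_ext_add_fac (addClosure_self T) (facClosure_of_addClosure hY) 1 one_pos
  obtain ⟨x, rfl⟩ := Ext.covariant_sequence_exact₁ _ h.shortExact e (Subsingleton.elim _ _)
    (zero_add 1)
  obtain ⟨g, rfl⟩ := (Ext.mk₀_bijective _ _).2 x
  obtain ⟨f, rfl⟩ := hs g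
  rw [← Ext.mk₀_comp_mk₀_assoc, h.shortExact.comp_extClass, Ext.comp_zero]

/-- The universal extension. -/
lemma exists_isSES_facClosure (T : A) [IsTilting T] (X : A) :
    ∃ (Y P : A) (i : X ⟶ Y) (p : Y ⟶ P), IsSES i p ∧ facClosure T Y ∧ addClosure T P := by
  have := IsFinitary.finite_ext T X
  obtain ⟨n, ⟨φ⟩⟩ := Finite.exists_equiv_fin (Ext.{max u v} T X 1)
  -- One copy of `T` for each element of the finite group `Ext¹(T, X)`, so that no basis has to be
  -- chosen; `e` restricts to every element.
  let P : A := ⨁ fun _ : Fin n ↦ T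
  let e : Ext.{max u v} P X 1 :=
    ∑ a, (Ext.mk₀ (biproduct.π (fun _ : Fin n ↦ T) a)).comp (φ.symm a) (zero_add 1)
  have he (a : Fin n) : (Ext.mk₀ (biproduct.ι (fun _ : Fin n ↦ T) a)).comp e (zero_add 1) =
      φ.symm a := by
    rw [Ext.comp_sum, Finset.sum_eq_single a]
    · rw [Ext.mk₀_comp_mk₀_assoc, biproduct.ι_π_self, Ext.mk₀_id_comp]
    · intro b _ hb
      rw [Ext.mk₀_comp_mk₀_assoc, biproduct.ι_π_ne _ hb.symm, Ext.mk₀_zero, Ext.zero_comp]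
    · simp
  obtain ⟨Y, i, p, h, hc⟩ := exists_isSES e
  refine ⟨Y, P, i, p, h, facClosure_of_ext ?_, addClosure_biproduct T n⟩
  -- A class `y` in `Ext¹(T, Y)` comes from `Ext¹(T, X)`, hence from a restriction of `e`; and `e`
  -- becomes zero when pushed to `Y`.
  refine subsingleton_of_forall_eq 0 fun y ↦ ?_
  have := subsingleton_ext_add_fac (addClosure_self T)
    (facClosure_of_addClosure (addClosure_biproduct T n)) 1 one_pos
  obtain ⟨x, rfl⟩ := Ext.covariant_sequence_exact₂ _ h.shortExact y (Subsingleton.elim _ _)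
  rw [← φ.symm_apply_apply x, ← he, ← hc, Ext.comp_assoc_of_third_deg_zero]
  exact (congrArg (fun z ↦ (Ext.mk₀ _).comp z (zero_add 1)) h.shortExact.extClass_comp).trans
    (by rw [Ext.comp_zero])

/-- Right `add T`-approximations. -/
lemma exists_approximation {X : A} (hX : facClosure T X) :
    ∃ (P : A) (p : P ⟶ X), addClosure T P ∧ Epi p ∧ ∀ g : T ⟶ X, ∃ f : T ⟶ P, f ≫ p = g := by
  have := IsFinitary.finite_hom T X
  obtain ⟨n, ⟨φ⟩⟩ := Finite.exists_equiv_fin (T ⟶ X)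
  let p : (⨁ fun _ : Fin n ↦ T) ⟶ X := biproduct.desc φ.symm
  have hp (g : T ⟶ X) : ∃ f : T ⟶ ⨁ fun _ : Fin n ↦ T, f ≫ p = g :=
    ⟨biproduct.ι (fun _ : Fin n ↦ T) (φ g), by simp [p]⟩
  refine ⟨_, p, addClosure_biproduct T n, ?_, hp⟩
  -- The given epimorphism `g` from an object of `add T` factors through `p`, because every map `T ⟶
  -- X` does; this makes `p` an epimorphism.
  obtain ⟨Y, g, hY, hg⟩ := hX
  obtain ⟨m, a, b, hab⟩ := exists_sum_of_addClosure hY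
  choose f hf using fun c ↦ hp (b c ≫ g)
  have : (∑ c, a c ≫ f c) ≫ p = g := by
    rw [← Category.id_comp g, ← hab]
    simp [Preadditive.sum_comp, hf]
  exact epi_of_epi_fac this

end Hereditary

end TiltingTheory

/-! ### Acyclic complexes and contractions -/

section Acyclic

variable {A : Type u} [Category.{v} A] [Abelian A]

section SES

variable {K L M : Z2Complex A} {i : K ⟶ L} {p : L ⟶ M} (h : IsSES i p)
include h

lemma IsSES.acyclic_mid (hK : K.Acyclic) (hM : M.Acyclic) : L.Acyclic :=
  h.shortExact.acyclic_X₂ hK hM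

lemma IsSES.acyclic_left (hL : L.Acyclic) (hM : M.Acyclic) : K.Acyclic :=
  h.shortExact.acyclic_X₁
    ⟨fun n ↦ (quasiIsoAt_iff_exactAt p n (hL n)).2 (hM n)⟩

lemma IsSES.acyclic_left_of_quasiIso (hp : QuasiIso p) : K.Acyclic :=
  h.shortExact.acyclic_X₁ hp

lemma IsSES.acyclic_right_of_quasiIso (hi : QuasiIso i) : M.Acyclic :=
  h.shortExact.acyclic_X₃ hi

lemma IsSES.quasiIso_left (hM : M.Acyclic) : QuasiIso i := by
  refine ⟨fun n ↦ ?_⟩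
  rw [quasiIsoAt_iff_isIso_homologyMap]
  have e₁ : Mono (HomologicalComplex.homologyMap i n) := by
    refine (h.shortExact.homology_exact₁ (n - 1) n (sub_add_cancel n 1)).mono_g ?_
    exact ((hM (n - 1)).isZero_homology).eq_of_src _ _
  have e₂ : Epi (HomologicalComplex.homologyMap i n) := by
    refine (h.shortExact.homology_exact₂ n).epi_f ?_
    exact ((hM n).isZero_homology).eq_of_tgt _ _
  exact isIso_of_mono_of_epi _

lemma IsSES.quasiIso_right (hK : K.Acyclic) : QuasiIso p := by
  refine ⟨fun n ↦ ?_⟩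
  rw [quasiIsoAt_iff_isIso_homologyMap]
  have e₁ : Mono (HomologicalComplex.homologyMap p n) := by
    refine (h.shortExact.homology_exact₂ n).mono_g ?_
    exact ((hK n).isZero_homology).eq_of_src _ _
  have e₂ : Epi (HomologicalComplex.homologyMap p n) := by
    refine (h.shortExact.homology_exact₃ n (n + 1) rfl).epi_f ?_
    exact ((hK (n + 1)).isZero_homology).eq_of_tgt _ _
  exact isIso_of_mono_of_epi _

end SES

lemma acyclic_biprod {K L : Z2Complex A} (hK : K.Acyclic) (hL : L.Acyclic) : (K ⊞ L).Acyclic :=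
  (IsSES.biprod K L).acyclic_mid hK hL

lemma z2_next (j : ZMod 2) : (ComplexShape.up (ZMod 2)).next j = j + 1 :=
  ComplexShape.next_eq' _ rfl

lemma z2_prev (j : ZMod 2) : (ComplexShape.up (ZMod 2)).prev (j + 1) = j :=
  ComplexShape.prev_eq' _ rfl

lemma z2_prev' (j : ZMod 2) : (ComplexShape.up (ZMod 2)).prev j = j + 1 :=
  ComplexShape.prev_eq' _ (zmod_two_add_add j)

lemma z2_next' (j : ZMod 2) : (ComplexShape.up (ZMod 2)).next (j + 1) = j :=
  ComplexShape.next_eq' _ (zmod_two_add_add j)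

lemma acyclic_disk (j : ZMod 2) (P : A) : ((disk A j).obj P).Acyclic := by
  intro n
  obtain rfl | rfl := zmod_two_cases n j
  · rw [HomologicalComplex.exactAt_iff' _ (n + 1) n (n + 1) (z2_prev' n) (z2_next n)]
    rw [ShortComplex.exact_iff_mono]
    · have h : Mono (𝟙 P) := inferInstance
      rw [← disk_d_self n P] at h
      exact h
    · exact disk_d_succ n P
  · rw [HomologicalComplex.exactAt_iff' _ j (j + 1) j (z2_prev j) (z2_next' j)]
    rw [ShortComplex.exact_iff_epi]
    · have h : Epi (𝟙 P) := inferInstance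
      rw [← disk_d_self j P] at h
      exact h
    · exact disk_d_succ j P

lemma acyclic_disks (P Q : A) : (disks P Q).Acyclic :=
  acyclic_biprod (acyclic_disk _ _) (acyclic_disk _ _)

lemma complexesIn_disk {P : ObjectProperty A} (j : ZMod 2) {X : A} (hX : P X) :
    complexesIn P ((disk A j).obj X) := fun _ ↦ hX

lemma complexesIn_biprod {P : ObjectProperty A} [P.IsClosedUnderExtensions]
    [P.IsClosedUnderIsomorphisms] {K L : Z2Complex A} (hK : complexesIn P K)
    (hL : complexesIn P L) : complexesIn P (K ⊞ L) :=
  ObjectProperty.prop_biprod _ hK hL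

lemma complexesIn_of_isSES {P : ObjectProperty A} [P.IsClosedUnderExtensions]
    [P.IsClosedUnderIsomorphisms] {K L M : Z2Complex A} {i : K ⟶ L} {p : L ⟶ M} (h : IsSES i p)
    (hK : complexesIn P K) (hM : complexesIn P M) : complexesIn P L :=
  (complexesIn P).prop_X₂_of_shortExact h.shortExact hK hM

section Contraction

variable {K : Z2Complex A} (s₀ : K.X 0 ⟶ K.X 1) (s₁ : K.X 1 ⟶ K.X 0)

/-- A contraction exhibits a complex as a retract of a sum of disks. -/
noncomputable def retractOfContraction (h₀ : K.d 0 1 ≫ s₁ + s₀ ≫ K.d 1 0 = 𝟙 _)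
    (h₁ : s₁ ≫ K.d 0 1 + K.d 1 0 ≫ s₀ = 𝟙 _) : Retract K (disks (K.X 0) (K.X 1)) where
  i := biprod.lift ((diskUnit 0).app K ≫ (disk A 0).map s₁)
    ((diskUnit 1).app K ≫ (disk A 1).map s₀)
  r := biprod.desc ((diskCounit 0).app K) ((diskCounit 1).app K)
  retract := by
    refine (biprod.lift_desc (f := ((diskUnit 0).app K ≫ (disk A 0).map s₁ :
      K ⟶ (disk A 0).obj (K.X 0))) (g := ((diskUnit 1).app K ≫ (disk A 1).map s₀ :
      K ⟶ (disk A 1).obj (K.X 1))) ..).trans ?_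
    refine z2_hom_ext 0 ?_ ?_
    · have a₁ : diskUnitAux 0 K 0 = K.d 0 1 := diskUnitAux_self 0 K
      have a₂ : diskCounitAux 0 K 0 = 𝟙 (K.X 0) := diskCounitAux_self 0 K
      have b₁ : diskUnitAux 1 K 0 = 𝟙 (K.X 0) := diskUnitAux_succ 1 K
      have b₂ : diskCounitAux 1 K 0 = K.d 1 0 := diskCounitAux_succ 1 K
      have h : (diskUnitAux 0 K 0 ≫ s₁) ≫ diskCounitAux 0 K 0 +
          (diskUnitAux 1 K 0 ≫ s₀) ≫ diskCounitAux 1 K 0 = 𝟙 (K.X 0) := by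
        rw [a₁, a₂, b₁, b₂]
        simpa using h₀
      exact h
    · have a₁ : diskUnitAux 0 K 1 = 𝟙 (K.X 1) := diskUnitAux_succ 0 K
      have a₂ : diskCounitAux 0 K 1 = K.d 0 1 := diskCounitAux_succ 0 K
      have b₁ : diskUnitAux 1 K 1 = K.d 1 0 := diskUnitAux_self 1 K
      have b₂ : diskCounitAux 1 K 1 = 𝟙 (K.X 1) := diskCounitAux_self 1 K
      have h : (diskUnitAux 0 K 1 ≫ s₁) ≫ diskCounitAux 0 K 1 +
          (diskUnitAux 1 K 1 ≫ s₀) ≫ diskCounitAux 1 K 1 = 𝟙 (K.X 1) := by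
        rw [a₁, a₂, b₁, b₂]
        simpa using h₁
      exact h

end Contraction

section Split

variable [IsHereditary A] [IsFinitary A] {T : A} [IsTilting T]

lemma exists_isSES_of_acyclic {K : Z2Complex A} (hK : K.Acyclic) :
    ∃ (Z₀ Z₁ : A) (i₀ : Z₀ ⟶ K.X 0) (p₀ : K.X 0 ⟶ Z₁) (i₁ : Z₁ ⟶ K.X 1) (p₁ : K.X 1 ⟶ Z₀),
      IsSES i₀ p₀ ∧ IsSES i₁ p₁ ∧ K.d 0 1 = p₀ ≫ i₁ ∧ K.d 1 0 = p₁ ≫ i₀ := by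
  have e₀ := hK 0
  have e₁ := hK 1
  rw [HomologicalComplex.exactAt_iff' _ 1 0 1 (z2_prev' 0) (z2_next 0)] at e₀
  rw [HomologicalComplex.exactAt_iff' _ 0 1 0 (z2_prev' 1) (z2_next 1)] at e₁
  have h₀ : K.d 0 1 = kernel.lift (K.d 1 0) (K.d 0 1) (by simp) ≫ kernel.ι _ := by simp
  have h₁ : K.d 1 0 = kernel.lift (K.d 0 1) (K.d 1 0) (by simp) ≫ kernel.ι _ := by simp
  have p₀ : Epi (kernel.lift (K.d 1 0) (K.d 0 1) (by simp)) := e₁.epi_kernelLift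
  have p₁ : Epi (kernel.lift (K.d 0 1) (K.d 1 0) (by simp)) := e₀.epi_kernelLift
  refine ⟨kernel (K.d 0 1), kernel (K.d 1 0), kernel.ι _, kernel.lift _ (K.d 0 1) (by simp),
    kernel.ι _, kernel.lift _ (K.d 1 0) (by simp), ?_, ?_, h₀, h₁⟩
  · refine IsSES.mk' ?_ fun {S} f hf ↦
      ⟨S, 𝟙 S, inferInstance, kernel.lift _ f ?_, by rw [kernel.lift_ι, Category.id_comp]⟩
    · rw [← cancel_mono (kernel.ι (K.d 1 0))]
      simp
    · rw [h₀, reassoc_of% hf, zero_comp]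
  · refine IsSES.mk' ?_ fun {S} f hf ↦
      ⟨S, 𝟙 S, inferInstance, kernel.lift _ f ?_, by rw [kernel.lift_ι, Category.id_comp]⟩
    · rw [← cancel_mono (kernel.ι (K.d 0 1))]
      simp
    · rw [h₁, reassoc_of% hf, zero_comp]

lemma IsSES.exists_splitting {X Y Z : A} {i : X ⟶ Y} {p : Y ⟶ Z} (h : IsSES i p)
    [Subsingleton (Ext.{max u v} Z X 1)] :
    ∃ (r : Y ⟶ X) (s : Z ⟶ Y), i ≫ r = 𝟙 X ∧ s ≫ p = 𝟙 Z ∧ s ≫ r = 0 ∧ r ≫ i + p ≫ s = 𝟙 Y := by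
  obtain ⟨x, hx⟩ := Ext.covariant_sequence_exact₃ _ h.shortExact (Ext.mk₀ (𝟙 Z)) (zero_add 1)
    (Subsingleton.elim _ _)
  obtain ⟨s, rfl⟩ := (Ext.mk₀_bijective _ _).2 x
  have hs : s ≫ p = 𝟙 _ := by
    apply (Ext.mk₀_bijective _ _).1
    rw [← hx, Ext.mk₀_comp_mk₀]
  let σ := ShortComplex.Splitting.ofExactOfSection _ h.shortExact.exact s hs h.mono
  exact ⟨σ.r, σ.s, σ.f_r, σ.s_g, σ.s_r, σ.id⟩

/-- The cycle objects are quotients of the components, hence in `Fac T`, and also subobjects of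
them, hence in `add T`. The two short exact sequences between cycles and components therefore split,
and the splittings assemble into a contraction. -/
lemma contractiblesIn_of_acyclic {K : Z2Complex A} (hT : complexesIn (addClosure T) K)
    (hK : K.Acyclic) : contractiblesIn (addClosure T) K := by
  obtain ⟨Z₀, Z₁, i₀, p₀, i₁, p₁, h₀, h₁, e₀, e₁⟩ := exists_isSES_of_acyclic hK
  have f₀ : facClosure T Z₀ :=
    have := h₁.epi
    facClosure_of_epi p₁ (facClosure_of_addClosure (hT 1))
  have f₁ : facClosure T Z₁ :=
    have := h₀.epi
    facClosure_of_epi p₀ (facClosure_of_addClosure (hT 0))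
  have a₀ : addClosure T Z₀ :=
    have := h₀.mono
    addClosure_of_mono i₀ f₀ (hT 0)
  have a₁ : addClosure T Z₁ :=
    have := h₁.mono
    addClosure_of_mono i₁ f₁ (hT 1)
  have := subsingleton_ext_add_fac a₁ f₀ 1 one_pos
  have := subsingleton_ext_add_fac a₀ f₁ 1 one_pos
  obtain ⟨r₀, s₀, g₀, g₀', -, k₀⟩ := h₀.exists_splitting
  obtain ⟨r₁, s₁, g₁, g₁', -, k₁⟩ := h₁.exists_splitting
  refine ⟨K.X 0, K.X 1, hT 0, hT 1, ⟨retractOfContraction (r₀ ≫ s₁) (r₁ ≫ s₀) ?_ ?_⟩⟩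
  · rw [e₀, e₁]
    simp only [Category.assoc, reassoc_of% g₁, reassoc_of% g₁']
    rw [add_comm, k₀]
  · rw [e₀, e₁]
    simp only [Category.assoc, reassoc_of% g₀, reassoc_of% g₀']
    rw [k₁]

end Split

end Acyclic

/-! ### Existence of resolutions -/

section Resolution

variable {A : Type u} [Category.{v} A] [Abelian A]

lemma IsSES.disk {X Y Z : A} {i : X ⟶ Y} {p : Y ⟶ Z} (h : IsSES i p) (j : ZMod 2) :
    IsSES ((disk A j).map i) ((disk A j).map p) :=
  ⟨by rw [← Functor.map_comp, h.zero, Functor.map_zero],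
    h.shortExact.map_of_exact (ModifiedHall.disk A j)⟩

lemma IsSES.complexesIn_right_of_retraction {P : ObjectProperty A}
    (hP : ∀ {X Y : A}, Retract X Y → P Y → P X) {K L M : Z2Complex A} {i : K ⟶ L} {p : L ⟶ M}
    (h : IsSES i p) (hL : complexesIn P L) (hr : ∀ n, ∃ r, i.f n ≫ r = 𝟙 (K.X n)) :
    complexesIn P M := by
  intro n
  obtain ⟨r, hr⟩ := hr n
  let σ := ShortComplex.Splitting.ofExactOfRetraction _ (h.eval n).shortExact.exact r hr
    (h.eval n).epi
  exact hP ⟨σ.s, p.f n, σ.s_g⟩ (hL n)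

variable [IsHereditary A] [IsFinitary A]

/-- Apply the disk functor to the universal extension of `M.X j` and push out along the counit. The
counit is the identity in degree `j`, so the middle term of the universal extension maps onto the
new component there. -/
lemma exists_isSES_disk (T : A) [IsTilting T] (j : ZMod 2) (M : Z2Complex A) :
    ∃ (X : Z2Complex A) (P : A) (w : M ⟶ X) (v : X ⟶ (disk A j).obj P), IsSES w v ∧
      addClosure T P ∧ facClosure T (X.X j) := by
  obtain ⟨Y, P, i, p, h, hY, hP⟩ := exists_isSES_facClosure T (M.X j)
  obtain ⟨X, g, w, v, sq, hgv, hwv⟩ := (h.disk j).exists_pushout ((diskCounit j).app M)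
  refine ⟨X, P, w, v, hwv, hP, ?_⟩
  let γ : Y ⟶ X.X j := g.f j
  have hγ₁ : i ≫ γ = w.f j := by
    have h₁ := congrArg (fun f ↦ f.f j) sq.w
    refine h₁.trans ?_
    have h₂ : diskCounitAux j M j ≫ w.f j = w.f j := by
      rw [diskCounitAux_self, Category.id_comp]
    exact h₂
  let ν : X.X j ⟶ P := v.f j
  have hγ₂ : γ ≫ ν = p := congrArg (fun f ↦ f.f j) hgv
  have hν : IsSES (w.f j) ν := hwv.eval j
  have : Epi γ := by
    refine Preadditive.epi_of_cancel_zero _ fun {Q} f hf ↦ ?_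
    obtain ⟨f', rfl⟩ := hν.desc f (by rw [← hγ₁, Category.assoc, hf, comp_zero])
    have := h.epi
    have h₀ : p ≫ f' = 0 := by rw [← hγ₂, Category.assoc, hf]
    rw [zero_of_epi_comp p h₀, comp_zero]
  exact facClosure_of_epi γ hY

/-- Degree 0 is corrected before degree 1. The second correction extends the component in degree 0
by an object of `add T`, which keeps it in `Fac T`. -/
lemma exists_isSES_complexesIn_facClosure (T : A) [IsTilting T] (M : Z2Complex A) :
    ∃ (X U : Z2Complex A) (w : M ⟶ X) (v : X ⟶ U), IsSES w v ∧
      complexesIn (facClosure T) X ∧ complexesIn (addClosure T) U ∧ U.Acyclic := by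
  obtain ⟨X₁, P, w₁, v₁, h₁, hP, hX₁⟩ := exists_isSES_disk T 0 M
  obtain ⟨X, Q, w₂, v₂, h₂, hQ, hX⟩ := exists_isSES_disk T 1 X₁
  obtain ⟨U, u, v, -⟩ := exists_compat_quot ⟨w₁, v₁, h₁⟩ ⟨w₂, v₂, h₂⟩
  refine ⟨X, U, v.i, v.p, v.isSES, ?_, complexesIn_of_isSES u.isSES (complexesIn_disk _ hP)
    (complexesIn_disk _ hQ), u.isSES.acyclic_mid (acyclic_disk _ _) (acyclic_disk _ _)⟩
  intro n
  obtain rfl | rfl := zmod_two_cases n 1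
  · exact hX
  · exact facClosure_of_isSES (h₂.eval _) hX₁ (facClosure_of_addClosure hQ)

/-- Every complex embeds into a sum of disks on its components, split in each degree. -/
noncomputable def toDisks (N : Z2Complex A) : N ⟶ disks (N.X 1) (N.X 0) :=
  biprod.lift ((diskUnit 0).app N : N ⟶ (disk A 0).obj (N.X 1))
    ((diskUnit 1).app N : N ⟶ (disk A 1).obj (N.X 0))

lemma toDisks_retraction (N : Z2Complex A) (n : ZMod 2) :
    ∃ r, (toDisks N).f n ≫ r = 𝟙 (N.X n) := by
  obtain rfl | rfl := zmod_two_cases n 0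
  · refine ⟨(biprod.snd : disks (N.X 1) (N.X 0) ⟶ (disk A 1).obj (N.X 0)).f 0, ?_⟩
    refine Eq.trans (b := (toDisks N ≫ biprod.snd).f 0) rfl ?_
    exact (congrArg (fun f : N ⟶ (disk A 1).obj (N.X 0) ↦ f.f 0) (biprod.lift_snd _ _)).trans
      (diskUnitAux_succ 1 N)
  · refine ⟨(biprod.fst : disks (N.X 1) (N.X 0) ⟶ (disk A 0).obj (N.X 1)).f 1, ?_⟩
    refine Eq.trans (b := (toDisks N ≫ biprod.fst).f 1) rfl ?_
    exact (congrArg (fun f : N ⟶ (disk A 0).obj (N.X 1) ↦ f.f 1) (biprod.lift_fst _ _)).trans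
      (diskUnitAux_succ 0 N)

instance (N : Z2Complex A) : Mono (toDisks N) := by
  refine HomologicalComplex.mono_of_mono_f _ fun n ↦ ?_
  obtain ⟨r, hr⟩ := toDisks_retraction N n
  exact mono_of_mono_fac hr

/-- The disks on `add T`-approximations of the two components map onto `X`. Since every map from `T`
to a component lifts, `addClosure_kernel` places the kernel over `add T`. -/
lemma exists_isSES_approximation {T : A} [IsTilting T] {X : Z2Complex A}
    (hX : complexesIn (facClosure T) X) : ∃ (N E : Z2Complex A) (i : N ⟶ E) (p : E ⟶ X),
      IsSES i p ∧ complexesIn (addClosure T) N ∧ complexesIn (addClosure T) E ∧ E.Acyclic := by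
  obtain ⟨P, p, hP, hp, hp'⟩ := exists_approximation (hX 0)
  obtain ⟨Q, q, hQ, hq, hq'⟩ := exists_approximation (hX 1)
  let a : (disk A 0).obj P ⟶ X := (disk A 0).map p ≫ (diskCounit 0).app X
  let b : (disk A 1).obj Q ⟶ X := (disk A 1).map q ≫ (diskCounit 1).app X
  have ha : a.f 0 = p := by
    have h : p ≫ diskCounitAux 0 X 0 = p := by rw [diskCounitAux_self, Category.comp_id]
    exact h
  have hb : b.f 1 = q := by
    have h : q ≫ diskCounitAux 1 X 1 = q := by rw [diskCounitAux_self, Category.comp_id]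
    exact h
  have ha' : (biprod.inl : _ ⟶ disks P Q).f 0 ≫ (biprod.desc a b).f 0 = p := by
    rw [← HomologicalComplex.comp_f, biprod.inl_desc, ha]
  have hb' : (biprod.inr : _ ⟶ disks P Q).f 1 ≫ (biprod.desc a b).f 1 = q := by
    rw [← HomologicalComplex.comp_f, biprod.inr_desc, hb]
  have : Epi (biprod.desc a b) := by
    refine HomologicalComplex.epi_of_epi_f _ fun n ↦ ?_
    obtain rfl | rfl := zmod_two_cases n 0
    · exact @epi_of_epi_fac _ _ _ _ _ _ _ _ hp ha'
    · exact @epi_of_epi_fac _ _ _ _ _ _ _ _ hq hb'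
  have hE : complexesIn (addClosure T) (disks P Q) :=
    complexesIn_biprod (complexesIn_disk _ hP) (complexesIn_disk _ hQ)
  refine ⟨_, disks P Q, kernel.ι _, biprod.desc a b, IsSES.of_epi _, fun n ↦ ?_, hE,
    acyclic_disks P Q⟩
  refine addClosure_kernel ((IsSES.of_epi (biprod.desc a b)).eval n) (hE n) fun g ↦ ?_
  obtain rfl | rfl := zmod_two_cases n 0
  · obtain ⟨f, rfl⟩ := hp' g
    exact ⟨f ≫ (biprod.inl : _ ⟶ disks P Q).f 0, (Category.assoc _ _ _).trans
      (congrArg (f ≫ ·) ha')⟩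
  · obtain ⟨f, rfl⟩ := hq' g
    exact ⟨f ≫ (biprod.inr : _ ⟶ disks P Q).f 1, (Category.assoc _ _ _).trans
      (congrArg (f ≫ ·) hb')⟩

/-- The kernel `N` of an approximation is over `add T` but need not be acyclic. Pushing out along
its degreewise split embedding into disks replaces it by an acyclic kernel. The new middle term is
an extension of the degreewise summand `disks / N` by `E`, so it stays over `add T`. -/
lemma exists_isSES_complexesIn_addClosure {T : A} [IsTilting T] {X : Z2Complex A}
    (hX : complexesIn (facClosure T) X) : ∃ (U V : Z2Complex A) (i : U ⟶ V) (p : V ⟶ X),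
      IsSES i p ∧ complexesIn (addClosure T) U ∧ U.Acyclic ∧ complexesIn (addClosure T) V := by
  obtain ⟨N, E, i, p, h, hN, hE, -⟩ := exists_isSES_approximation hX
  obtain ⟨V, g, j, q, sq, -, hq⟩ := h.exists_pushout (toDisks N)
  have hF : complexesIn (addClosure T) (disks (N.X 1) (N.X 0)) :=
    complexesIn_biprod (complexesIn_disk _ (hN 1)) (complexesIn_disk _ (hN 0))
  have hQ := (IsSES.of_mono (toDisks N)).complexesIn_right_of_retraction
    (P := addClosure T) addClosure_of_retract hF (toDisks_retraction N)
  obtain ⟨q', hq'⟩ := IsSES.exists_of_isPushout sq (IsSES.of_mono (toDisks N))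
  exact ⟨_, V, j, q, hq, hF, acyclic_disks _ _, complexesIn_of_isSES hq' hE hQ⟩

theorem nonempty_tResolution (T : A) [IsTilting T] (M : Z2Complex A) :
    Nonempty (TResolution T M) := by
  obtain ⟨X, U, w, v, h, hX, hU, hU'⟩ := exists_isSES_complexesIn_facClosure T M
  obtain ⟨V, W, i, p, h', hV, hV', hW⟩ := exists_isSES_complexesIn_addClosure hX
  exact ⟨⟨X, ⟨W, hW⟩, ⟨V, hV⟩, ⟨U, hU⟩, w, v, i, p, hX, h, h', h.quasiIso_left hU',
    h'.quasiIso_right hV'⟩⟩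

end Resolution

/-! ### Localization at normal elements -/

section OreLocalization

variable {R : Type u} [Ring R] [Algebra ℚ R] {S : Set R}

lemma toLocalized_apply (a : R) : toLocalized S a =
    RingQuot.mkAlgHom ℚ (InvRel S) (FreeAlgebra.ι ℚ (Sum.inl a)) := rfl

lemma Localized.mul_inv (s : S) : toLocalized S s.1 *
    RingQuot.mkAlgHom ℚ (InvRel S) (FreeAlgebra.ι ℚ (Sum.inr s)) = 1 := by
  rw [toLocalized_apply, ← map_mul, RingQuot.mkAlgHom_rel ℚ (InvRel.mul_inv s), map_one]

lemma Localized.inv_mul (s : S) : RingQuot.mkAlgHom ℚ (InvRel S) (FreeAlgebra.ι ℚ (Sum.inr s)) *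
    toLocalized S s.1 = 1 := by
  rw [toLocalized_apply, ← map_mul, RingQuot.mkAlgHom_rel ℚ (InvRel.inv_mul s), map_one]

lemma isUnit_toLocalized {s : R} (hs : s ∈ S) : IsUnit (toLocalized S s) :=
  ⟨⟨_, _, Localized.mul_inv ⟨s, hs⟩, Localized.inv_mul ⟨s, hs⟩⟩, rfl⟩

/-- The universal property of the localization. -/
lemma Localized.exists_lift {B : Type*} [Ring B] [Algebra ℚ B] (g : R →ₐ[ℚ] B)
    (hg : ∀ s ∈ S, IsUnit (g s)) :
    ∃ f : Localized S →ₐ[ℚ] B, ∀ a, f (toLocalized S a) = g a := by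
  let F : FreeAlgebra ℚ (R ⊕ S) →ₐ[ℚ] B :=
    FreeAlgebra.lift ℚ (Sum.elim g fun s ↦ Ring.inverse (g s.1))
  have hF : ∀ ⦃x y⦄, InvRel S x y → F x = F y := by
    rintro - - (⟨a, b⟩ | ⟨a, b⟩ | ⟨q⟩ | ⟨s⟩ | ⟨s⟩)
    · simp [F]
    · simp [F]
    · simp [F]
    · simp [F, Ring.mul_inverse_cancel _ (hg s.1 s.2)]
    · simp [F, Ring.inverse_mul_cancel _ (hg s.1 s.2)]
  refine ⟨RingQuot.liftAlgHom ℚ ⟨F, hF⟩, fun a ↦ ?_⟩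
  rw [toLocalized_apply, RingQuot.liftAlgHom_mkAlgHom_apply]
  simp [F]

/-- An induction principle: the localization is generated by the image of `R` and the inverses of
the elements of `S`. -/
lemma Localized.induction {p : Localized S → Prop} (x : Localized S)
    (toLocalized : ∀ a, p (toLocalized S a))
    (inv : ∀ s ∈ S, ∀ y, y * ModifiedHall.toLocalized S s = 1 → p y)
    (add : ∀ x y, p x → p y → p (x + y)) (mul : ∀ x y, p x → p y → p (x * y)) : p x := by
  obtain ⟨x, rfl⟩ := RingQuot.mkAlgHom_surjective ℚ (InvRel S) x
  induction x using FreeAlgebra.induction with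
  | grade0 q =>
    rw [AlgHom.commutes, ← AlgHom.commutes (ModifiedHall.toLocalized S)]
    exact toLocalized _
  | grade1 x =>
    obtain a | s := x
    · exact toLocalized a
    · exact inv s.1 s.2 _ (Localized.inv_mul s)
  | mul x y hx hy => rw [map_mul]; exact mul _ _ hx hy
  | add x y hx hy => rw [map_add]; exact add _ _ hx hy

lemma Localized.hom_ext {B : Type*} [Ring B] [Algebra ℚ B] {f g : Localized S →ₐ[ℚ] B}
    (h : ∀ a, f (toLocalized S a) = g (toLocalized S a)) : f = g := by
  refine AlgHom.ext fun x ↦ ?_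
  induction x using Localized.induction with
  | toLocalized a => exact h a
  | inv s hs y hy =>
    have h₁ := (isUnit_toLocalized hs).map f
    rw [← h₁.mul_left_inj, ← map_mul, hy, h, ← map_mul, hy, map_one, map_one]
  | add x y hx hy => rw [map_add, map_add, hx, hy]
  | mul x y hx hy => rw [map_mul, map_mul, hx, hy]

/-- If every `s ∈ S` is normal, with `s a = σ_s(a) s` for an automorphism `σ_s` fixing `s`, then
`S` is a denominator set. -/
lemma isRightLocalization_of_normal (h₁ : 1 ∈ S) (hm : ∀ s ∈ S, ∀ t ∈ S, s * t ∈ S)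
    (hσ : ∀ s ∈ S, ∃ σ : R ≃ₐ[ℚ] R, (∀ a, s * a = σ a * s) ∧ σ s = s) :
    IsRightLocalization S (toLocalized S) := by
  have hσ' : ∀ s ∈ S, ∀ a, ∃ b, a * s = s * b := fun s hs a ↦ by
    obtain ⟨σ, h, -⟩ := hσ s hs
    exact ⟨σ.symm a, by rw [h, AlgEquiv.apply_symm_apply]⟩
  -- Normality together with `σ s = s` makes left and right annihilation by `s` equivalent. This
  -- turns left cancellation conditions into right ones.
  have hc₁ : ∀ s ∈ S, ∀ a, a * s = 0 → s * a = 0 := fun s hs a ha ↦ by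
    obtain ⟨σ, h, h'⟩ := hσ s hs
    have := congrArg σ ha
    rwa [map_mul, h', map_zero, ← h] at this
  have hc₂ : ∀ s ∈ S, ∀ a, s * a = 0 → a * s = 0 := fun s hs a ha ↦ by
    obtain ⟨σ, h, h'⟩ := hσ s hs
    apply σ.injective
    rw [map_mul, h', map_zero, ← h, ha]
  let M : Submonoid R := ⟨⟨S, fun hs ht ↦ hm _ hs _ ht⟩, h₁⟩
  have hn : Nonempty (OreLocalization.OreSet M) := by
    choose σ h h' using hσ
    -- The identity `s r = σ_s(r) s` is the Ore condition with the denominator left unchanged.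
    refine ⟨⟨fun r₁ r₂ s hs ↦ ⟨s, ?_⟩, fun r s ↦ σ s.1 s.2 r, fun r s ↦ s, fun r s ↦ h _ s.2 _⟩⟩
    rw [← sub_eq_zero, ← mul_sub]
    refine hc₁ _ s.2 _ ?_
    rw [sub_mul, hs, sub_self]
  obtain ⟨hO⟩ := hn
  -- `OreLocalization` consists of left fractions. It serves only to determine the kernel of
  -- `toLocalized S`: the universal localization maps to it, so an element dying in the former dies
  -- in the latter.
  let g : R →ₐ[ℚ] OreLocalization M R :=
    { OreLocalization.numeratorRingHom with
      commutes' := fun q ↦ rfl }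
  have hg : ∀ s ∈ S, IsUnit (g s) := fun s hs ↦ OreLocalization.numerator_isUnit (S := M) ⟨s, hs⟩
  obtain ⟨f, hf⟩ := Localized.exists_lift g hg
  refine ⟨h₁, fun hs ht ↦ hm _ hs _ ht, isUnit_toLocalized, fun x ↦ ?_, fun a b ↦ ⟨fun h ↦ ?_, ?_⟩⟩
  · induction x using Localized.induction with
    | toLocalized a => exact ⟨a, 1, h₁, by simp⟩
    | inv s hs y hy => exact ⟨1, s, hs, by simp [hy]⟩
    | add x y hx hy =>
      obtain ⟨a, s, hs, ha⟩ := hx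
      obtain ⟨b, t, ht, hb⟩ := hy
      obtain ⟨s', hs'⟩ := hσ' t ht s
      refine ⟨a * t + b * s', s * t, hm _ hs _ ht, ?_⟩
      rw [add_mul, map_add]
      congr 1
      · rw [map_mul, ← mul_assoc, ha, map_mul]
      · rw [hs', map_mul, ← mul_assoc, hb, map_mul]
    | mul x y hx hy =>
      obtain ⟨a, s, hs, ha⟩ := hx
      obtain ⟨b, t, ht, hb⟩ := hy
      obtain ⟨b', hb'⟩ := hσ' s hs b
      refine ⟨a * b', t * s, hm _ ht _ hs, ?_⟩
      rw [map_mul, mul_assoc, ← mul_assoc y, hb, ← map_mul, hb', map_mul, ← mul_assoc, ha, map_mul]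
  · have h₂ : g (a - b) = 0 := by rw [← hf, map_sub, h, sub_self, map_zero]
    have h₃ : OreLocalization.oreDiv (a - b) (1 : M) = OreLocalization.oreDiv 0 1 :=
      Eq.trans h₂ (OreLocalization.zero_oreDiv' 1).symm
    rw [OreLocalization.oreDiv_eq_iff] at h₃
    obtain ⟨u, v, h₄, h₅⟩ := h₃
    refine ⟨v, ?_, ?_⟩
    · have : u.1 = v := by simpa using h₅
      rw [← this]
      exact u.2
    · have hv : u.1 = v := by simpa using h₅
      have hvS : v ∈ S := hv ▸ u.2
      rw [← sub_eq_zero, ← sub_mul]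
      refine hc₂ v hvS _ ?_
      simpa using h₄.symm
  · rintro ⟨t, ht, h⟩
    have := congrArg (toLocalized S) h
    rwa [map_mul, map_mul, (isUnit_toLocalized ht).mul_left_inj] at this

end OreLocalization

/-! ### Homomorphisms out of a Hall algebra -/

section HallHom

variable {C : Type u} [Category.{v} C] [Abelian C] {P : ObjectProperty C}

@[elab_as_elim]
lemma HallAlg.cls_induction {p : HallAlg P → Prop} (x : HallAlg P) (zero : p 0)
    (add : ∀ x y, p x → p y → p (x + y)) (smul : ∀ (q : ℚ) x, p x → p (q • x))
    (cls : ∀ X, p (HallAlg.cls X)) : p x := by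
  refine Finsupp.induction_linear (motive := p) x zero add fun a q ↦ ?_
  have h : (Finsupp.single a q : IsoClass P →₀ ℚ) = q • Finsupp.single a (1 : ℚ) := by simp
  obtain ⟨X, rfl⟩ := Quotient.exists_rep a
  rw [h]
  exact smul q _ (cls X)

lemma HallAlg.exists_linearMap {V : Type*} [AddCommGroup V] [Module ℚ V]
    (f : P.FullSubcategory → V) (hf : ∀ X Y, Nonempty (X.obj ≅ Y.obj) → f X = f Y) :
    ∃ F : HallAlg P →ₗ[ℚ] V, ∀ X, F (HallAlg.cls X) = f X := by
  let g : IsoClass P → V := Quotient.lift f fun X Y ⟨e⟩ ↦ hf X Y ⟨P.ι.mapIso e⟩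
  refine ⟨(Finsupp.linearCombination ℚ g : (IsoClass P →₀ ℚ) →ₗ[ℚ] V), fun X ↦ ?_⟩
  refine (Finsupp.linearCombination_single ℚ (1 : ℚ) (IsoClass.mk X)).trans ?_
  rw [one_smul]
  rfl

variable [HallFinite C] [P.IsClosedUnderExtensions] [P.ContainsZero] [P.IsClosedUnderIsomorphisms]

/-- Algebra homomorphisms from the Hall algebra. -/
lemma HallAlg.exists_algHom {B : Type*} [Ring B] [Algebra ℚ B]
    (f : P.FullSubcategory → B) (hf : ∀ X Y, Nonempty (X.obj ≅ Y.obj) → f X = f Y)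
    (h₁ : f (zeroObj P) = 1)
    (hm : ∀ L N, f L * f N = (Nat.card (L.obj ⟶ N.obj) : ℚ)⁻¹ •
      ∑ e : Ext.{max u v} L.obj N.obj 1, f ⟨mid e, prop_mid L N e⟩) :
    ∃ F : HallAlg P →ₐ[ℚ] B, ∀ X, F (HallAlg.cls X) = f X := by
  obtain ⟨F, hF⟩ := HallAlg.exists_linearMap f hf
  refine ⟨AlgHom.ofLinearMap F ((hF _).trans h₁) fun x y ↦ ?_, hF⟩
  refine HallAlg.cls_induction x (by simp) (fun x x' h h' ↦ by simp [add_mul, h, h'])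
    (fun q x h ↦ by simp [h]) fun L ↦ ?_
  refine HallAlg.cls_induction y (by simp) (fun x x' h h' ↦ by simp [mul_add, h, h'])
    (fun q x h ↦ by simp [h]) fun N ↦ ?_
  rw [HallAlg.cls_mul_cls, map_smul, map_sum, hF, hF, hm]
  simp only [hF]

lemma HallAlg.hom_ext {B : Type*} [Ring B] [Algebra ℚ B] {f g : HallAlg P →ₐ[ℚ] B}
    (h : ∀ X, f (HallAlg.cls X) = g (HallAlg.cls X)) : f = g := by
  refine AlgHom.ext fun x ↦ ?_
  exact HallAlg.cls_induction x (by simp) (fun x x' h h' ↦ by simp [h, h'])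
    (fun q x h ↦ by simp [h]) h

end HallHom

/-! ### Acyclic complexes over `add T` -/

section AddAcyclic

variable {A : Type u} [Category.{v} A] [Abelian A]

/-- The acyclic complexes over `add T`. -/
structure IsAddAcyclic (T : A) (K : Z2Complex A) : Prop where
  mem : complexesIn (addClosure T) K
  acyclic : K.Acyclic

lemma IsAddAcyclic.of_isSES {T : A} [IsTilting T] {K L M : Z2Complex A} {i : K ⟶ L} {p : L ⟶ M}
    (h : IsSES i p) (hK : IsAddAcyclic T K) (hM : IsAddAcyclic T M) : IsAddAcyclic T L :=
  ⟨complexesIn_of_isSES h hK.mem hM.mem, h.acyclic_mid hK.acyclic hM.acyclic⟩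

lemma IsAddAcyclic.biprod {T : A} [IsTilting T] {K L : Z2Complex A}
    (hK : IsAddAcyclic T K) (hL : IsAddAcyclic T L) : IsAddAcyclic T (K ⊞ L) :=
  .of_isSES (.biprod K L) hK hL

lemma isAddAcyclic_zero (T : A) : IsAddAcyclic T (0 : Z2Complex A) :=
  ⟨(complexesIn (addClosure T)).prop_zero,
    HomologicalComplex.acyclic_of_isZero _ (isZero_zero _)⟩

lemma complexesIn_fac_of_isSES {T : A} {K L M : Z2Complex A} {i : K ⟶ L} {p : L ⟶ M}
    (h : IsSES i p) (hL : complexesIn (facClosure T) L) : complexesIn (facClosure T) M := fun n ↦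
  have := (h.eval n).epi
  facClosure_of_epi (p.f n) (hL n)

lemma complexesIn_fac_of_add {T : A} {M : Z2Complex A} (h : complexesIn (addClosure T) M) :
    complexesIn (facClosure T) M := fun n ↦ facClosure_of_addClosure (h n)

variable [IsFinitary A] [IsHereditary A] {T : A} [IsTilting T]

namespace IsAddAcyclic

variable {K : Z2Complex A} (hK : IsAddAcyclic T K)
include hK

/-- Contractibility reduces this to `A`, where heredity applies. For an arbitrary pair of complexes
`Ext²` may be nonzero. -/
lemma subsingleton_ext_left (M : Z2Complex A) (n : ℕ) (hn : 2 ≤ n) :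
    Subsingleton (Ext.{max u v} K M n) :=
  subsingleton_ext_contractible_left (contractiblesIn_of_acyclic hK.mem hK.acyclic) M n
    fun _ _ _ ↦ subsingleton_ext_of_two_le _ _ n hn

lemma subsingleton_ext_right (M : Z2Complex A) (n : ℕ) (hn : 2 ≤ n) :
    Subsingleton (Ext.{max u v} M K n) :=
  subsingleton_ext_contractible_right (contractiblesIn_of_acyclic hK.mem hK.acyclic) M n
    fun _ _ _ ↦ subsingleton_ext_of_two_le _ _ n hn

/-- Against `Fac T` the vanishing holds only for extensions of `K` by `M`; in the other direction
`subsingleton_ext_add` needs `M` over `add T`. This asymmetry is why a complex is resolved in two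
stages. -/
lemma subsingleton_ext_fac {M : Z2Complex A} (hM : complexesIn (facClosure T) M) :
    Subsingleton (Ext.{max u v} K M 1) :=
  subsingleton_ext_contractible_left (contractiblesIn_of_acyclic hK.mem hK.acyclic) M 1
    fun _ hX n ↦ subsingleton_ext_add_fac hX (hM n) 1 one_pos

lemma subsingleton_ext_add {M : Z2Complex A} (hM : complexesIn (addClosure T) M) :
    Subsingleton (Ext.{max u v} M K 1) :=
  subsingleton_ext_contractible_right (contractiblesIn_of_acyclic hK.mem hK.acyclic) M 1
    fun _ hX n ↦ subsingleton_ext_add_fac (hM n) (facClosure_of_addClosure hX) 1 one_pos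

lemma chi_left {M E M' : Z2Complex A} (h : IsExtension M E M') :
    chi E K = chi M K * chi M' K :=
  have := hK.subsingleton_ext_right M' 2 le_rfl
  chi_mul_left h K

lemma chi_right {N E N' : Z2Complex A} (h : IsExtension N E N') :
    chi K E = chi K N * chi K N' :=
  have := hK.subsingleton_ext_left N 2 le_rfl
  chi_mul_right h K

/-- Extensions of an acyclic complex over `add T` are, up to isomorphism, determined by their
pushforwards. -/
lemma surjective_postcomp {N N' : Z2Complex A} {i : N ⟶ N'} {p : N' ⟶ K} (h : IsSES i p)
    (M : Z2Complex A) (x : Ext.{max u v} M K 1) :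
    ∃ y : Ext.{max u v} (disks (M.X 1) (M.X 0)) N' 1,
      ((Ext.mk₀ (toDisks M)).comp y (zero_add 1)).comp (Ext.mk₀ p) (add_zero 1) = x := by
  -- Since `Ext²(M, N)` may be nonzero, `x` is not lifted directly. It is first extended to the disk
  -- complex containing `M`, the obstruction being in `Ext²(-, K) = 0`, and lifted there, the
  -- obstruction being in `Ext²` from disks.
  have h₁ : Subsingleton (Ext.{max u v} (disks (M.X 1) (M.X 0)) N 2) :=
    subsingleton_ext_biprod_left _ _ _ _
      (subsingleton_ext_disk_left _ _ _ _ (subsingleton_ext_of_two_le _ _ 2 le_rfl))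
      (subsingleton_ext_disk_left _ _ _ _ (subsingleton_ext_of_two_le _ _ 2 le_rfl))
  have h₂ : Subsingleton (Ext.{max u v} (cokernel (toDisks M)) K 2) :=
    hK.subsingleton_ext_right _ 2 le_rfl
  obtain ⟨z, rfl⟩ := surjective_precomp (IsSES.of_mono (toDisks M)) K 1 x
  obtain ⟨y, rfl⟩ := ModifiedHall.surjective_postcomp h _ 1 z
  exact ⟨y, by rw [Ext.comp_assoc_of_third_deg_zero]⟩

lemma chi_left' {N N' : Z2Complex A} (h : IsExtension N N' K) (M : Z2Complex A) :
    chi M N' = chi M N * chi M K := by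
  obtain ⟨⟨i, p, h⟩⟩ := h
  refine chi_mul_right_of_surjective h M fun x ↦ ?_
  obtain ⟨y, hy⟩ := hK.surjective_postcomp h M x
  exact ⟨_, hy⟩

lemma chi_right' {N N' : Z2Complex A} (h : IsExtension K N' N) (M : Z2Complex A) :
    chi M N' = chi M K * chi M N :=
  have := hK.subsingleton_ext_right M 2 le_rfl
  chi_mul_right h M

lemma chi_sub {N N' : Z2Complex A} (h : IsExtension N N' K) (M : Z2Complex A) :
    chi N' M = chi N M * chi K M :=
  have := hK.subsingleton_ext_left M 2 le_rfl
  chi_mul_left h M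

end IsAddAcyclic

/-! ### Classes in the localized Hall algebra of `add T` -/

section LocCls

variable (T)

open Classical in
/-- The class of a complex over `add T` in the localized Hall algebra, and zero for the other
complexes. -/
noncomputable def locCls (M : Z2Complex A) : LocalizedAddHallAlg T :=
  if h : complexesIn (addClosure T) M then toLocalized (addAcyclicSet T) (HallAlg.cls ⟨M, h⟩) else 0

variable {T}

lemma locCls_of_mem {M : Z2Complex A} (h : complexesIn (addClosure T) M) :
    locCls T M = toLocalized (addAcyclicSet T) (HallAlg.cls ⟨M, h⟩) := dif_pos h

lemma IsAddAcyclic.cls_mem {K : Z2Complex A} (hK : IsAddAcyclic T K) :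
    HallAlg.cls ⟨K, hK.mem⟩ ∈ addAcyclicSet T :=
  ⟨1, ⟨K, hK.mem⟩, one_ne_zero, hK.acyclic, (one_smul _ _).symm⟩

lemma IsAddAcyclic.isUnit_locCls {K : Z2Complex A} (hK : IsAddAcyclic T K) :
    IsUnit (locCls T K) := by
  rw [locCls_of_mem hK.mem]
  exact isUnit_toLocalized hK.cls_mem

/-- Over `add T`, `Ext¹` vanishes in both directions between `K` and `M`. So `E` is their direct
sum, and either product consists of this single term. In particular `[K]` is normal. -/
lemma HallAlg.cls_extension {M K E : (complexesIn (addClosure T)).FullSubcategory}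
    (hK : K.obj.Acyclic) (h : IsExtension K.obj E.obj M.obj ∨ IsExtension M.obj E.obj K.obj) :
    HallAlg.cls E = chi M.obj K.obj • (HallAlg.cls M * HallAlg.cls K) ∧
    HallAlg.cls E = chi K.obj M.obj • (HallAlg.cls K * HallAlg.cls M) := by
  have hK' : IsAddAcyclic T K.obj := ⟨K.property, hK⟩
  have h₁ : Subsingleton (Ext.{max u v} M.obj K.obj 1) := hK'.subsingleton_ext_add M.property
  have h₂ : Subsingleton (Ext.{max u v} K.obj M.obj 1) :=
    hK'.subsingleton_ext_fac (complexesIn_fac_of_add M.property)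
  have h₃ : Nonempty (E.obj ≅ K.obj ⊞ M.obj) := by
    obtain ⟨⟨i, p, h⟩⟩ | ⟨⟨i, p, h⟩⟩ := h
    · exact h.nonempty_iso_biprod_of_subsingleton
    · obtain ⟨e⟩ := h.nonempty_iso_biprod_of_subsingleton
      exact ⟨e ≪≫ biprod.braiding _ _⟩
  refine ⟨HallAlg.cls_mul_cls_of_subsingleton _ _ _ h₃,
    HallAlg.cls_mul_cls_of_subsingleton _ _ _ ?_⟩
  obtain ⟨e⟩ := h₃
  exact ⟨e ≪≫ biprod.braiding _ _⟩

lemma locCls_extension {M K E : Z2Complex A} (hM : complexesIn (addClosure T) M)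
    (hK : IsAddAcyclic T K) (h : IsExtension K E M ∨ IsExtension M E K) :
    locCls T E = chi M K • (locCls T M * locCls T K) := by
  have hE : complexesIn (addClosure T) E := by
    obtain ⟨⟨i, p, h⟩⟩ | ⟨⟨i, p, h⟩⟩ := h
    · exact complexesIn_of_isSES h hK.mem hM
    · exact complexesIn_of_isSES h hM hK.mem
  rw [locCls_of_mem hM, locCls_of_mem hK.mem, locCls_of_mem hE,
    (HallAlg.cls_extension (M := ⟨M, hM⟩) (K := ⟨K, hK.mem⟩) (E := ⟨E, hE⟩) hK.acyclic h).1,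
    map_smul, map_mul]

lemma locCls_comm {M K : Z2Complex A} (hM : complexesIn (addClosure T) M)
    (hK : IsAddAcyclic T K) : chi M K • (locCls T M * locCls T K) =
      chi K M • (locCls T K * locCls T M) := by
  have h := HallAlg.cls_extension (M := ⟨M, hM⟩) (K := ⟨K, hK.mem⟩)
    (E := ⟨K ⊞ M, complexesIn_biprod hK.mem hM⟩) hK.acyclic
    (Or.inl (IsSES.biprod K M).isExtension)
  have := congrArg (toLocalized (addAcyclicSet T)) (h.1.symm.trans h.2)
  rwa [map_smul, map_mul, map_smul, map_mul, ← locCls_of_mem hM, ← locCls_of_mem hK.mem] at this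

lemma chi_of_isZero {C : Type u} [Category.{v} C] [Abelian C] [HallFinite C] (M Z : C)
    (hZ : IsZero Z) : chi M Z = 1 := by
  have h₁ : Subsingleton (Ext.{max u v} M Z 1) := by
    refine subsingleton_of_forall_eq 0 fun e ↦ ?_
    rw [← Ext.comp_mk₀_id e, hZ.eq_of_src (𝟙 Z) 0, Ext.mk₀_zero, Ext.comp_zero]
  have h₂ : Subsingleton (M ⟶ Z) := ⟨fun _ _ ↦ hZ.eq_of_tgt _ _⟩
  have : Nonempty (M ⟶ Z) := ⟨0⟩
  rw [chi, Nat.card_unique, Nat.card_unique, Nat.cast_one, div_one]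

lemma locCls_zero : locCls T 0 = 1 := by
  rw [locCls_of_mem (isAddAcyclic_zero T).mem]
  exact map_one _

end LocCls

/-! ### The Ore condition over `add T` -/

section Denominators

/-- The automorphism of the Hall algebra of complexes over `add T` rescaling `[M]` by
`χ(M, K) / χ(K, M)`. -/
lemma exists_rescaling {K : Z2Complex A} (hK : IsAddAcyclic T K) :
    ∃ σ : AddHallAlg T ≃ₐ[ℚ] AddHallAlg T, ∀ M, σ (HallAlg.cls M) =
      (chi M.obj K / chi K M.obj) • HallAlg.cls M := by
  -- A function multiplicative on extensions takes the same value `r L * r N` on every middle term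
  -- of `[L][N]`, so rescaling the basis by it is an algebra endomorphism. The ratio and its inverse
  -- give mutually inverse ones.
  have key : ∀ r : Z2Complex A → ℚ, (∀ M N, Nonempty (M ≅ N) → r M = r N) → r 0 = 1 →
      (∀ M E N, IsExtension M E N → r E = r M * r N) →
      ∃ F : AddHallAlg T →ₐ[ℚ] AddHallAlg T, ∀ M, F (HallAlg.cls M) = r M.obj • HallAlg.cls M := by
    intro r h₁ h₂ h₃
    refine HallAlg.exists_algHom (fun M ↦ r M.obj • HallAlg.cls M) ?_ ?_ ?_
    · rintro X Y ⟨e⟩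
      rw [h₁ _ _ ⟨e⟩, HallAlg.cls_eq_of_iso e]
    · rw [show (zeroObj (complexesIn (addClosure T))).obj = 0 from rfl, h₂, one_smul]
      rfl
    · intro L N
      simp only [h₃ _ _ _ (isExtension_mid _)]
      rw [← Finset.smul_sum, smul_comm, ← HallAlg.cls_mul_cls, smul_mul_smul_comm, mul_comm]
  obtain ⟨F, hF⟩ := key (fun M ↦ chi M K / chi K M)
    (fun M N ⟨e⟩ ↦ by simp only [chi_congr e (Iso.refl K), chi_congr (Iso.refl K) e])
    (by
      -- Since `0 ⊞ 0` is zero, the nonzero number χ(0, K) is idempotent, hence equal to 1.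
      have h₁ : chi (0 : Z2Complex A) K * chi (0 : Z2Complex A) K = chi (0 : Z2Complex A) K * 1 := by
        rw [← hK.chi_left (IsSES.biprod 0 0).isExtension, mul_one]
        exact chi_congr (IsZero.iso ((biprod_isZero_iff _ _).2 ⟨isZero_zero _, isZero_zero _⟩)
          (isZero_zero _)) (Iso.refl K)
      simp only [mul_left_cancel₀ (chi_ne_zero _ _) h₁, chi_of_isZero _ _ (isZero_zero _), div_one])
    (fun M E N h ↦ by simp only [hK.chi_left h, hK.chi_right h, mul_div_mul_comm])
  obtain ⟨G, hG⟩ := key (fun M ↦ chi K M / chi M K)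
    (fun M N ⟨e⟩ ↦ by simp only [chi_congr e (Iso.refl K), chi_congr (Iso.refl K) e])
    (by
      have h₁ : chi (0 : Z2Complex A) K * chi (0 : Z2Complex A) K = chi (0 : Z2Complex A) K * 1 := by
        rw [← hK.chi_left (IsSES.biprod 0 0).isExtension, mul_one]
        exact chi_congr (IsZero.iso ((biprod_isZero_iff _ _).2 ⟨isZero_zero _, isZero_zero _⟩)
          (isZero_zero _)) (Iso.refl K)
      simp only [mul_left_cancel₀ (chi_ne_zero _ _) h₁, chi_of_isZero _ _ (isZero_zero _), div_one])
    (fun M E N h ↦ by simp only [hK.chi_left h, hK.chi_right h, mul_div_mul_comm])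
  have h (M : Z2Complex A) : (chi M K / chi K M) * (chi K M / chi M K) = 1 := by
    have := chi_ne_zero M K
    have := chi_ne_zero K M
    field_simp
  refine ⟨AlgEquiv.ofAlgHom F G (HallAlg.hom_ext fun M ↦ ?_) (HallAlg.hom_ext fun M ↦ ?_), hF⟩
  · simp [hF, hG, smul_smul, h, mul_comm (chi K M.obj / chi M.obj K)]
  · simp [hF, hG, smul_smul, h]

variable (T) in
theorem isRightLocalization_addAcyclicSet :
    IsRightLocalization (addAcyclicSet T) (toLocalized (addAcyclicSet T)) := by
  refine isRightLocalization_of_normal ?_ ?_ ?_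
  · exact ⟨1, zeroObj _, one_ne_zero, (isAddAcyclic_zero T).acyclic, (one_smul _ _).symm⟩
  · rintro - ⟨q, K, hq, hK, rfl⟩ - ⟨r, L, hr, hL, rfl⟩
    refine ⟨q * r * (chi K.obj L.obj)⁻¹, ⟨K.obj ⊞ L.obj, complexesIn_biprod K.property L.property⟩,
      mul_ne_zero (mul_ne_zero hq hr) (inv_ne_zero (chi_ne_zero _ _)), acyclic_biprod hK hL, ?_⟩
    rw [(HallAlg.cls_extension (M := K) (K := L)
      (E := ⟨K.obj ⊞ L.obj, complexesIn_biprod K.property L.property⟩) hL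
      (Or.inr (IsSES.biprod K.obj L.obj).isExtension)).1, smul_mul_smul_comm, smul_smul, mul_assoc,
      inv_mul_cancel₀ (chi_ne_zero _ _), mul_one]
  · rintro - ⟨q, K, hq, hK, rfl⟩
    obtain ⟨σ, hσ⟩ := exists_rescaling (T := T) ⟨K.property, hK⟩
    refine ⟨σ, fun a ↦ ?_, ?_⟩
    · refine HallAlg.cls_induction a (by simp) (fun x y hx hy ↦ ?_) (fun r x hx ↦ ?_) fun M ↦ ?_
      · rw [mul_add, map_add, add_mul, hx, hy]
      · rw [mul_smul_comm, hx, map_smul, smul_mul_assoc]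
      · have h := HallAlg.cls_extension (M := M) (K := K)
          (E := ⟨K.obj ⊞ M.obj, complexesIn_biprod K.property M.property⟩) hK
          (Or.inl (IsSES.biprod K.obj M.obj).isExtension)
        have h' := h.2.symm.trans h.1
        rw [hσ, smul_mul_assoc, smul_mul_assoc, mul_smul_comm, smul_comm _ q, div_eq_inv_mul,
          mul_smul, ← h', smul_smul _ (chi K.obj M.obj), inv_mul_cancel₀ (chi_ne_zero _ _), one_smul]
    · rw [map_smul, hσ, div_self (chi_ne_zero _ _), one_smul]

end Denominators

end AddAcyclic

/-! ### The class of an arbitrary complex -/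

section Psi

lemma eq_of_smul_mul_eq {B : Type*} [Ring B] [Algebra ℚ B] {q : ℚ} (hq : q ≠ 0) {x y u : B}
    (hu : IsUnit u) (h : q • (x * u) = q • (y * u)) : x = y :=
  hu.mul_left_injective (smul_right_injective B hq h)

variable {A : Type u} [Category.{v} A] [Abelian A] [IsFinitary A] [IsHereditary A] {T : A}
  [IsTilting T]

/-- `x` is the class of the complex `X` computed from a resolution by complexes over `add T`. -/
def IsFacCls (X : Z2Complex A) (x : LocalizedAddHallAlg T) : Prop :=
  ∃ U V : Z2Complex A, IsExtension U V X ∧ IsAddAcyclic T U ∧ complexesIn (addClosure T) V ∧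
    locCls T V = chi X U • (x * locCls T U)

/-- The fibre product of two resolutions over `X` extends each of them by the acyclic kernel of the
other. Computing its class in both ways gives the equality, once invertible classes and scalars are
cancelled. -/
lemma IsFacCls.unique {X : Z2Complex A} {x x' : LocalizedAddHallAlg T} (h : IsFacCls X x)
    (h' : IsFacCls X x') : x = x' := by
  obtain ⟨U, V, ⟨⟨i, p, h⟩⟩, hU, hV, hx⟩ := h
  obtain ⟨U', V', ⟨⟨i', p', h'⟩⟩, hU', hV', hx'⟩ := h'
  obtain ⟨W, g, j, q, sq, -, hW⟩ := h.exists_pullback p'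
  obtain ⟨k, hk⟩ := IsSES.exists_of_isPullback sq h'
  have e := (locCls_extension hV hU' (.inl hk.isExtension)).symm.trans
    (locCls_extension hV' hU (.inl hW.isExtension))
  rw [hU'.chi_left h.isExtension, hU.chi_left h'.isExtension, hx, hx'] at e
  have e₁ := locCls_comm hU.mem hU'
  refine eq_of_smul_mul_eq (q := chi X U' * chi X U * chi U U') ?_
    (hU.isUnit_locCls.mul hU'.isUnit_locCls) ?_
  · exact mul_ne_zero (mul_ne_zero (chi_ne_zero _ _) (chi_ne_zero _ _)) (chi_ne_zero _ _)
  · calc _ = (chi U U' * chi X U') • (chi X U • (x * locCls T U) * locCls T U') := by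
          simp only [smul_mul_assoc, smul_smul, mul_assoc]
          congr 1
          ring
      _ = _ := e
      _ = (chi X U' * chi X U) • (x' * (chi U' U • (locCls T U' * locCls T U))) := by
          simp only [smul_mul_assoc, mul_smul_comm, smul_smul, mul_assoc]
          congr 1
          ring
      _ = _ := by rw [← e₁, mul_smul_comm, smul_smul]

lemma IsFacCls.of_mem {X : Z2Complex A} (h : complexesIn (addClosure T) X) :
    IsFacCls X (locCls T X) := by
  refine ⟨0, X, ⟨⟨0, 𝟙 X, ?_⟩⟩, isAddAcyclic_zero T, h, ?_⟩
  · have : Mono (0 : (0 : Z2Complex A) ⟶ X) := (isZero_zero _).mono _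
    exact IsSES.mk' zero_comp fun {S} f hf ↦ ⟨S, 𝟙 S, inferInstance, 0, by simpa using hf⟩
  · rw [chi_of_isZero _ _ (isZero_zero _), locCls_zero, one_smul, mul_one]

lemma exists_mul_eq {B : Type*} [Ring B] [Algebra ℚ B] {q : ℚ} (hq : q ≠ 0) {u : B}
    (hu : IsUnit u) (y : B) : ∃ x, y = q • (x * u) := by
  obtain ⟨u, rfl⟩ := hu
  exact ⟨q⁻¹ • (y * ↑u⁻¹), by simp [smul_smul, hq]⟩

lemma exists_isFacCls {X : Z2Complex A} (hX : complexesIn (facClosure T) X) :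
    ∃ x : LocalizedAddHallAlg T, IsFacCls X x := by
  obtain ⟨U, V, i, p, h, hU, hU', hV⟩ := exists_isSES_complexesIn_addClosure hX
  have hU : IsAddAcyclic T U := ⟨hU, hU'⟩
  obtain ⟨x, hx⟩ := exists_mul_eq (chi_ne_zero X U) hU.isUnit_locCls (locCls T V)
  exact ⟨x, U, V, h.isExtension, hU, hV, hx⟩

lemma IsFacCls.congr {X Y : Z2Complex A} (e : X ≅ Y) {x : LocalizedAddHallAlg T}
    (h : IsFacCls X x) : IsFacCls Y x := by
  obtain ⟨U, V, h, hU, hV, hx⟩ := h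
  exact ⟨U, V, h.congr (Iso.refl _) (Iso.refl _) e, hU, hV, by
    rwa [← chi_congr e (Iso.refl U)]⟩

/-- `Ext¹(K, X) = 0` since `X` is over `Fac T`, so `Y` splits as `K ⊞ X`. Adding `K` to the cover of
`X` then resolves `Y` with the same kernel. -/
lemma IsFacCls.extension {X Y K : Z2Complex A} {x : LocalizedAddHallAlg T} (h : IsFacCls X x)
    (hX : complexesIn (facClosure T) X) (hK : IsAddAcyclic T K) (hY : IsExtension X Y K) :
    IsFacCls Y (chi X K • (x * locCls T K)) := by
  obtain ⟨⟨i, p, hY⟩⟩ := hY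
  have := hK.subsingleton_ext_fac hX
  obtain ⟨e⟩ := hY.nonempty_iso_biprod_of_subsingleton
  refine IsFacCls.congr (e ≪≫ biprod.braiding _ _).symm ?_
  obtain ⟨U, V, ⟨⟨j, q, h⟩⟩, hU, hV, hx⟩ := h
  refine ⟨U, K ⊞ V, (h.biprodMap' K).isExtension, hU, complexesIn_biprod hK.mem hV, ?_⟩
  rw [locCls_extension hV hK (.inl (IsSES.biprod K V).isExtension), hx, hK.chi_left h.isExtension,
    hU.chi_left (IsSES.biprod K X).isExtension]
  have e₁ := locCls_comm hU.mem hK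
  calc _ = (chi X K * chi X U) • (x * (chi U K • (locCls T U * locCls T K))) := by
        simp only [smul_mul_assoc, mul_smul_comm, smul_smul, mul_assoc]
        congr 1
        ring
    _ = _ := by
        rw [e₁]
        simp only [smul_mul_assoc, mul_smul_comm, smul_smul, mul_assoc]
        congr 1
        ring

/-- `x` is the class of the complex `M` computed from a `T`-resolution. -/
def IsCls (M : Z2Complex A) (x : LocalizedAddHallAlg T) : Prop :=
  ∃ (X U : Z2Complex A) (y : LocalizedAddHallAlg T), IsExtension M X U ∧
    complexesIn (facClosure T) X ∧ IsAddAcyclic T U ∧ IsFacCls X y ∧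
    y = chi M U • (x * locCls T U)

variable (T) in
lemma exists_isCls (M : Z2Complex A) : ∃ x : LocalizedAddHallAlg T, IsCls M x := by
  obtain ⟨X, U, w, v, h, hX, hU, hU'⟩ := exists_isSES_complexesIn_facClosure T M
  have hU : IsAddAcyclic T U := ⟨hU, hU'⟩
  obtain ⟨y, hy⟩ := exists_isFacCls hX
  obtain ⟨x, hx⟩ := exists_mul_eq (chi_ne_zero M U) hU.isUnit_locCls y
  exact ⟨x, X, U, y, h.isExtension, hX, hU, hy, hx⟩

/-- Dual to `IsFacCls.unique`: the pushout of two embeddings of `M` extends the acyclic cokernel of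
each by the target of the other. Its class is compared by `IsFacCls.extension`. -/
lemma IsCls.unique {M : Z2Complex A} {x x' : LocalizedAddHallAlg T} (h : IsCls M x)
    (h' : IsCls M x') : x = x' := by
  obtain ⟨X, U, y, ⟨⟨i, p, h⟩⟩, hX, hU, hy, hx⟩ := h
  obtain ⟨X', U', y', ⟨⟨i', p', h'⟩⟩, hX', hU', hy', hx'⟩ := h'
  obtain ⟨Y, g, j, q, sq, -, hj⟩ := h.exists_pushout i'
  obtain ⟨q', hq'⟩ := IsSES.exists_of_isPushout sq h'
  have e := (hy.extension hX hU' hq'.isExtension).unique (hy'.extension hX' hU hj.isExtension)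
  have e₁ := locCls_comm hU.mem hU'
  rw [hU'.chi_left h.isExtension, hU.chi_left h'.isExtension, hx, hx'] at e
  refine eq_of_smul_mul_eq (q := chi M U' * chi M U * chi U U') ?_
    (hU.isUnit_locCls.mul hU'.isUnit_locCls) ?_
  · exact mul_ne_zero (mul_ne_zero (chi_ne_zero _ _) (chi_ne_zero _ _)) (chi_ne_zero _ _)
  · calc _ = _ := by
          simp only [smul_mul_assoc, smul_smul, mul_assoc]
          congr 1
          ring
      _ = _ := e
      _ = (chi M U' * chi M U) • (x' * (chi U' U • (locCls T U' * locCls T U))) := by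
          simp only [smul_mul_assoc, mul_smul_comm, smul_smul, mul_assoc]
          congr 1
          ring
      _ = _ := by rw [← e₁, mul_smul_comm, smul_smul]

variable (T) in
/-- The class of a complex in the localized Hall algebra of complexes over `add T`. -/
noncomputable def psi (M : Z2Complex A) : LocalizedAddHallAlg T := (exists_isCls T M).choose

lemma isCls_psi (M : Z2Complex A) : IsCls M (psi T M) := (exists_isCls T M).choose_spec

lemma IsCls.eq_psi {M : Z2Complex A} {x : LocalizedAddHallAlg T} (h : IsCls M x) : x = psi T M :=
  h.unique (isCls_psi M)

lemma isExtension_zero (M : Z2Complex A) : IsExtension M M 0 := by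
  refine ⟨⟨𝟙 M, 0, ?_⟩⟩
  have : Epi (0 : M ⟶ (0 : Z2Complex A)) := (isZero_zero _).epi _
  exact IsSES.mk' comp_zero fun {S} f hf ↦ ⟨S, 𝟙 S, inferInstance, f, by simp⟩

lemma IsFacCls.eq_psi {X : Z2Complex A} {x : LocalizedAddHallAlg T} (h : IsFacCls X x)
    (hX : complexesIn (facClosure T) X) : x = psi T X := by
  refine IsCls.eq_psi ⟨X, 0, x, isExtension_zero X, hX, isAddAcyclic_zero T, h, ?_⟩
  rw [chi_of_isZero _ _ (isZero_zero _), locCls_zero, one_smul, mul_one]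

lemma psi_of_mem {V : Z2Complex A} (h : complexesIn (addClosure T) V) : psi T V = locCls T V :=
  ((IsFacCls.of_mem h).eq_psi (complexesIn_fac_of_add h)).symm

lemma IsAddAcyclic.isUnit_psi {K : Z2Complex A} (hK : IsAddAcyclic T K) : IsUnit (psi T K) := by
  rw [psi_of_mem hK.mem]
  exact hK.isUnit_locCls

lemma isFacCls_psi {X : Z2Complex A} (hX : complexesIn (facClosure T) X) :
    IsFacCls X (psi T X) := by
  obtain ⟨x, hx⟩ := exists_isFacCls hX
  rwa [← hx.eq_psi hX]

lemma psi_of_add {V X K : Z2Complex A} (h : IsExtension K V X) (hK : IsAddAcyclic T K)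
    (hV : complexesIn (addClosure T) V) : psi T V = chi X K • (psi T X * psi T K) := by
  have hX : complexesIn (facClosure T) X := by
    obtain ⟨⟨i, p, h⟩⟩ := h
    exact complexesIn_fac_of_isSES h (complexesIn_fac_of_add hV)
  obtain ⟨x, hx⟩ := exists_mul_eq (chi_ne_zero X K) hK.isUnit_locCls (locCls T V)
  rw [← IsFacCls.eq_psi ⟨K, V, h, hK, hV, hx⟩ hX, psi_of_mem hV, psi_of_mem hK.mem, hx]

lemma psi_of_fac {M X K : Z2Complex A} (h : IsExtension M X K) (hK : IsAddAcyclic T K)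
    (hX : complexesIn (facClosure T) X) : psi T X = chi M K • (psi T M * psi T K) := by
  obtain ⟨x, hx⟩ := exists_mul_eq (chi_ne_zero M K) hK.isUnit_locCls (psi T X)
  rw [← IsCls.eq_psi ⟨X, K, _, h, hX, hK, isFacCls_psi hX, hx⟩, psi_of_mem hK.mem, ← hx]

lemma psi_congr {M N : Z2Complex A} (e : M ≅ N) : psi T M = psi T N := by
  obtain ⟨X, U, y, h, hX, hU, hy, hx⟩ := isCls_psi (T := T) M
  exact IsCls.eq_psi ⟨X, U, y, h.congr e (Iso.refl _) (Iso.refl _), hX, hU, hy, by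
    rwa [← chi_congr e (Iso.refl U)]⟩

end Psi

/-! ### Two-step filtrations -/

section Octahedron

variable {C : Type u} [Category.{v} C] [Abelian C] {D B K Y M X : C}

lemma IsExtension.exists_quot (r : IsExtension K Y B) (s : IsExtension Y M D) :
    ∃ X, IsExtension B X D ∧ IsExtension K M X := by
  obtain ⟨r⟩ := r
  obtain ⟨s⟩ := s
  obtain ⟨X, u, v, -⟩ := exists_compat_quot r s
  exact ⟨X, ⟨u⟩, ⟨v⟩⟩

lemma IsExtension.exists_sub (u : IsExtension B X D) (v : IsExtension K M X) :
    ∃ Y, IsExtension K Y B ∧ IsExtension Y M D := by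
  obtain ⟨u⟩ := u
  obtain ⟨v⟩ := v
  obtain ⟨Y, r, s, -⟩ := exists_compat_sub u v
  exact ⟨Y, ⟨r⟩, ⟨s⟩⟩

end Octahedron

/-! ### Classes of extensions with an acyclic end term -/

section PsiExtension

variable {A : Type u} [Category.{v} A] [Abelian A]

variable [IsFinitary A] [IsHereditary A] {T : A} [IsTilting T]

lemma IsExtension.isAddAcyclic {K L M : Z2Complex A} (h : IsExtension K L M)
    (hK : IsAddAcyclic T K) (hM : IsAddAcyclic T M) : IsAddAcyclic T L := by
  obtain ⟨⟨i, p, h⟩⟩ := h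
  exact .of_isSES h hK hM

variable (T) in
lemma exists_isSES_fac (M : Z2Complex A) : ∃ (X U : Z2Complex A) (i : M ⟶ X) (p : X ⟶ U),
    IsSES i p ∧ complexesIn (facClosure T) X ∧ IsAddAcyclic T U := by
  obtain ⟨X, U, w, v, h, hX, hU, hU'⟩ := exists_isSES_complexesIn_facClosure T M
  exact ⟨X, U, w, v, h, hX, hU, hU'⟩

lemma exists_isSES_add {X : Z2Complex A} (hX : complexesIn (facClosure T) X) :
    ∃ (U V : Z2Complex A) (i : U ⟶ V) (p : V ⟶ X),
    IsSES i p ∧ IsAddAcyclic T U ∧ complexesIn (addClosure T) V := by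
  obtain ⟨U, V, i, p, h, hU, hU', hV⟩ := exists_isSES_complexesIn_addClosure hX
  exact ⟨U, V, i, p, h, ⟨hU, hU'⟩, hV⟩

lemma psi_addAcyclic {K L E : Z2Complex A} (hK : IsAddAcyclic T K) (hL : IsAddAcyclic T L)
    (h : IsExtension L E K) : psi T E = chi K L • (psi T K * psi T L) := by
  rw [psi_of_mem (h.isAddAcyclic hL hK).mem, psi_of_mem hK.mem, psi_of_mem hL.mem]
  exact locCls_extension hK.mem hL (.inl h)

lemma psi_comm_of_add {V K : Z2Complex A} (hV : complexesIn (addClosure T) V)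
    (hK : IsAddAcyclic T K) :
    chi V K • (psi T V * psi T K) = chi K V • (psi T K * psi T V) := by
  rw [psi_of_mem hV, psi_of_mem hK.mem]
  exact locCls_comm hV hK

/-- Classes of acyclic complexes over `add T` commute with all classes up to a scalar. -/
lemma psi_comm {K : Z2Complex A} (hK : IsAddAcyclic T K) (M : Z2Complex A) :
    chi M K • (psi T M * psi T K) = chi K M • (psi T K * psi T M) := by
  -- If `ψ(E)` is a multiple of `ψ(X)ψ(U)` with `U` acyclic over `add T`, commutation with `ψ(K)`
  -- descends from `E` to `X`, because `ψ(U)` is invertible and already commutes with `ψ(K)` up to a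
  -- scalar. This is used from `V` to `X` and from `X` to `M`.
  have key (X U E : Z2Complex A) (q : ℚ) (hq : q ≠ 0) (hU : IsAddAcyclic T U)
      (h : psi T E = q • (psi T X * psi T U)) (h₁ : chi E K = chi X K * chi U K)
      (h₂ : chi K E = chi K X * chi K U)
      (h₃ : chi E K • (psi T E * psi T K) = chi K E • (psi T K * psi T E)) :
      chi X K • (psi T X * psi T K) = chi K X • (psi T K * psi T X) := by
    rw [h, h₁, h₂] at h₃
    have h₄ := psi_comm_of_add hU.mem hK
    refine eq_of_smul_mul_eq (q := q * chi K U) (mul_ne_zero hq (chi_ne_zero _ _)) hU.isUnit_psi ?_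
    calc _ = (q * chi X K) • (psi T X * (chi K U • (psi T K * psi T U))) := by
          simp only [smul_mul_assoc, mul_smul_comm, smul_smul, mul_assoc]
          congr 1
          ring
      _ = (chi X K * chi U K) • (q • (psi T X * psi T U) * psi T K) := by
          rw [← h₄]
          simp only [smul_mul_assoc, mul_smul_comm, smul_smul, mul_assoc]
          congr 1
          ring
      _ = _ := h₃
      _ = _ := by
          simp only [smul_mul_assoc, mul_smul_comm, smul_smul, mul_assoc]
          congr 1
          ring
  obtain ⟨X, U, i, p, h, hX, hU⟩ := exists_isSES_fac T M
  obtain ⟨U', V, i', p', h', hU', hV⟩ := exists_isSES_add hX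
  refine key M U X _ (chi_ne_zero _ _) hU (psi_of_fac h.isExtension hU hX)
    (hK.chi_left h.isExtension) (hK.chi_right h.isExtension) ?_
  exact key X U' V _ (chi_ne_zero _ _) hU' (psi_of_add h'.isExtension hU' hV)
    ((hK.chi_left h'.isExtension).trans (mul_comm _ _))
    ((hK.chi_right h'.isExtension).trans (mul_comm _ _)) (psi_comm_of_add hV hK)

/-- Composing a cover `V ⟶ X` with `X ⟶ X'` gives a cover of `X'`, whose kernel is an extension of
`K` by `U`. The two expressions for `ψ(V)` are compared. -/
lemma psi_sub_of_fac {K X X' : Z2Complex A} (h : IsExtension K X X') (hK : IsAddAcyclic T K)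
    (hX : complexesIn (facClosure T) X) : psi T X = chi X' K • (psi T X' * psi T K) := by
  obtain ⟨U, V, i, p, h', hU, hV⟩ := exists_isSES_add hX
  obtain ⟨N, h₁, h₂⟩ := h.exists_sub h'.isExtension
  have hN := h₁.isAddAcyclic hU hK
  have e₁ := psi_of_add h'.isExtension hU hV
  have e₂ := psi_of_add h₂ hN hV
  rw [psi_addAcyclic hK hU h₁, hU.chi_right' h₁, e₁, hU.chi_left h] at e₂
  refine eq_of_smul_mul_eq (mul_ne_zero (chi_ne_zero _ _) (chi_ne_zero _ _)) hU.isUnit_psi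
    (e₂.trans ?_)
  simp only [smul_mul_assoc, mul_smul_comm, smul_smul, mul_assoc]
  congr 1
  ring

/-- Embed `E` in `X` over `Fac T`. Dividing by `K` embeds `M` in `X / K`, which is still over `Fac
T`, with the same cokernel `U`; this reduces to `psi_sub_of_fac`. -/
lemma psi_sub {K E M : Z2Complex A} (h : IsExtension K E M) (hK : IsAddAcyclic T K) :
    psi T E = chi M K • (psi T M * psi T K) := by
  obtain ⟨X, U, i, p, h', hX, hU⟩ := exists_isSES_fac T E
  obtain ⟨X', h₁, h₂⟩ := h.exists_quot h'.isExtension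
  have hX' : complexesIn (facClosure T) X' := by
    obtain ⟨⟨_, _, h₂⟩⟩ := h₂
    exact complexesIn_fac_of_isSES h₂ hX
  have e := (psi_of_fac h'.isExtension hU hX).symm.trans (psi_sub_of_fac h₂ hK hX)
  have e₁ := psi_comm hK U
  rw [psi_of_fac h₁ hU hX', hU.chi_left h, hK.chi_left h₁] at e
  refine eq_of_smul_mul_eq (mul_ne_zero (chi_ne_zero _ _) (chi_ne_zero _ _)) hU.isUnit_psi
    (e.trans ?_)
  calc _ = (chi M K * chi M U) • (psi T M * (chi U K • (psi T U * psi T K))) := by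
        simp only [smul_mul_assoc, mul_smul_comm, smul_smul, mul_assoc]
        congr 1
        ring
    _ = _ := by
        rw [e₁]
        simp only [smul_mul_assoc, mul_smul_comm, smul_smul, mul_assoc]
        congr 1
        ring

/-- An embedding of `E` in `X` over `Fac T` is also one of `M`, with cokernel an extension of `U` by
`K`; both compute `ψ(X)`. -/
lemma psi_quot {M E K : Z2Complex A} (h : IsExtension M E K) (hK : IsAddAcyclic T K) :
    psi T E = chi M K • (psi T M * psi T K) := by
  obtain ⟨X, U, i, p, h', hX, hU⟩ := exists_isSES_fac T E
  obtain ⟨Q, h₁, h₂⟩ := h.exists_quot h'.isExtension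
  have hQ := h₁.isAddAcyclic hK hU
  have e := (psi_of_fac h'.isExtension hU hX).symm.trans (psi_of_fac h₂ hQ hX)
  have e₁ := psi_comm hU K
  rw [psi_addAcyclic hU hK h₁, ← e₁, hU.chi_left h, hU.chi_left' h₁] at e
  refine eq_of_smul_mul_eq (mul_ne_zero (chi_ne_zero _ _) (chi_ne_zero _ _)) hU.isUnit_psi
    (e.trans ?_)
  simp only [smul_mul_assoc, mul_smul_comm, smul_smul, mul_assoc]
  congr 1
  ring

/-! ### Independence of the extension class -/

section Acyclic

variable (T) in
/-- The class of the middle term of an extension only depends on the outer terms. -/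
def IsMidConst (M K : Z2Complex A) : Prop :=
  ∀ e e' : Ext.{max u v} M K 1, psi T (mid e) = psi T (mid e')

/-- Pushing a class to `K'` multiplies `ψ` of its middle term by `ψ(U)`, which is invertible, and by
a scalar. That scalar does not depend on the class, because χ(-, U) is multiplicative on extensions.
-/
lemma IsMidConst.of_sub_mono {M K K' U : Z2Complex A} {i : K ⟶ K'} {p : K' ⟶ U} (h : IsSES i p)
    (hU : IsAddAcyclic T U) (hc : IsMidConst T M K') : IsMidConst T M K := by
  intro e e'
  have h₁ (e : Ext.{max u v} M K 1) := psi_quot (isExtension_mid_postcomp_mono h e) hU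
  simp only [hU.chi_left (isExtension_mid _)] at h₁
  exact eq_of_smul_mul_eq (mul_ne_zero (chi_ne_zero _ _) (chi_ne_zero _ _)) hU.isUnit_psi
    ((h₁ e).symm.trans ((hc _ _).trans (h₁ e')))

lemma IsMidConst.of_sub_epi {M K K' U : Z2Complex A} {i : U ⟶ K'} {p : K' ⟶ K} (h : IsSES i p)
    (hU : IsAddAcyclic T U) (hc : IsMidConst T M K') : IsMidConst T M K := by
  intro e e'
  have := hU.subsingleton_ext_right M (1 + 1) le_rfl
  obtain ⟨e, rfl⟩ := surjective_postcomp h M 1 e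
  obtain ⟨e', rfl⟩ := surjective_postcomp h M 1 e'
  have h₁ (e : Ext.{max u v} M K' 1) := psi_sub (isExtension_mid_postcomp_epi h e) hU
  simp only [hU.chi_left (isExtension_mid _)] at h₁
  exact eq_of_smul_mul_eq (mul_ne_zero (chi_ne_zero _ _) (chi_ne_zero _ _)) hU.isUnit_psi
    ((h₁ e).symm.trans ((hc _ _).trans (h₁ e')))

lemma IsMidConst.of_quot_mono {M M' K U : Z2Complex A} {i : M ⟶ M'} {p : M' ⟶ U} (h : IsSES i p)
    (hU : IsAddAcyclic T U) (hc : IsMidConst T M' K) : IsMidConst T M K := by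
  intro e e'
  have := hU.subsingleton_ext_left K (1 + 1) le_rfl
  obtain ⟨e, rfl⟩ := surjective_precomp h K 1 e
  obtain ⟨e', rfl⟩ := surjective_precomp h K 1 e'
  have h₁ (e : Ext.{max u v} M' K 1) := psi_quot (isExtension_mid_precomp_mono h e) hU
  simp only [hU.chi_left (isExtension_mid _)] at h₁
  exact eq_of_smul_mul_eq (mul_ne_zero (chi_ne_zero _ _) (chi_ne_zero _ _)) hU.isUnit_psi
    ((h₁ e).symm.trans ((hc _ _).trans (h₁ e')))

lemma IsMidConst.of_quot_epi {M M' K U : Z2Complex A} {i : U ⟶ M'} {p : M' ⟶ M} (h : IsSES i p)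
    (hU : IsAddAcyclic T U) (hc : IsMidConst T M' K) : IsMidConst T M K := by
  intro e e'
  have h₁ (e : Ext.{max u v} M K 1) := psi_sub (isExtension_mid_precomp_epi h e) hU
  simp only [hU.chi_left (isExtension_mid _)] at h₁
  exact eq_of_smul_mul_eq (mul_ne_zero (chi_ne_zero _ _) (chi_ne_zero _ _)) hU.isUnit_psi
    ((h₁ e).symm.trans ((hc _ _).trans (h₁ e')))

variable (T) in
-- Resolving `K` leads to a complex acyclic over `add T`, for which `psi_sub` gives a value not
-- involving the class.
lemma isMidConst_of_acyclic_left {K : Z2Complex A} (hK : K.Acyclic) (M : Z2Complex A) :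
    IsMidConst T M K := by
  obtain ⟨X, U, i, p, h, hX, hU⟩ := exists_isSES_fac T K
  obtain ⟨U', V, i', p', h', hU', hV⟩ := exists_isSES_add hX
  have hV' : IsAddAcyclic T V :=
    ⟨hV, h'.acyclic_mid hU'.acyclic (h.acyclic_mid hK hU.acyclic)⟩
  refine .of_sub_mono h hU (.of_sub_epi h' hU' fun e e' ↦ ?_)
  rw [psi_sub (isExtension_mid e) hV', psi_sub (isExtension_mid e') hV']

variable (T) in
lemma isMidConst_of_acyclic_right {M : Z2Complex A} (hM : M.Acyclic) (K : Z2Complex A) :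
    IsMidConst T M K := by
  obtain ⟨X, U, i, p, h, hX, hU⟩ := exists_isSES_fac T M
  obtain ⟨U', V, i', p', h', hU', hV⟩ := exists_isSES_add hX
  have hV' : IsAddAcyclic T V :=
    ⟨hV, h'.acyclic_mid hU'.acyclic (h.acyclic_mid hM hU.acyclic)⟩
  refine .of_quot_mono h hU (.of_quot_epi h' hU' fun e e' ↦ ?_)
  rw [psi_quot (isExtension_mid e) hV', psi_quot (isExtension_mid e') hV']

variable (T) in
lemma psi_eq_psi_biprod {K E M : Z2Complex A} (h : IsExtension K E M)
    (hKM : K.Acyclic ∨ M.Acyclic) : psi T E = psi T (K ⊞ M) := by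
  obtain ⟨e, ⟨φ⟩⟩ := h.exists_mid
  obtain ⟨φ'⟩ := nonempty_mid_zero_iso K M
  have hc : IsMidConst T M K := hKM.elim (fun hK ↦ isMidConst_of_acyclic_left T hK M)
    (fun hM ↦ isMidConst_of_acyclic_right T hM K)
  rw [psi_congr φ, hc e 0, psi_congr φ']

/-- The class of an acyclic `K` outside `add T` is not directly cancellable here, so `K` is replaced
along its resolution by `V`, acyclic over `add T`. Hypothesis `hχ` makes the scalars on the two
sides agree. -/
lemma psi_cancel {E E' K : Z2Complex A} (hK : K.Acyclic)
    (hχ : ∀ U, IsAddAcyclic T U → chi E U = chi E' U) (h : psi T (E ⊞ K) = psi T (E' ⊞ K)) :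
    psi T E = psi T E' := by
  obtain ⟨X, U, i, p, h₁, hX, hU⟩ := exists_isSES_fac T K
  obtain ⟨U', V, i', p', h₂, hU', hV⟩ := exists_isSES_add hX
  have hV' : IsAddAcyclic T V :=
    ⟨hV, h₂.acyclic_mid hU'.acyclic (h₁.acyclic_mid hK hU.acyclic)⟩
  have e₁ : psi T (E ⊞ X) = psi T (E' ⊞ X) := by
    rw [psi_quot (h₁.biprodMap E).isExtension hU, psi_quot (h₁.biprodMap E').isExtension hU, h,
      chi_biprod_left, chi_biprod_left, hχ U hU]
  have e₂ : psi T (E ⊞ V) = psi T (E' ⊞ V) := by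
    rw [psi_sub (h₂.biprodMap' E).isExtension hU', psi_sub (h₂.biprodMap' E').isExtension hU', e₁,
      chi_biprod_left, chi_biprod_left, hχ U' hU']
  rw [psi_quot (IsSES.biprod E V).isExtension hV', psi_quot (IsSES.biprod E' V).isExtension hV',
    hχ V hV'] at e₂
  exact eq_of_smul_mul_eq (chi_ne_zero _ _) hV'.isUnit_psi e₂

lemma IsSES.graph {C : Type u} [Category.{v} C] [Abelian C] {X Y : C} (f : X ⟶ Y) :
    IsSES (biprod.lift (𝟙 X) f) (biprod.snd - biprod.fst ≫ f) := by
  have h₁ : (biprod.lift (𝟙 X) f) ≫ biprod.fst = 𝟙 X := by simp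
  have h₂ : biprod.inr ≫ (biprod.snd - biprod.fst ≫ f) = 𝟙 Y := by simp
  have : Mono (biprod.lift (𝟙 X) f) := mono_of_mono_fac h₁
  have : Epi (biprod.snd - biprod.fst ≫ f) := epi_of_epi_fac h₂
  refine mk' (by simp) fun {S} t ht ↦ ⟨S, 𝟙 S, inferInstance, t ≫ biprod.fst, ?_⟩
  rw [Preadditive.comp_sub, sub_eq_zero] at ht
  ext <;> simp [ht]

/-- Classes of middle terms are invariant under classes pulled back from an acyclic complex. -/
lemma psi_mid_add {L D Y : Z2Complex A} (hD : D.Acyclic) (f : L ⟶ D) (e : Ext.{max u v} L Y 1)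
    (k : Ext.{max u v} D Y 1) :
    psi T (mid (e + (Ext.mk₀ f).comp k (zero_add 1))) = psi T (mid e) := by
  -- Restricting `ε` to `L` along the inclusion and along the graph of `f` gives the two classes.
  -- Both subobjects have quotient `D`, so both middle terms sit in `mid ε` with acyclic quotient
  -- `D`, which is then cancelled.
  let ε : Ext.{max u v} (L ⊞ D) Y 1 := (Ext.mk₀ biprod.fst).comp e (zero_add 1) +
    (Ext.mk₀ biprod.snd).comp k (zero_add 1)
  have h₁ : (Ext.mk₀ (biprod.inl : L ⟶ L ⊞ D)).comp ε (zero_add 1) = e := by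
    simp only [ε, Ext.comp_add, Ext.mk₀_comp_mk₀_assoc, biprod.inl_fst, biprod.inl_snd,
      Ext.mk₀_id_comp, Ext.mk₀_zero, Ext.zero_comp, add_zero]
  have h₂ : (Ext.mk₀ (biprod.lift (𝟙 L) f)).comp ε (zero_add 1) =
      e + (Ext.mk₀ f).comp k (zero_add 1) := by
    simp only [ε, Ext.comp_add, Ext.mk₀_comp_mk₀_assoc, biprod.lift_fst, biprod.lift_snd,
      Ext.mk₀_id_comp]
  have h₃ := isExtension_mid_precomp_mono (IsSES.biprod L D) ε
  have h₄ := isExtension_mid_precomp_mono (IsSES.graph f) ε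
  rw [h₁] at h₃
  rw [h₂] at h₄
  refine psi_cancel hD (fun U hU ↦ ?_) ?_
  · rw [hU.chi_left (isExtension_mid _), hU.chi_left (isExtension_mid _)]
  · rw [← psi_eq_psi_biprod T h₃ (.inr hD), ← psi_eq_psi_biprod T h₄ (.inr hD)]

end Acyclic

end PsiExtension

/-! ### Averages over finite groups -/

section Average

/-- The average of a function on a finite type. -/
noncomputable def average {G V : Type*} [Fintype G] [AddCommGroup V] [Module ℚ V] (g : G → V) : V :=
  (Nat.card G : ℚ)⁻¹ • ∑ x, g x

variable {G H V : Type*} [AddGroup G] [AddGroup H] [Fintype G] [Fintype H] [AddCommGroup V]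
  [Module ℚ V]

lemma average_comp_of_invariant (f : H →+ G) (g : G → V)
    (h : ∀ x, ∃ a v, x = f a + v ∧ ∀ y, g (y + v) = g y) :
    average g = average fun a ↦ g (f a) := by
  have key := card_smul_sum_eq_card_smul_sum_comp f g h
  rw [← Nat.card_eq_fintype_card, ← Nat.card_eq_fintype_card, ← Nat.cast_smul_eq_nsmul ℚ,
    ← Nat.cast_smul_eq_nsmul ℚ] at key
  have hG : (Nat.card G : ℚ) ≠ 0 := by exact_mod_cast Nat.card_pos.ne'
  have hH : (Nat.card H : ℚ) ≠ 0 := by exact_mod_cast Nat.card_pos.ne'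
  rw [average, average, inv_smul_eq_iff₀ hG, smul_comm, eq_inv_smul_iff₀ hH, key]

lemma average_comp_of_surjective (f : H →+ G) (hf : Function.Surjective f) (g : G → V) :
    average (fun a ↦ g (f a)) = average g :=
  (average_comp_of_invariant f g fun x ↦ by
    obtain ⟨a, rfl⟩ := hf x
    exact ⟨a, 0, (add_zero _).symm, fun y ↦ by rw [add_zero]⟩).symm

lemma average_smul_mul {B : Type*} [Ring B] [Algebra ℚ B] (q : ℚ) (g : G → B) (u : B) :
    average (fun x ↦ q • (g x * u)) = q • (average g * u) := by
  rw [average, average, ← Finset.smul_sum, ← Finset.sum_mul, smul_mul_assoc, smul_comm]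

end Average

/-! ### Multiplicativity of the class -/

section PsiMul

variable {A : Type u} [Category.{v} A] [Abelian A] [IsFinitary A] [IsHereditary A] {T : A}
  [IsTilting T]

variable (T) in
/-- The class of `L` times the class of `N` is given by the Hall product. -/
def IsPsiMul (L N : Z2Complex A) : Prop :=
  average (fun e : Ext.{max u v} L N 1 ↦ psi T (mid e)) = chi L N • (psi T L * psi T N)

section

variable {L L' N N' U : Z2Complex A} (hU : IsAddAcyclic T U)
include hU

/-- Restriction `Ext¹(L', N) ⟶ Ext¹(L, N)` is onto, so it preserves averages, while each middle term
changes by `ψ(U)` and a constant scalar. The formula for `L'` then yields that for `L` on cancelling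
`ψ(U)`. -/
lemma IsPsiMul.of_left_mono {i : L ⟶ L'} {p : L' ⟶ U} (h : IsSES i p) (hm : IsPsiMul T L' N) :
    IsPsiMul T L N := by
  have := hU.subsingleton_ext_left N (1 + 1) le_rfl
  have h₁ (e : Ext.{max u v} L' N 1) := psi_quot (isExtension_mid_precomp_mono h e) hU
  simp only [hU.chi_left (isExtension_mid _)] at h₁
  have h₂ : average (fun e : Ext.{max u v} L' N 1 ↦ psi T (mid e)) =
      (chi N U * chi L U) • (average (fun e : Ext.{max u v} L N 1 ↦ psi T (mid e)) * psi T U) := by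
    rw [funext h₁, average_smul_mul]
    congr 2
    exact average_comp_of_surjective ((Ext.mk₀ i).precomp N (zero_add 1)) (surjective_precomp h N 1)
      (fun e : Ext.{max u v} L N 1 ↦ psi T (mid e))
  have h₃ := psi_comm hU N
  refine eq_of_smul_mul_eq (mul_ne_zero (chi_ne_zero _ _) (chi_ne_zero _ _)) hU.isUnit_psi
    (h₂.symm.trans (hm.trans ?_))
  rw [psi_quot h.isExtension hU, hU.chi_sub h.isExtension]
  calc _ = (chi L N * chi L U) • (psi T L * (chi U N • (psi T U * psi T N))) := by
        simp only [smul_mul_assoc, mul_smul_comm, smul_smul, mul_assoc]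
        congr 1
        ring
    _ = _ := by
        rw [← h₃]
        simp only [smul_mul_assoc, mul_smul_comm, smul_smul, mul_assoc]
        congr 1
        ring

lemma IsPsiMul.of_left_epi {i : U ⟶ L'} {p : L' ⟶ L} (h : IsSES i p)
    [hN : Subsingleton (Ext.{max u v} U N 1)] (hm : IsPsiMul T L' N) : IsPsiMul T L N := by
  have h₁ (e : Ext.{max u v} L N 1) := psi_sub (isExtension_mid_precomp_epi h e) hU
  simp only [hU.chi_left (isExtension_mid _)] at h₁
  have h₂ : average (fun e : Ext.{max u v} L' N 1 ↦ psi T (mid e)) =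
      (chi N U * chi L U) • (average (fun e : Ext.{max u v} L N 1 ↦ psi T (mid e)) * psi T U) := by
    rw [← average_smul_mul, ← funext h₁]
    refine (average_comp_of_surjective ((Ext.mk₀ p).precomp N (zero_add 1)) ?_
      (fun e : Ext.{max u v} L' N 1 ↦ psi T (mid e))).symm
    -- Here the map goes from `Ext¹(L, N)` to `Ext¹(L', N)`, and it is onto because `Ext¹(U, N) =
    -- 0`.
    exact fun x ↦ Ext.contravariant_sequence_exact₂ h.shortExact N x (Subsingleton.elim _ _)
  have h₃ := psi_comm hU N
  refine eq_of_smul_mul_eq (mul_ne_zero (chi_ne_zero _ _) (chi_ne_zero _ _)) hU.isUnit_psi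
    (h₂.symm.trans (hm.trans ?_))
  rw [psi_sub h.isExtension hU, chi_mul_left_of_surjective h N fun x ↦ ⟨0, Subsingleton.elim _ _⟩]
  calc _ = (chi L N * chi L U) • (psi T L * (chi U N • (psi T U * psi T N))) := by
        simp only [smul_mul_assoc, mul_smul_comm, smul_smul, mul_assoc]
        congr 1
        ring
    _ = _ := by
        rw [← h₃]
        simp only [smul_mul_assoc, mul_smul_comm, smul_smul, mul_assoc]
        congr 1
        ring

lemma IsPsiMul.of_right_epi {i : U ⟶ N'} {p : N' ⟶ N} (h : IsSES i p) (hm : IsPsiMul T L N') :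
    IsPsiMul T L N := by
  have := hU.subsingleton_ext_right L (1 + 1) le_rfl
  have h₁ (e : Ext.{max u v} L N' 1) := psi_sub (isExtension_mid_postcomp_epi h e) hU
  simp only [hU.chi_left (isExtension_mid _)] at h₁
  have h₂ : average (fun e : Ext.{max u v} L N' 1 ↦ psi T (mid e)) =
      (chi N U * chi L U) • (average (fun e : Ext.{max u v} L N 1 ↦ psi T (mid e)) * psi T U) := by
    rw [funext h₁, average_smul_mul]
    congr 2
    exact average_comp_of_surjective ((Ext.mk₀ p).postcomp L (add_zero 1))
      (surjective_postcomp h L 1) (fun e : Ext.{max u v} L N 1 ↦ psi T (mid e))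
  refine eq_of_smul_mul_eq (mul_ne_zero (chi_ne_zero _ _) (chi_ne_zero _ _)) hU.isUnit_psi
    (h₂.symm.trans (hm.trans ?_))
  rw [psi_sub h.isExtension hU, hU.chi_right' h.isExtension]
  simp only [smul_mul_assoc, mul_smul_comm, smul_smul, mul_assoc]
  congr 1
  ring

lemma IsPsiMul.of_right_mono {i : N ⟶ N'} {p : N' ⟶ U} (h : IsSES i p) (hm : IsPsiMul T L N') :
    IsPsiMul T L N := by
  have h₁ (e : Ext.{max u v} L N 1) := psi_quot (isExtension_mid_postcomp_mono h e) hU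
  simp only [hU.chi_left (isExtension_mid _)] at h₁
  have h₂ : average (fun e : Ext.{max u v} L N' 1 ↦ psi T (mid e)) =
      (chi N U * chi L U) • (average (fun e : Ext.{max u v} L N 1 ↦ psi T (mid e)) * psi T U) := by
    rw [← average_smul_mul, ← funext h₁]
    -- Pushforward to `Ext¹(L, N')` need not be onto. Modulo its image every class is pulled back
    -- from the disk complex containing `L`, and by `psi_mid_add` such classes are periods of the
    -- averaged function.
    refine average_comp_of_invariant ((Ext.mk₀ i).postcomp L (add_zero 1))
      (fun e : Ext.{max u v} L N' 1 ↦ psi T (mid e)) fun x ↦ ?_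
    obtain ⟨y, hy⟩ := hU.surjective_postcomp h L (x.comp (Ext.mk₀ p) (add_zero 1))
    obtain ⟨a, ha⟩ := Ext.covariant_sequence_exact₂ _ h.shortExact
      (x - (Ext.mk₀ (toDisks L)).comp y (zero_add 1)) (by
        rw [sub_eq_add_neg, Ext.add_comp, Ext.neg_comp]
        exact add_neg_eq_zero.2 hy.symm)
    exact ⟨a, _, (eq_sub_iff_add_eq.1 ha).symm,
      fun z ↦ psi_mid_add (acyclic_disks _ _) (toDisks L) z y⟩
  refine eq_of_smul_mul_eq (mul_ne_zero (chi_ne_zero _ _) (chi_ne_zero _ _)) hU.isUnit_psi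
    (h₂.symm.trans (hm.trans ?_))
  rw [psi_quot h.isExtension hU, hU.chi_left' h.isExtension]
  simp only [smul_mul_assoc, mul_smul_comm, smul_smul, mul_assoc]
  congr 1
  ring

end

lemma isPsiMul_of_mem {L N : Z2Complex A} (hL : complexesIn (addClosure T) L)
    (hN : complexesIn (addClosure T) N) : IsPsiMul T L N := by
  have h₁ (e : Ext.{max u v} L N 1) := psi_of_mem (prop_mid ⟨L, hL⟩ ⟨N, hN⟩ e)
  have h₂ (e : Ext.{max u v} L N 1) := locCls_of_mem (prop_mid ⟨L, hL⟩ ⟨N, hN⟩ e)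
  have h₃ := congrArg (toLocalized (addAcyclicSet T)) (HallAlg.cls_mul_cls ⟨L, hL⟩ ⟨N, hN⟩)
  rw [map_mul, map_smul, map_sum] at h₃
  rw [IsPsiMul, psi_of_mem hL, psi_of_mem hN, locCls_of_mem hL, locCls_of_mem hN, h₃, average, chi,
    smul_smul]
  simp only [h₁, h₂]
  congr 1
  have := card_hom_ne_zero L N
  field_simp

variable (T) in
theorem isPsiMul (L N : Z2Complex A) : IsPsiMul T L N := by
  obtain ⟨X, U, i, p, h, hX, hU⟩ := exists_isSES_fac T L
  obtain ⟨U', V, i', p', h', hU', hV⟩ := exists_isSES_add hX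
  obtain ⟨Y, W, j, q, g, hY, hW⟩ := exists_isSES_fac T N
  obtain ⟨W', Z, j', q', g', hW', hZ⟩ := exists_isSES_add hY
  have := hU'.subsingleton_ext_fac hY
  -- The nesting matters: the cover of `X` is used while the second argument is `Y`, over `Fac T`,
  -- so that `Ext¹(U', Y) = 0`.
  exact .of_right_mono hW g (.of_left_mono hU h (.of_left_epi hU' h' (.of_right_epi hW' g'
    (isPsiMul_of_mem hV hZ))))

lemma isUnit_psi_of_acyclic {K : Z2Complex A} (hK : K.Acyclic) : IsUnit (psi T K) := by
  obtain ⟨X, U, i, p, h₁, hX, hU⟩ := exists_isSES_fac T K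
  obtain ⟨U', V, i', p', h₂, hU', hV⟩ := exists_isSES_add hX
  have hV' : IsAddAcyclic T V :=
    ⟨hV, h₂.acyclic_mid hU'.acyclic (h₁.acyclic_mid hK hU.acyclic)⟩
  have key {x y z : LocalizedAddHallAlg T} {q : ℚ} (hq : q ≠ 0) (hx : IsUnit x) (hz : IsUnit z)
      (h : x = q • (y * z)) : IsUnit y := by
    obtain ⟨z, rfl⟩ := hz
    have : y = q⁻¹ • (x * ↑z⁻¹) := by simp [h, hq]
    rw [this, Algebra.smul_def]
    exact ((IsUnit.mk0 _ (inv_ne_zero hq)).map (algebraMap ℚ _)).mul (hx.mul z⁻¹.isUnit)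
  refine key (chi_ne_zero _ _) ?_ hU.isUnit_psi (psi_quot h₁.isExtension hU)
  exact key (chi_ne_zero _ _) hV'.isUnit_psi hU'.isUnit_psi (psi_sub h₂.isExtension hU')

end PsiMul

/-! ### The two homomorphisms -/

section PsiHom

variable {A : Type u} [Category.{v} A] [Abelian A] [IsFinitary A] [IsHereditary A] (T : A)
  [IsTilting T]

lemma exists_psiHom : ∃ F : ComplexHallAlg A →ₐ[ℚ] LocalizedAddHallAlg T,
    ∀ M, F (complexCls M) = psi T M := by
  obtain ⟨F, hF⟩ := HallAlg.exists_algHom (P := (⊤ : ObjectProperty (Z2Complex A)))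
    (fun M ↦ psi T M.obj) (fun X Y ⟨e⟩ ↦ psi_congr e) (by
      exact (psi_of_mem (isAddAcyclic_zero T).mem).trans locCls_zero) (fun L N ↦ by
      have h := isPsiMul T L.obj N.obj
      rw [IsPsiMul, average, chi, div_eq_mul_inv, mul_comm, mul_smul] at h
      have h₁ := smul_right_injective _ (inv_ne_zero (card_ext_ne_zero L.obj N.obj)) h
      rw [h₁, smul_smul, inv_mul_cancel₀ (card_hom_ne_zero _ _), one_smul])
  exact ⟨F, fun M ↦ hF ⟨M, trivial⟩⟩

lemma exists_psiHom_modified : ∃ F : ModifiedHallAlg A →ₐ[ℚ] LocalizedAddHallAlg T,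
    ∀ M, F (toModifiedHallAlg A (complexCls M)) = psi T M := by
  obtain ⟨F, hF⟩ := exists_psiHom T
  let G : QuotientHallAlg A →ₐ[ℚ] LocalizedAddHallAlg T := RingQuot.liftAlgHom ℚ ⟨F, by
    rintro - - ⟨i, p, h, hK⟩
    rw [hF, hF, psi_eq_psi_biprod T h.isExtension (.inl hK)]⟩
  have hG (x : ComplexHallAlg A) : G (RingQuot.mkAlgHom ℚ (AcyclicRel A) x) = F x :=
    RingQuot.liftAlgHom_mkAlgHom_apply ..
  obtain ⟨H, hH⟩ := Localized.exists_lift (S := acyclicSet A) G (by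
    rintro - ⟨q, K, hq, hK, rfl⟩
    rw [map_smul, hG, hF, Algebra.smul_def]
    exact ((IsUnit.mk0 _ hq).map (algebraMap ℚ _)).mul (isUnit_psi_of_acyclic hK))
  refine ⟨H, fun M ↦ ?_⟩
  rw [toModifiedHallAlg, AlgHom.comp_apply, hH, hG, hF]

lemma exists_inclusion : ∃ φ : AddHallAlg T →ₐ[ℚ] ComplexHallAlg A,
    ∀ X, φ (HallAlg.cls X) = complexCls X.obj :=
  HallAlg.exists_algHom (fun X ↦ complexCls X.obj)
    (fun X Y ⟨e⟩ ↦ HallAlg.cls_eq_of_iso (X := ⟨X.obj, trivial⟩) (Y := ⟨Y.obj, trivial⟩) e)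
    rfl fun L N ↦ HallAlg.cls_mul_cls (P := (⊤ : ObjectProperty (Z2Complex A)))
      ⟨L.obj, trivial⟩ ⟨N.obj, trivial⟩

end PsiHom

/-! ### Acyclic classes in the quotient algebra -/

section Quotient

variable {A : Type u} [Category.{v} A] [Abelian A] [IsFinitary A]

/-- The class of a complex in the quotient of the Hall algebra. -/
noncomputable def quotCls (M : Z2Complex A) : QuotientHallAlg A :=
  RingQuot.mkAlgHom ℚ (AcyclicRel A) (complexCls M)

lemma complexCls_congr {M N : Z2Complex A} (e : M ≅ N) : complexCls M = complexCls N :=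
  HallAlg.cls_eq_of_iso (X := ⟨M, trivial⟩) (Y := ⟨N, trivial⟩) e

lemma quotCls_congr {M N : Z2Complex A} (e : M ≅ N) : quotCls M = quotCls N := by
  rw [quotCls, quotCls, complexCls_congr e]

lemma quotCls_eq_biprod {K E M : Z2Complex A} (h : IsExtension K E M) (hK : K.Acyclic) :
    quotCls E = quotCls (K ⊞ M) := by
  obtain ⟨⟨i, p, h⟩⟩ := h
  exact RingQuot.mkAlgHom_rel ℚ (AcyclicRel.of i p h hK)

/-- The relations identify the classes of all extensions of `M` by `K`, so the Hall product `[M][K]`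
collapses to `[E]` times the number of extension classes divided by `|Hom|`. -/
lemma quotCls_sub {K E M : Z2Complex A} (h : IsExtension K E M) (hK : K.Acyclic) :
    quotCls E = chi M K • (quotCls M * quotCls K) := by
  have h₁ : complexCls M * complexCls K = (Nat.card (M ⟶ K) : ℚ)⁻¹ •
      ∑ e : Ext.{max u v} M K 1, complexCls (mid e) :=
    HallAlg.cls_mul_cls (P := (⊤ : ObjectProperty (Z2Complex A))) ⟨M, trivial⟩ ⟨K, trivial⟩
  have h₂ := congrArg (RingQuot.mkAlgHom ℚ (AcyclicRel A)) h₁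
  rw [map_mul, map_smul, map_sum] at h₂
  have h₃ (e : Ext.{max u v} M K 1) :
      RingQuot.mkAlgHom ℚ (AcyclicRel A) (complexCls (mid e)) = quotCls E :=
    (quotCls_eq_biprod (isExtension_mid e) hK).trans (quotCls_eq_biprod h hK).symm
  simp only [h₃, Finset.sum_const, Finset.card_univ] at h₂
  rw [← Nat.card_eq_fintype_card, ← Nat.cast_smul_eq_nsmul ℚ] at h₂
  rw [quotCls, quotCls, quotCls, h₂, ← quotCls, chi]
  have := card_hom_ne_zero M K
  have := card_ext_ne_zero M K
  rw [smul_smul, smul_smul]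
  field_simp
  rw [one_smul]

lemma quotCls_mem {K : Z2Complex A} (hK : K.Acyclic) : quotCls K ∈ acyclicSet A :=
  ⟨1, K, one_ne_zero, hK, (one_smul _ _).symm⟩

lemma mul_mem_acyclicSet {s t : QuotientHallAlg A} (hs : s ∈ acyclicSet A)
    (ht : t ∈ acyclicSet A) : s * t ∈ acyclicSet A := by
  obtain ⟨q, K, hq, hK, rfl⟩ := hs
  obtain ⟨r, L, hr, hL, rfl⟩ := ht
  refine ⟨q * r * (chi K L)⁻¹, L ⊞ K, mul_ne_zero (mul_ne_zero hq hr)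
    (inv_ne_zero (chi_ne_zero _ _)), acyclic_biprod hL hK, ?_⟩
  change _ = _ • quotCls _
  rw [quotCls_sub (IsSES.biprod L K).isExtension hL, smul_mul_smul_comm, smul_smul, mul_assoc,
    inv_mul_cancel₀ (chi_ne_zero _ _), mul_one]
  rfl

/-- Acyclic classes commute up to scalars. -/
lemma acyclicSet_comm {s t : QuotientHallAlg A} (hs : s ∈ acyclicSet A) (ht : t ∈ acyclicSet A) :
    ∃ c : ℚ, c ≠ 0 ∧ s * t = c • (t * s) := by
  obtain ⟨q, K, hq, hK, rfl⟩ := hs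
  obtain ⟨r, L, hr, hL, rfl⟩ := ht
  refine ⟨(chi K L)⁻¹ * chi L K, mul_ne_zero (inv_ne_zero (chi_ne_zero _ _)) (chi_ne_zero _ _), ?_⟩
  have h : chi K L • (quotCls K * quotCls L) = chi L K • (quotCls L * quotCls K) := by
    rw [← quotCls_sub (IsSES.biprod L K).isExtension hL,
      ← quotCls_sub (IsSES.biprod' L K).isExtension hK]
  change (q • quotCls K) * (r • quotCls L) = _ • ((r • quotCls L) * (q • quotCls K))
  rw [smul_mul_smul_comm, smul_mul_smul_comm, smul_smul, mul_comm r q, mul_comm _ (q * r),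
    ← smul_smul (q * r), ← smul_smul (chi K L)⁻¹ (chi L K), ← h, smul_smul (chi K L)⁻¹,
    inv_mul_cancel₀ (chi_ne_zero _ _), one_smul]

lemma isUnit_toModifiedHallAlg {K : Z2Complex A} (hK : K.Acyclic) :
    IsUnit (toModifiedHallAlg A (complexCls K)) :=
  isUnit_toLocalized (quotCls_mem hK)

end Quotient

/-! ### The comparison isomorphism and the remaining Ore condition -/

section Comparison

variable {A : Type u} [Category.{v} A] [Abelian A] [IsFinitary A] [IsHereditary A] {T : A}
  [IsTilting T]

/-- The relations only cover acyclic subobjects, so the quotient `U` is traded for one. Cover `X` by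
an acyclic `E`, let `K` be the kernel of `E ⟶ U`, and pull back `X ⟶ U` to `E`. The pullback
contains `K` with quotient `X`, and it is `M ⊞ E` because `E ⟶ U` factors through `X`. Compare the
two values of its class, using `[E] = χ(U,K)[U][K]`. -/
lemma exists_quotCls_mul_eq {M X U : Z2Complex A} (h : IsExtension M X U)
    (hX : complexesIn (facClosure T) X) (hU : IsAddAcyclic T U) :
    ∃ K : Z2Complex A, K.Acyclic ∧
      quotCls X * quotCls K = chi M U • (quotCls M * quotCls U * quotCls K) := by
  obtain ⟨⟨w, v, h⟩⟩ := h
  obtain ⟨N, E, j, p, hp, hN, hE', hE⟩ := exists_isSES_approximation hX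
  have := hp.epi
  have := h.epi
  have hK := IsSES.of_epi (p ≫ v)
  have hK' := hK.acyclic_left hE hU.acyclic
  obtain ⟨Q, g, i, q, sq, hi, hQ⟩ := h.exists_pullback (p ≫ v)
  obtain ⟨k, hk⟩ := IsSES.exists_of_isPullback sq hK
  have e₀ : hQ.extClass = 0 := by
    have h₁ := hQ.extClass_naturality h (𝟙 M) g (p ≫ v) (by simpa using hi) sq.w
    rw [Ext.comp_mk₀_id, ← Ext.mk₀_comp_mk₀_assoc] at h₁
    rw [h₁]
    exact (congrArg (fun z ↦ (Ext.mk₀ p).comp z (zero_add 1)) h.shortExact.comp_extClass).trans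
      (by rw [Ext.comp_zero])
  obtain ⟨φ⟩ := hQ.nonempty_iso_biprod e₀
  have e₁ := quotCls_sub hk.isExtension hK'
  rw [quotCls_congr φ, quotCls_sub (IsSES.biprod' M E).isExtension hE,
    quotCls_sub hK.isExtension hK', hU.chi_sub h.isExtension, hU.chi_left' hK.isExtension] at e₁
  refine ⟨_, hK', smul_right_injective _ (mul_ne_zero (chi_ne_zero M (kernel (p ≫ v)))
    (chi_ne_zero U (kernel (p ≫ v)))) (e₁.symm.trans ?_)⟩
  simp only [mul_smul_comm, smul_smul, mul_assoc]
  congr 1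
  ring

namespace TResolution

variable {M : Z2Complex A} (r : TResolution T M)

lemma isAddAcyclic_T₁ : IsAddAcyclic T r.T₁.obj :=
  ⟨r.T₁.property, r.isSES_u.acyclic_left_of_quasiIso r.quasiIso_u₀⟩

lemma isAddAcyclic_T₂ : IsAddAcyclic T r.T₂.obj :=
  ⟨r.T₂.property, r.isSES_wv.acyclic_right_of_quasiIso r.quasiIso_w⟩

lemma isAddAcyclic_sum : IsAddAcyclic T r.sum.obj :=
  r.isAddAcyclic_T₁.biprod r.isAddAcyclic_T₂

/-- After localization the auxiliary class of `exists_quotCls_mul_eq` cancels, giving `[X] =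
χ(M,T₂)[M][T₂]`. This is inserted in `[T₀] = χ(X,T₁)[X][T₁]`; the factor χ(T₂,T₁) in χ(X,T₁) turns
`[T₂][T₁]` into `[T₁ ⊕ T₂]`. -/
lemma toModifiedHallAlg_eq : toModifiedHallAlg A (complexCls r.T₀.obj) =
    chi M r.sum.obj • (toModifiedHallAlg A (complexCls M) *
      toModifiedHallAlg A (complexCls r.sum.obj)) := by
  have h₁ := r.isAddAcyclic_T₁
  have h₂ := r.isAddAcyclic_T₂
  obtain ⟨K, hK, e⟩ := exists_quotCls_mul_eq r.isSES_wv.isExtension r.prop_X h₂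
  have e₁ := congrArg (toLocalized (acyclicSet A)) e
  rw [map_mul, map_smul, map_mul, ← smul_mul_assoc] at e₁
  have e₂ := (isUnit_toLocalized (quotCls_mem hK)).mul_left_injective e₁
  have e₃ := congrArg (toLocalized (acyclicSet A)) (quotCls_sub r.isSES_u.isExtension h₁.acyclic)
  have e₄ := congrArg (toLocalized (acyclicSet A))
    (quotCls_sub (IsSES.biprod r.T₁.obj r.T₂.obj).isExtension h₁.acyclic)
  rw [map_smul, map_mul, e₂, h₁.chi_left r.isSES_wv.isExtension, map_mul] at e₃
  rw [map_smul, map_mul] at e₄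
  have e₅ : chi M r.sum.obj = chi M r.T₁.obj * chi M r.T₂.obj := chi_biprod_right _ _ _
  refine e₃.trans (Eq.trans ?_ (congrArg (fun z ↦ chi M r.sum.obj •
    (toModifiedHallAlg A (complexCls M) * z)) e₄).symm)
  rw [e₅]
  change _ = _ • (toLocalized (acyclicSet A) (quotCls M) * _)
  simp only [smul_mul_assoc, mul_smul_comm, smul_smul, mul_assoc]
  congr 1
  ring

end TResolution

lemma eulerForm_eq_chi {K : Z2Complex A} (hK : IsAddAcyclic T K) (M : Z2Complex A) :
    eulerForm M K = chi M K := by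
  rw [eulerForm, finprod_eq_prod_of_mulSupport_subset (s := {0, 1})]
  · rw [Finset.prod_pair zero_ne_one, card_ext_zero, chi, pow_zero, zpow_one, pow_one, zpow_neg_one,
      div_eq_mul_inv]
  · intro n hn
    by_contra h
    simp only [Finset.coe_insert, Finset.coe_singleton, Set.mem_insert_iff, Set.mem_singleton_iff,
      not_or] at h
    have := hK.subsingleton_ext_right M n (by omega)
    refine hn ?_
    have : Nat.card (Ext.{max u v} M K n) = 1 := Nat.card_unique
    simp only [this, Nat.cast_one, one_zpow]

/-- Up to acyclic classes, every element of the quotient algebra comes from the complexes over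
`add T`. -/
lemma exists_mul_eq_inclusion {φ : AddHallAlg T →ₐ[ℚ] ComplexHallAlg A}
    (hφ : ∀ X, φ (HallAlg.cls X) = complexCls X.obj)
    (hS : ∀ t ∈ addAcyclicSet T, RingQuot.mkAlgHom ℚ (AcyclicRel A) (φ t) ∈ acyclicSet A)
    (a : QuotientHallAlg A) : ∃ t ∈ addAcyclicSet T, ∃ u ∈ acyclicSet A, ∃ b : AddHallAlg T,
      a * RingQuot.mkAlgHom ℚ (AcyclicRel A) (φ t) * u =
        RingQuot.mkAlgHom ℚ (AcyclicRel A) (φ b) * u := by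
  have hT := isRightLocalization_addAcyclicSet T
  obtain ⟨x, rfl⟩ := RingQuot.mkAlgHom_surjective ℚ (AcyclicRel A) a
  refine HallAlg.cls_induction x ?_ (fun x y hx hy ↦ ?_) (fun q x hx ↦ ?_) fun M ↦ ?_
  · exact ⟨1, hT.one_mem, _, quotCls_mem (isAddAcyclic_zero T).acyclic, 0, by simp⟩
  · obtain ⟨t, ht, u, hu, b, h₁⟩ := hx
    obtain ⟨t', ht', u', hu', b', h₂⟩ := hy
    have hs := hS t ht
    have hs' := hS t' ht'
    obtain ⟨c, hc, e₁⟩ := acyclicSet_comm hs' hu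
    obtain ⟨d, hd, e₂⟩ := acyclicSet_comm hs hs'
    obtain ⟨d', hd', e₃⟩ := acyclicSet_comm (mul_mem_acyclicSet hs hu) hu'
    -- A common denominator for the sum: `t` and `t'`, and likewise the auxiliary factors, are moved
    -- past each other at the cost of nonzero scalars, of which only `d` survives in the numerator.
    refine ⟨t * t', hT.mul_mem ht ht', u * u', mul_mem_acyclicSet hu hu', b * t' + d • (b' * t), ?_⟩
    simp only [map_add, map_mul, map_smul, add_mul]
    generalize RingQuot.mkAlgHom ℚ (AcyclicRel A) (φ t) = s at *
    generalize RingQuot.mkAlgHom ℚ (AcyclicRel A) (φ t') = s' at *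
    congr 1
    · calc _ = RingQuot.mkAlgHom ℚ (AcyclicRel A) x * s * (s' * u) * u' := by
            simp only [mul_assoc]
        _ = c • (RingQuot.mkAlgHom ℚ (AcyclicRel A) x * s * u * s' * u') := by
            rw [e₁]
            simp only [mul_smul_comm, smul_mul_assoc, mul_assoc]
        _ = RingQuot.mkAlgHom ℚ (AcyclicRel A) (φ b) * (c • (u * s')) * u' := by
            rw [h₁]
            simp only [mul_smul_comm, smul_mul_assoc, mul_assoc]
        _ = _ := by
            rw [← e₁]
            simp only [mul_assoc]
    · calc _ = RingQuot.mkAlgHom ℚ (AcyclicRel A) y * (s * s') * u * u' := by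
            simp only [mul_assoc]
        _ = d • (RingQuot.mkAlgHom ℚ (AcyclicRel A) y * s' * (s * u * u')) := by
            rw [e₂]
            simp only [mul_smul_comm, smul_mul_assoc, mul_assoc]
        _ = d • d' • (RingQuot.mkAlgHom ℚ (AcyclicRel A) y * s' * u' * (s * u)) := by
            rw [e₃]
            simp only [mul_smul_comm, mul_assoc]
        _ = d • (RingQuot.mkAlgHom ℚ (AcyclicRel A) (φ b') * (d' • (u' * (s * u)))) := by
            rw [h₂]
            simp only [mul_smul_comm, mul_assoc]
        _ = _ := by
            rw [← e₃]
            simp only [smul_mul_assoc, mul_assoc]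
  · obtain ⟨t, ht, u, hu, b, h⟩ := hx
    refine ⟨t, ht, u, hu, q • b, ?_⟩
    simp only [map_smul, smul_mul_assoc, h]
  · obtain ⟨r⟩ := nonempty_tResolution T M.obj
    have h₁ := r.isAddAcyclic_T₁
    have h₂ := r.isAddAcyclic_T₂
    obtain ⟨K, hK, e⟩ := exists_quotCls_mul_eq r.isSES_wv.isExtension r.prop_X h₂
    have e₁ := quotCls_sub r.isSES_u.isExtension h₁.acyclic
    obtain ⟨c, hc, e₂⟩ := acyclicSet_comm (quotCls_mem h₁.acyclic) (quotCls_mem hK)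
    have hq := mul_ne_zero (chi_ne_zero r.X r.T₁.obj) (chi_ne_zero M.obj r.T₂.obj)
    -- For a single class the denominator is read off a resolution, and the extra factor is the
    -- acyclic class supplied by `exists_quotCls_mul_eq`.
    refine ⟨HallAlg.cls r.T₂ * HallAlg.cls r.T₁, hT.mul_mem h₂.cls_mem h₁.cls_mem, quotCls K,
      quotCls_mem hK, (chi r.X r.T₁.obj * chi M.obj r.T₂.obj)⁻¹ • HallAlg.cls r.T₀, ?_⟩
    rw [map_mul, map_mul, map_smul, map_smul, hφ, hφ, hφ, smul_mul_assoc, eq_inv_smul_iff₀ hq]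
    change _ • (quotCls M.obj * (quotCls r.T₂.obj * quotCls r.T₁.obj) * quotCls K) =
      quotCls r.T₀.obj * quotCls K
    symm
    calc _ = chi r.X r.T₁.obj • (quotCls r.X * (quotCls r.T₁.obj * quotCls K)) := by
          rw [e₁, smul_mul_assoc, mul_assoc]
      _ = (chi r.X r.T₁.obj * c) • (quotCls r.X * quotCls K * quotCls r.T₁.obj) := by
          rw [e₂]
          simp only [mul_smul_comm, smul_smul, mul_assoc]
      _ = (chi r.X r.T₁.obj * chi M.obj r.T₂.obj) • (quotCls M.obj * quotCls r.T₂.obj *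
            (c • (quotCls K * quotCls r.T₁.obj))) := by
          rw [e]
          simp only [smul_mul_assoc, mul_smul_comm, smul_smul, mul_assoc]
          congr 1
          ring
      _ = _ := by
          rw [← e₂]
          simp only [mul_assoc]

variable (T) in
theorem exists_comparison {φ : AddHallAlg T →ₐ[ℚ] ComplexHallAlg A}
    (hφ : ∀ X, φ (HallAlg.cls X) = complexCls X.obj) :
    ∃ Φ : LocalizedAddHallAlg T ≃ₐ[ℚ] ModifiedHallAlg A,
      (∀ x, Φ (toLocalized (addAcyclicSet T) x) = toModifiedHallAlg A (φ x)) ∧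
      ∀ M, Φ.symm (toModifiedHallAlg A (complexCls M)) = psi T M := by
  obtain ⟨F, hF⟩ := Localized.exists_lift (S := addAcyclicSet T)
    ((toModifiedHallAlg A).comp φ) (by
      rintro - ⟨q, K, hq, hK, rfl⟩
      rw [map_smul, AlgHom.comp_apply, hφ, Algebra.smul_def]
      exact ((IsUnit.mk0 _ hq).map (algebraMap ℚ _)).mul (isUnit_toModifiedHallAlg hK))
  obtain ⟨G, hG⟩ := exists_psiHom_modified T
  have hF' {V : Z2Complex A} (hV : complexesIn (addClosure T) V) :
      F (psi T V) = toModifiedHallAlg A (complexCls V) := by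
    rw [psi_of_mem hV, locCls_of_mem hV, hF, AlgHom.comp_apply, hφ]
  have h₁ : F.comp G = AlgHom.id ℚ _ := by
    refine Localized.hom_ext fun a ↦ ?_
    obtain ⟨x, rfl⟩ := RingQuot.mkAlgHom_surjective ℚ (AcyclicRel A) a
    suffices (F.comp G).comp (toModifiedHallAlg A) = toModifiedHallAlg A from
      DFunLike.congr_fun this x
    refine HallAlg.hom_ext fun M ↦ ?_
    change F (G (toModifiedHallAlg A (complexCls M.obj))) = toModifiedHallAlg A (complexCls M.obj)
    obtain ⟨r⟩ := nonempty_tResolution T M.obj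
    have e := r.toModifiedHallAlg_eq
    have e' := congrArg (fun z ↦ F (G z)) e
    simp only [map_smul, map_mul, hG] at e'
    rw [hF' r.T₀.property, hF' r.sum.property, e] at e'
    rw [hG]
    -- The endomorphism `F ∘ G` fixes classes over `add T`, so the resolution formula forces it to
    -- fix `[M]`, as `[T₁ ⊕ T₂]` is invertible.
    exact (eq_of_smul_mul_eq (chi_ne_zero _ _)
      (isUnit_toModifiedHallAlg r.isAddAcyclic_sum.acyclic) e').symm
  have h₂ : G.comp F = AlgHom.id ℚ _ := by
    refine Localized.hom_ext fun a ↦ ?_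
    suffices (G.comp F).comp (toLocalized _) = toLocalized (addAcyclicSet T) from
      DFunLike.congr_fun this a
    refine HallAlg.hom_ext fun V ↦ ?_
    change G (F (toLocalized _ (HallAlg.cls V))) = _
    rw [hF, AlgHom.comp_apply, hφ, hG, psi_of_mem V.property, locCls_of_mem V.property]
  exact ⟨AlgEquiv.ofAlgHom F G h₁ h₂, hF, hG⟩

/-- Acyclic classes over `A` are not shown to be normal. Fractions are transported from `add T`
through the isomorphism, and the kernel is found by first moving an element into the image of the
Hall algebra of `add T`. -/
theorem isRightLocalization_acyclicSet (T : A) [IsTilting T] :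
    IsRightLocalization (acyclicSet A) (toLocalized (acyclicSet A)) := by
  obtain ⟨φ, hφ⟩ := exists_inclusion T
  obtain ⟨Φ, hΦ, -⟩ := exists_comparison T hφ
  have hT := isRightLocalization_addAcyclicSet T
  have hS : ∀ t ∈ addAcyclicSet T, RingQuot.mkAlgHom ℚ (AcyclicRel A) (φ t) ∈ acyclicSet A := by
    rintro - ⟨q, K, hq, hK, rfl⟩
    exact ⟨q, K.obj, hq, hK, by rw [map_smul, map_smul, hφ]⟩
  refine ⟨?_, mul_mem_acyclicSet, isUnit_toLocalized, fun x ↦ ?_, fun a b ↦ ⟨fun h ↦ ?_, ?_⟩⟩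
  · exact ⟨1, 0, one_ne_zero, (isAddAcyclic_zero T).acyclic,
      ((one_smul _ _).trans (map_one (RingQuot.mkAlgHom ℚ (AcyclicRel A)))).symm⟩
  · obtain ⟨a, s, hs, h⟩ := hT.exists_fraction (Φ.symm x)
    refine ⟨RingQuot.mkAlgHom ℚ (AcyclicRel A) (φ a), _, hS s hs, ?_⟩
    have := congrArg Φ h
    rwa [map_mul, AlgEquiv.apply_symm_apply, hΦ, hΦ] at this
  -- If `a - b` dies in the localization, so does its counterpart `c` over `add T`. Then `c` is
  -- killed by some `t'`, and commuting `t'` past `u` up to a scalar shows that `t u t'` kills `a -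
  -- b`.
  · obtain ⟨t, ht, u, hu, c, hc⟩ := exists_mul_eq_inclusion hφ hS (a - b)
    have h₁ : toLocalized (acyclicSet A) (RingQuot.mkAlgHom ℚ (AcyclicRel A) (φ c)) = 0 := by
      rw [← (isUnit_toLocalized hu).mul_left_eq_zero, ← map_mul, ← hc, map_mul, map_mul, map_sub, h,
        sub_self, zero_mul, zero_mul]
    have h₂ : toLocalized (addAcyclicSet T) c = toLocalized (addAcyclicSet T) 0 := by
      apply Φ.injective
      rw [hΦ, map_zero, map_zero]
      exact h₁
    obtain ⟨t', ht', h₃⟩ := (hT.map_eq_iff c 0).1 h₂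
    obtain ⟨q, hq, h₄⟩ := acyclicSet_comm hu (hS t' ht')
    refine ⟨_, mul_mem_acyclicSet (mul_mem_acyclicSet (hS t ht) hu) (hS t' ht'), ?_⟩
    rw [← sub_eq_zero, ← sub_mul, ← mul_assoc, ← mul_assoc, hc, mul_assoc, h₄, mul_smul_comm,
      ← mul_assoc, ← map_mul, ← map_mul, h₃, zero_mul, map_zero, map_zero, zero_mul, smul_zero]
  · rintro ⟨t, ht, h⟩
    have := congrArg (toLocalized (acyclicSet A)) h
    rwa [map_mul, map_mul, (isUnit_toLocalized ht).mul_left_inj] at this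

end Comparison

end ModifiedHall

open ModifiedHall in
theorem theorem5p14 {k : Type w} [Field k] [Finite k] {A : Type u} [Category.{v} A] [Abelian A]
    [Linear k A] [IsFinitary A] [IsHereditary A] (T : A) [IsTilting T] :
    IsRightLocalization (addAcyclicSet T) (toLocalized (addAcyclicSet T)) ∧
    IsRightLocalization (acyclicSet A) (toLocalized (acyclicSet A)) ∧
    ∃ φ : AddHallAlg T →ₐ[ℚ] ComplexHallAlg A,
      (∀ X, φ (HallAlg.cls X) = complexCls X.obj) ∧
      ∃ Φ : LocalizedAddHallAlg T ≃ₐ[ℚ] ModifiedHallAlg A,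
        (∀ x, Φ (toLocalized (addAcyclicSet T) x) = toModifiedHallAlg A (φ x)) ∧
        (∀ M : Z2Complex A, Nonempty (TResolution T M)) ∧
        ∀ (M : Z2Complex A) (r : TResolution T M),
          IsUnit (toLocalized (addAcyclicSet T) (HallAlg.cls r.sum)) ∧
          Φ.symm (toModifiedHallAlg A (complexCls M)) =
            (eulerForm M r.sum.obj)⁻¹ •
              (toLocalized (addAcyclicSet T) (HallAlg.cls r.T₀) *
                Ring.inverse (toLocalized (addAcyclicSet T) (HallAlg.cls r.sum))) := by
  obtain ⟨φ, hφ⟩ := exists_inclusion T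
  obtain ⟨Φ, hΦ, hΦ'⟩ := exists_comparison T hφ
  refine ⟨isRightLocalization_addAcyclicSet T, isRightLocalization_acyclicSet T, φ, hφ, Φ, hΦ,
    nonempty_tResolution T, fun M r ↦ ?_⟩
  have hu : IsUnit (toLocalized (addAcyclicSet T) (HallAlg.cls r.sum)) :=
    isUnit_toLocalized r.isAddAcyclic_sum.cls_mem
  have hV (V : (complexesIn (addClosure T)).FullSubcategory) :
      Φ.symm (toModifiedHallAlg A (complexCls V.obj)) =
        toLocalized (addAcyclicSet T) (HallAlg.cls V) := by
    rw [← hφ, ← hΦ, AlgEquiv.symm_apply_apply]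
  -- Pulled back along `Φ`, the resolution formula involves only classes over `add T` apart from
  -- `[M]`, and can be solved for the latter.
  have e := congrArg Φ.symm r.toModifiedHallAlg_eq
  rw [map_smul, map_mul, hV, hV] at e
  refine ⟨hu, ?_⟩
  rw [eulerForm_eq_chi r.isAddAcyclic_sum, e, smul_mul_assoc, smul_smul,
    inv_mul_cancel₀ (chi_ne_zero _ _), one_smul, Ring.mul_inverse_cancel_right _ _ hu]
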